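/- Let $A$ be a Hopf algebra over $\mathbb{C}$ with coproduct $\Delta$, counit $\varepsilon$ and bijective antipode. *Quantum homogeneous spaces.* A quantum homogeneous $A$-space is a subalgebra $B\subseteq A$ with $\Delta(B)\subseteq A\otimes B$ and $B^+A=AB^+$, where $B^+:=B\cap\ker\varepsilon$, such that $A$ is faithfully flat as a right $B$-module (the functor $A\otimes_B-$ preserves and reflects exact sequences of left $B$-modules). Then $\pi_B(A):=A/B^+A$ is a quotient Hopf algebra of $A$; write $\pi_B:A\to\pi_B(A)$ for the projection. *Principal pairs.* A principal pair $(B,P)$ consists of quantum homogeneous $A$-spaces $B\subseteq P$ such that $\pi_B(P)$ is a Hopf subalgebra of $\pi_B(A)$. Then $\Delta_R:=(\mathrm{id}\otimes\pi_B)\circ\Delta$ restricts to a right $\pi_B(P)$-coaction $P\to P\otimes\pi_B(P)$. *Categories.* ${}^A_B\mathrm{Mod}$ is the category of left $B$-modules $N$ with a left $A$-coaction $\Delta_L$ satisfying $\Delta_L(bn)=\Delta(b)\Delta_L(n)$; morphisms are the $B$-linear $A$-colinear maps. ${}^A_P\mathrm{Mod}^{\pi_B(P)}$ is the category of left $P$-modules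 $M$ with a left $A$-coaction $\Delta_L$ and a right $\pi_B(P)$-coaction $\Delta_R$ which make $M$ an $(A,\pi_B(P))$-bicomodule and satisfy $\Delta_L(pm)=\Delta(p)\Delta_L(m)$ and $\Delta_R(pm)=\Delta_R(p)\Delta_R(m)$; morphisms are the linear maps compatible with all three structures. ${}^{\pi_B}\mathrm{Mod}$ is the category of left $\pi_B(A)$-comodules. *Functors.* For $M$ in ${}^A_P\mathrm{Mod}^{\pi_B(P)}$ let $M^{\mathrm{co}(\pi_B(P))}=\{m\in M:\Delta_R(m)=m\otimes 1\}$, with the restricted $B$-action and $A$-coaction, as an object of ${}^A_B\mathrm{Mod}$. For $N$ in ${}^A_B\mathrm{Mod}$ let $P\otimes_B N$ have the $P$-action on the first factor, the left $A$-coaction $p\otimes n\mapsto p_{(1)}n_{(-1)}\otimes(p_{(2)}\otimes n_{(0)})$ and the right coaction $\Delta_R\otimes\mathrm{id}$, that is, $p\otimes n\mapsto (p_{(1)}\otimes n)\otimes\pi_B(p_{(2)})$. On morphisms the two functors act by restriction and by $f\mapsto\mathrm{id}\otimes f$. Let $\Phi:{}^A_B\mathrm{Mod}\to{}^{\pi_B}\mathrm{Mod}$,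 $\Phi(N)=N/B^+N$, with coaction $[n]\mapsto\pi_B(n_{(-1)})\otimes[n_{(0)}]$, and $\Psi:{}^{\pi_B}\mathrm{Mod}\to{}^A_B\mathrm{Mod}$, $\Psi(V)=A\,\square_{\pi_B(A)}V$ (cotensor product), with $B$-action and $A$-coaction on the first factor. **Statement.** Let $(B,P)$ be a principal pair. 1. The functors $P\otimes_B-$ (left adjoint) and $(-)^{\mathrm{co}(\pi_B(P))}$ (right adjoint) form an adjoint equivalence between ${}^A_B\mathrm{Mod}$ and ${}^A_P\mathrm{Mod}^{\pi_B(P)}$, with unit $N\to(P\otimes_BN)^{\mathrm{co}(\pi_B(P))}$, $n\mapsto 1\otimes n$, and counit $P\otimes_BM^{\mathrm{co}(\pi_B(P))}\to M$, $p\otimes m\mapsto pm$. 2. The functors $\Phi\circ(-)^{\mathrm{co}(\pi_B(P))}$ and $(P\otimes_B-)\circ\Psi$ are mutually quasi-inverse and give an equivalence between ${}^A_P\mathrm{Mod}^{\pi_B(P)}$ and the category ${}^{\pi_B}\mathrm{Mod}$ of left $\pi_B(A)$-comodules. -/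

import Mathlib

open TensorProduct CategoryTheory

set_option linter.unusedSectionVars false

universe u

namespace HopfPair

section Generic

variable {k : Type*} [Field k]

/-- The factorisation of a linear map `g : X → Z` through an injective linear map `j : Y → Z`
whose range contains the range of `g`. -/
noncomputable def liftInj {X Y Z : Type*} [AddCommGroup X] [Module k X] [AddCommGroup Y]
    [Module k Y] [AddCommGroup Z] [Module k Z] (j : Y →ₗ[k] Z) (hj : Function.Injective j)
    (g : X →ₗ[k] Z) (hg : ∀ x, g x ∈ LinearMap.range j) : X →ₗ[k] Y :=
  (LinearEquiv.ofInjective j hj).symm.toLinearMap ∘ₗ g.codRestrict (LinearMap.range j) hg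

theorem liftInj_spec {X Y Z : Type*} [AddCommGroup X] [Module k X] [AddCommGroup Y]
    [Module k Y] [AddCommGroup Z] [Module k Z] (j : Y →ₗ[k] Z) (hj : Function.Injective j)
    (g : X →ₗ[k] Z) (hg : ∀ x, g x ∈ LinearMap.range j) (x : X) :
    j (liftInj j hj g hg x) = g x := by
  have := (LinearEquiv.ofInjective j hj).apply_symm_apply (g.codRestrict (LinearMap.range j) hg x)
  exact congrArg Subtype.val this

theorem lTensor_inj {X Y : Type*} (Q : Type*) [AddCommGroup X] [Module k X] [AddCommGroup Y]
    [Module k Y] [AddCommGroup Q] [Module k Q] {f : X →ₗ[k] Y} (hf : Function.Injective f) :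
    Function.Injective (f.lTensor Q) :=
  Module.Flat.lTensor_preserves_injective_linearMap f hf

theorem rTensor_inj {X Y : Type*} (Q : Type*) [AddCommGroup X] [Module k X] [AddCommGroup Y]
    [Module k Y] [AddCommGroup Q] [Module k Q] {f : X →ₗ[k] Y} (hf : Function.Injective f) :
    Function.Injective (f.rTensor Q) :=
  Module.Flat.rTensor_preserves_injective_linearMap f hf

theorem map_inj {X Y X' Y' : Type*} [AddCommGroup X] [Module k X] [AddCommGroup Y]
    [Module k Y] [AddCommGroup X'] [Module k X'] [AddCommGroup Y'] [Module k Y']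
    {f : X →ₗ[k] Y} {g : X' →ₗ[k] Y'} (hf : Function.Injective f) (hg : Function.Injective g) :
    Function.Injective (TensorProduct.map f g) := by
  rw [← LinearMap.lTensor_comp_rTensor]
  exact (lTensor_inj _ hg).comp (rTensor_inj _ hf)

theorem mem_range_lTensor {X Y Z : Type*} (Q : Type*) [AddCommGroup X] [Module k X]
    [AddCommGroup Y] [Module k Y] [AddCommGroup Z] [Module k Z] [AddCommGroup Q] [Module k Q]
    {f : X →ₗ[k] Y} {g : Y →ₗ[k] Z} (h : Function.Exact f g) {x : Q ⊗[k] Y}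
    (hx : g.lTensor Q x = 0) : x ∈ LinearMap.range (f.lTensor Q) :=
  (Module.Flat.lTensor_exact Q h x).1 hx

theorem mem_range_rTensor {X Y Z : Type*} (Q : Type*) [AddCommGroup X] [Module k X]
    [AddCommGroup Y] [Module k Y] [AddCommGroup Z] [Module k Z] [AddCommGroup Q] [Module k Q]
    {f : X →ₗ[k] Y} {g : Y →ₗ[k] Z} (h : Function.Exact f g) {x : Y ⊗[k] Q}
    (hx : g.rTensor Q x = 0) : x ∈ LinearMap.range (f.rTensor Q) :=
  (Module.Flat.rTensor_exact Q h x).1 hx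

/-- The map `δ : M → C ⊗ M` is a (coassociative, counital) left coaction of the coalgebra `C`. -/
structure IsLeftCoaction (C : Type*) {M : Type*} [AddCommGroup C] [Module k C] [Coalgebra k C]
    [AddCommGroup M] [Module k M] (δ : M →ₗ[k] C ⊗[k] M) : Prop where
  coassoc : ∀ m, TensorProduct.assoc k C C M ((Coalgebra.comul (R := k)).rTensor M (δ m)) =
    δ.lTensor C (δ m)
  counit : ∀ m, (Coalgebra.counit (R := k)).rTensor M (δ m) = 1 ⊗ₜ m

/-- The map `δ : M → M ⊗ C` is a (coassociative, counital) right coaction of the coalgebra `C`. -/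
structure IsRightCoaction (C : Type*) {M : Type*} [AddCommGroup C] [Module k C] [Coalgebra k C]
    [AddCommGroup M] [Module k M] (δ : M →ₗ[k] M ⊗[k] C) : Prop where
  coassoc : ∀ m, TensorProduct.assoc k M C C (δ.rTensor C (δ m)) =
    (Coalgebra.comul (R := k)).lTensor M (δ m)
  counit : ∀ m, (Coalgebra.counit (R := k)).lTensor M (δ m) = m ⊗ₜ 1

/-- The action of the algebra `R` on the module `M`, as a bilinear map. -/
noncomputable def act (k : Type*) [Field k] (R M : Type*) [Ring R] [Algebra k R] [AddCommGroup M]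
    [Module k M] [Module R M] [IsScalarTower k R M] : R →ₗ[k] M →ₗ[k] M :=
  (Algebra.lsmul k k M).toLinearMap

@[simp]
theorem act_apply {R M : Type*} [Ring R] [Algebra k R] [AddCommGroup M]
    [Module k M] [Module R M] [IsScalarTower k R M] (r : R) (m : M) : act k R M r m = r • m := rfl

section SubCoalgebra

variable {C V : Type*} [AddCommGroup C] [Module k C] [Coalgebra k C] [AddCommGroup V] [Module k V]
  {j : V →ₗ[k] C} {δ : V →ₗ[k] V ⊗[k] V}

theorem sub_coassoc (hj : Function.Injective j)
    (hδ : ∀ v, TensorProduct.map j j (δ v) = Coalgebra.comul (R := k) (j v)) :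
    TensorProduct.assoc k V V V ∘ₗ δ.rTensor V ∘ₗ δ = δ.lTensor V ∘ₗ δ := by
  refine LinearMap.ext fun t => map_inj hj (map_inj hj hj) ?_
  have h1 : ∀ z : V ⊗[k] V, TensorProduct.map j (TensorProduct.map j j)
      (TensorProduct.assoc k V V V (δ.rTensor V z)) =
      TensorProduct.assoc k C C C ((Coalgebra.comul (R := k)).rTensor C
        (TensorProduct.map j j z)) := by
    intro z
    induction z with
    | zero => simp
    | add z z' hz hz' => simp only [map_add, hz, hz']
    | tmul x y =>
      rw [LinearMap.rTensor_tmul, TensorProduct.map_tmul, LinearMap.rTensor_tmul, ← hδ]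
      generalize δ x = w
      induction w with
      | zero => simp
      | add z z' hz hz' => simp only [map_add, TensorProduct.add_tmul, hz, hz']
      | tmul x y => rfl
  have h2 : ∀ z : V ⊗[k] V, TensorProduct.map j (TensorProduct.map j j) (δ.lTensor V z) =
      (Coalgebra.comul (R := k)).lTensor C (TensorProduct.map j j z) := by
    intro z
    induction z with
    | zero => simp
    | add z z' hz hz' => simp only [map_add, hz, hz']
    | tmul x y =>
      rw [LinearMap.lTensor_tmul, TensorProduct.map_tmul, TensorProduct.map_tmul,
        LinearMap.lTensor_tmul, hδ]
  simp only [LinearMap.comp_apply, LinearEquiv.coe_coe]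
  rw [h1, h2, hδ, Coalgebra.coassoc_apply]

theorem sub_rTensor_counit (hj : Function.Injective j)
    (hδ : ∀ v, TensorProduct.map j j (δ v) = Coalgebra.comul (R := k) (j v)) :
    ((Coalgebra.counit (R := k)) ∘ₗ j).rTensor V ∘ₗ δ =
    TensorProduct.mk k k V 1 := by
  refine LinearMap.ext fun t => lTensor_inj k hj ?_
  have h : ∀ z : V ⊗[k] V, j.lTensor k (((Coalgebra.counit (R := k)) ∘ₗ j).rTensor V z) =
      (Coalgebra.counit (R := k)).rTensor C (TensorProduct.map j j z) := by
    intro z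
    induction z with
    | zero => simp
    | add z z' hz hz' => simp only [map_add, hz, hz']
    | tmul x y => rfl
  rw [LinearMap.comp_apply, h, hδ, Coalgebra.rTensor_counit_comul]
  rfl

theorem sub_lTensor_counit (hj : Function.Injective j)
    (hδ : ∀ v, TensorProduct.map j j (δ v) = Coalgebra.comul (R := k) (j v)) :
    ((Coalgebra.counit (R := k)) ∘ₗ j).lTensor V ∘ₗ δ =
    (TensorProduct.mk k V k).flip 1 := by
  refine LinearMap.ext fun t => rTensor_inj k hj ?_
  have h : ∀ z : V ⊗[k] V, j.rTensor k (((Coalgebra.counit (R := k)) ∘ₗ j).lTensor V z) =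
      (Coalgebra.counit (R := k)).lTensor C (TensorProduct.map j j z) := by
    intro z
    induction z with
    | zero => simp
    | add z z' hz hz' => simp only [map_add, hz, hz']
    | tmul x y => rfl
  rw [LinearMap.comp_apply, h, hδ, Coalgebra.lTensor_counit_comul]
  rfl

end SubCoalgebra

section Identities

variable {U V W X Y : Type*} [AddCommGroup U] [Module k U] [AddCommGroup V] [Module k V]
  [AddCommGroup W] [Module k W] [AddCommGroup X] [Module k X] [AddCommGroup Y] [Module k Y]

theorem assoc_map {U' V' W' : Type*} [AddCommGroup U'] [Module k U'] [AddCommGroup V']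
    [Module k V'] [AddCommGroup W'] [Module k W'] (f : U →ₗ[k] U') (g : V →ₗ[k] V')
    (h : W →ₗ[k] W') (z : (U ⊗[k] V) ⊗[k] W) :
    TensorProduct.assoc k U' V' W' (TensorProduct.map (TensorProduct.map f g) h z) =
      TensorProduct.map f (TensorProduct.map g h) (TensorProduct.assoc k U V W z) := by
  induction z with
  | zero => simp
  | add z z' hz hz' => simp only [map_add, hz, hz']
  | tmul x y =>
    induction x with
    | zero => simp
    | add z z' hz hz' => simp only [map_add, TensorProduct.add_tmul, hz, hz']
    | tmul x y => rfl

theorem assoc_rTensor_mk (v : V) (z : U ⊗[k] W) :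
    TensorProduct.assoc k U V W (((TensorProduct.mk k U V).flip v).rTensor W z) =
      (TensorProduct.mk k V W v).lTensor U z := by
  induction z with
  | zero => simp
  | add z z' hz hz' => simp only [map_add, hz, hz']
  | tmul x y => rfl

end Identities

section Balanced

variable {S R : Type*} [Ring S] [Algebra k S] [Ring R] [Algebra k R] (i : S →ₐ[k] R)

/-- The relations `r i(s) ⊗ n = r ⊗ s n` that define `R ⊗_S N`. -/
def balRel (N : Type*) [AddCommGroup N] [Module k N] [Module S N] : Submodule R (R ⊗[k] N) :=
  Submodule.span R {x | ∃ (r : R) (s : S) (n : N), x = (r * i s) ⊗ₜ[k] n - r ⊗ₜ[k] (s • n)}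

/-- The left `R`-module `R ⊗_S N`, where `R` is a right `S`-module through the algebra map
`i : S → R` and `N` is a left `S`-module (none of the rings is assumed to be commutative). -/
abbrev BalTensor (N : Type*) [AddCommGroup N] [Module k N] [Module S N] : Type _ :=
  (R ⊗[k] N) ⧸ balRel i N

/-- The class of `r ⊗ n` in `R ⊗_S N`. -/
def balMk {N : Type*} [AddCommGroup N] [Module k N] [Module S N] :
    R →ₗ[k] N →ₗ[k] BalTensor i N :=
  LinearMap.compr₂ (TensorProduct.mk k R N) ((balRel i N).mkQ.restrictScalars k)

theorem balMk_mul {N : Type*} [AddCommGroup N] [Module k N] [Module S N] (r : R) (s : S) (n : N) :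
    balMk i (r * i s) n = balMk i r (s • n) :=
  (Submodule.Quotient.eq _).2 (Submodule.subset_span ⟨r, s, n, rfl⟩)

theorem smul_balMk {N : Type*} [AddCommGroup N] [Module k N] [Module S N] (r r' : R) (n : N) :
    r • balMk i r' n = balMk i (r * r') n := rfl

theorem bal_induction {N : Type*} [AddCommGroup N] [Module k N] [Module S N]
    {p : BalTensor i N → Prop} (x : BalTensor i N) (h0 : p 0) (h : ∀ r n, p (balMk i r n))
    (hadd : ∀ x y, p x → p y → p (x + y)) : p x := by
  obtain ⟨x, rfl⟩ := Submodule.Quotient.mk_surjective _ x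
  induction x with
  | zero => exact h0
  | tmul r n => exact h r n
  | add x y hx hy => exact hadd _ _ hx hy

/-- A `k`-bilinear map `β` that is balanced over `S` induces a map on `R ⊗_S N`. -/
noncomputable def balLift {N X : Type*} [AddCommGroup N] [Module k N] [Module S N]
    [AddCommGroup X] [Module k X] (β : R →ₗ[k] N →ₗ[k] X)
    (hβ : ∀ r s n, β (r * i s) n = β r (s • n)) : BalTensor i N →ₗ[k] X :=
  Submodule.liftQ ((balRel i N).restrictScalars k) (TensorProduct.lift β) (by
    intro x hx
    have key : ∀ r' : R, TensorProduct.lift β (r' • x) = 0 := by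
      refine Submodule.span_induction (p := fun x _ => ∀ r' : R, TensorProduct.lift β (r' • x) = 0)
        ?_ ?_ ?_ ?_ (show x ∈ balRel i N from hx)
      · rintro _ ⟨r, s, n, rfl⟩ r'
        simp [smul_sub, TensorProduct.smul_tmul', ← mul_assoc, hβ]
      · simp
      · intro x y _ _ hx hy r'
        rw [smul_add, map_add, hx, hy, add_zero]
      · intro a x _ hx r'
        rw [smul_smul, hx]
    simpa using key 1) ∘ₗ
  (Submodule.Quotient.restrictScalarsEquiv k (balRel i N)).symm.toLinearMap

theorem balLift_mk {N X : Type*} [AddCommGroup N] [Module k N] [Module S N]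
    [AddCommGroup X] [Module k X] (β : R →ₗ[k] N →ₗ[k] X)
    (hβ : ∀ r s n, β (r * i s) n = β r (s • n)) (r : R) (n : N) :
    balLift i β hβ (balMk i r n) = β r n := rfl

/-- The map `id ⊗_S f : R ⊗_S N → R ⊗_S N'`. -/
noncomputable def balMap {N N' : Type*} [AddCommGroup N] [Module k N] [Module S N]
    [IsScalarTower k S N] [AddCommGroup N'] [Module k N'] [Module S N'] [IsScalarTower k S N']
    (f : N →ₗ[S] N') : BalTensor i N →ₗ[R] BalTensor i N' :=
  Submodule.mapQ _ _ (AlgebraTensorModule.map (LinearMap.id : R →ₗ[R] R) (f.restrictScalars k)) (by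
    refine Submodule.span_le.2 ?_
    rintro _ ⟨r, s, n, rfl⟩
    refine Submodule.subset_span ⟨r, s, f n, ?_⟩
    simp)

theorem balMap_mk {N N' : Type*} [AddCommGroup N] [Module k N] [Module S N]
    [IsScalarTower k S N] [AddCommGroup N'] [Module k N'] [Module S N'] [IsScalarTower k S N']
    (f : N →ₗ[S] N') (r : R) (n : N) : balMap i f (balMk i r n) = balMk i r (f n) := rfl

end Balanced

/-- `R` is faithfully flat as a right `S`-module: `R ⊗_S -` preserves and reflects exactness. -/
def RightFaithfullyFlat {S R : Type u} [Ring S] [Algebra k S] [Ring R] [Algebra k R]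
    (i : S →ₐ[k] R) : Prop :=
  ∀ (N₁ N₂ N₃ : Type u) [AddCommGroup N₁] [Module k N₁] [Module S N₁] [IsScalarTower k S N₁]
    [AddCommGroup N₂] [Module k N₂] [Module S N₂] [IsScalarTower k S N₂]
    [AddCommGroup N₃] [Module k N₃] [Module S N₃] [IsScalarTower k S N₃]
    (f : N₁ →ₗ[S] N₂) (g : N₂ →ₗ[S] N₃),
    Function.Exact f g ↔ Function.Exact (balMap i f) (balMap i g)

theorem ff_injective {S R : Type u} [Ring S] [Algebra k S] [Ring R] [Algebra k R]
    {i : S →ₐ[k] R} (hi : RightFaithfullyFlat i) {N N' : Type u} [AddCommGroup N] [Module k N]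
    [Module S N] [IsScalarTower k S N] [AddCommGroup N'] [Module k N'] [Module S N']
    [IsScalarTower k S N'] (f : N →ₗ[S] N') (hf : Function.Injective f) (x : BalTensor i N)
    (hx : balMap i f x = 0) : x = 0 := by
  have h := (hi PUnit.{u+1} N N' (0 : PUnit.{u+1} →ₗ[S] N) f).1 (by
    intro x
    rw [map_eq_zero_iff f hf]
    exact ⟨fun h => ⟨0, by rw [h, map_zero]⟩, fun ⟨y, hy⟩ => hy.symm⟩)
  obtain ⟨y, rfl⟩ := (h x).1 hx
  refine bal_induction i
    (p := fun y => balMap i (0 : PUnit.{u+1} →ₗ[S] N) y = 0) y (map_zero _) ?_ ?_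
  · intro r n
    rw [balMap_mk, LinearMap.zero_apply, map_zero]
  · intro x y hx hy
    rw [map_add, hx, hy, add_zero]

theorem ff_eq_zero {S R : Type u} [Ring S] [Algebra k S] [Ring R] [Algebra k R]
    {i : S →ₐ[k] R} (hi : RightFaithfullyFlat i) {N : Type u} [AddCommGroup N] [Module k N]
    [Module S N] [IsScalarTower k S N] (h : ∀ x : BalTensor i N, x = 0) (n : N) : n = 0 := by
  have h := (hi PUnit.{u+1} N PUnit.{u+1} (0 : PUnit.{u+1} →ₗ[S] N)
    (0 : N →ₗ[S] PUnit.{u+1})).2 (by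
      intro x
      rw [h x]
      exact ⟨fun _ => ⟨0, map_zero _⟩, fun _ => map_zero _⟩)
  obtain ⟨y, hy⟩ := (h n).1 rfl
  exact hy.symm

theorem ff_mem_range {S R : Type u} [Ring S] [Algebra k S] [Ring R] [Algebra k R]
    {i : S →ₐ[k] R} (hi : RightFaithfullyFlat i) [Module S R] [IsScalarTower k S R]
    (hsmul : ∀ (s : S) (r : R), s • r = i s * r) {a : R}
    (ha : balMk i a (1 : R) = balMk i 1 a) : ∃ s, i s = a := by
  let U : Submodule S R := Submodule.span S {(1 : R)}
  let n : R ⧸ U := U.mkQ a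
  let M : Submodule S (R ⧸ U) := Submodule.span S {n}
  let m : M := ⟨n, Submodule.mem_span_singleton_self n⟩
  have hz : ∀ r : R, balMk i r m = 0 := by
    intro r
    refine ff_injective hi M.subtype M.injective_subtype _ ?_
    rw [balMap_mk]
    have e1 : balMk i r (M.subtype m) = r • balMap i U.mkQ (balMk i 1 a) := by
      rw [balMap_mk, smul_balMk, mul_one]
      rfl
    have e2 : U.mkQ 1 = 0 := by
      rw [Submodule.mkQ_apply, Submodule.Quotient.mk_eq_zero]
      exact Submodule.mem_span_singleton_self _
    rw [e1, ← ha, balMap_mk, e2, map_zero, smul_zero]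
  have hm : m = 0 := by
    refine ff_eq_zero hi (fun x => ?_) m
    refine bal_induction i (p := fun x => x = 0) x rfl ?_ ?_
    · rintro r ⟨y, hy⟩
      obtain ⟨s, rfl⟩ := Submodule.mem_span_singleton.1 hy
      have : (⟨s • n, hy⟩ : M) = s • m := rfl
      rw [this, ← balMk_mul, hz]
    · intro x y hx hy
      rw [hx, hy, add_zero]
  have hn : U.mkQ a = 0 := congrArg Subtype.val hm
  rw [Submodule.mkQ_apply, Submodule.Quotient.mk_eq_zero] at hn
  obtain ⟨s, hs⟩ := Submodule.mem_span_singleton.1 hn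
  exact ⟨s, by rw [← hs, hsmul, mul_one]⟩

end Generic

section Spaces

variable {k : Type*} [Field k] {A : Type u} [Ring A] [HopfAlgebra k A]

/-- `B⁺`, the intersection of `B` with the kernel of the counit. -/
def plus (B : Subalgebra k A) : Submodule k A :=
  Subalgebra.toSubmodule B ⊓ LinearMap.ker (Coalgebra.counit (R := k) (A := A))

/-- A quantum homogeneous `A`-space: a subalgebra `B` of `A` which is a left coideal,
`Δ(B) ⊆ A ⊗ B`, with `B⁺A = AB⁺`, and such that `A` is faithfully flat as a right `B`-module. -/
class IsQuantumHomogeneousSpace (B : Subalgebra k A) : Prop where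
  comul_mem : ∀ b ∈ B, Coalgebra.comul (R := k) b ∈
    LinearMap.range ((Subalgebra.toSubmodule B).subtype.lTensor A)
  plus_mul : plus B * (⊤ : Submodule k A) = (⊤ : Submodule k A) * plus B
  faithfullyFlat : RightFaithfullyFlat B.val

variable (B : Subalgebra k A) [IsQuantumHomogeneousSpace B]

/-- The two-sided ideal `B⁺A = AB⁺` of `A`. -/
def augIdeal : Ideal A where
  carrier := (plus B * (⊤ : Submodule k A) : Submodule k A)
  add_mem' := Submodule.add_mem _
  zero_mem' := Submodule.zero_mem _
  smul_mem' := by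
    intro c x hx
    rw [IsQuantumHomogeneousSpace.plus_mul, SetLike.mem_coe] at hx ⊢
    have := Submodule.mul_mem_mul (Submodule.mem_top (R := k) (x := c)) hx
    rw [← mul_assoc] at this
    exact (mul_le_mul' le_top le_rfl :
      (⊤ : Submodule k A) * ⊤ * plus B ≤ ⊤ * plus B) this

theorem mem_augIdeal {x : A} : x ∈ augIdeal B ↔ x ∈ plus B * (⊤ : Submodule k A) := Iff.rfl

instance : (augIdeal B).IsTwoSided where
  mul_mem_of_left := by
    intro x c hx
    rw [mem_augIdeal] at hx ⊢
    have := Submodule.mul_mem_mul hx (Submodule.mem_top (R := k) (x := c))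
    rw [mul_assoc] at this
    exact (mul_le_mul' le_rfl le_top :
      plus B * ((⊤ : Submodule k A) * ⊤) ≤ plus B * ⊤) this

theorem augIdeal_induction {p : A → Prop} (h : ∀ b ∈ plus B, ∀ a : A, p (b * a))
    (hadd : ∀ x y, p x → p y → p (x + y)) {x : A} (hx : x ∈ augIdeal B) : p x :=
  Submodule.mul_induction_on ((mem_augIdeal B).1 hx) (fun b hb a _ => h b hb a) hadd

theorem plus_le {b : A} (hb : b ∈ plus B) : b ∈ augIdeal B := by
  have := Submodule.mul_mem_mul hb (Submodule.mem_top (R := k) (x := (1 : A)))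
  rwa [mul_one] at this

/-- The quotient `π_B(A) = A / B⁺A`. -/
abbrev QuotHopf : Type u := A ⧸ augIdeal B

/-- The canonical projection `π_B : A → π_B(A)`. -/
def proj : A →ₐ[k] QuotHopf B := Ideal.Quotient.mkₐ k (augIdeal B)

theorem proj_surjective : Function.Surjective (proj B) := Ideal.Quotient.mk_surjective

theorem proj_eq_zero {x : A} (hx : x ∈ augIdeal B) : proj B x = 0 :=
  Ideal.Quotient.eq_zero_iff_mem.2 hx

theorem proj_of_mem {b : A} (hb : b ∈ B) :
    proj B b = algebraMap k (QuotHopf B) (Coalgebra.counit (R := k) b) := by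
  rw [← (proj B).commutes, ← sub_eq_zero, ← map_sub]
  refine proj_eq_zero B (plus_le B ⟨B.sub_mem hb (B.algebraMap_mem _), ?_⟩)
  simp

/-- The left coaction `B → A ⊗ B` obtained by restricting the coproduct of `A`. -/
noncomputable def coidealComul : B →ₗ[k] A ⊗[k] B :=
  liftInj (B.val.toLinearMap.lTensor A) (lTensor_inj A Subtype.val_injective)
    (Coalgebra.comul ∘ₗ B.val.toLinearMap)
    (fun b => IsQuantumHomogeneousSpace.comul_mem (b : A) b.2)

theorem coidealComul_spec (b : B) :
    B.val.toLinearMap.lTensor A (coidealComul B b) = Coalgebra.comul (R := k) (b : A) :=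
  liftInj_spec _ _ _ _ _

theorem lTensor_counit_coidealComul (b : B) :
    (Coalgebra.counit (R := k) (A := A) ∘ₗ B.val.toLinearMap).lTensor A (coidealComul B b) =
      (b : A) ⊗ₜ 1 := by
  rw [LinearMap.lTensor_comp, LinearMap.comp_apply, coidealComul_spec]
  simp

/-- Every element of `B` is right `π_B(A)`-coinvariant. -/
theorem proj_comul {b : A} (hb : b ∈ B) :
    (proj B).toLinearMap.lTensor A (Coalgebra.comul (R := k) b) = b ⊗ₜ 1 := by
  have h : (proj B).toLinearMap ∘ₗ B.val.toLinearMap =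
      Algebra.linearMap k (QuotHopf B) ∘ₗ (Coalgebra.counit (R := k) (A := A) ∘ₗ B.val.toLinearMap) := by
    ext b
    exact proj_of_mem B b.2
  have h2 := lTensor_counit_coidealComul B ⟨b, hb⟩
  have h3 := coidealComul_spec B ⟨b, hb⟩
  dsimp only at h2 h3
  rw [← h3, ← LinearMap.comp_apply, ← LinearMap.lTensor_comp, h, LinearMap.lTensor_comp,
    LinearMap.comp_apply, h2]
  simp

theorem counit_augIdeal {x : A} (hx : x ∈ augIdeal B) : Coalgebra.counit (R := k) x = 0 := by
  refine augIdeal_induction B (p := fun x => Coalgebra.counit (R := k) x = 0) ?_ ?_ hx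
  · intro b hb a
    rw [Bialgebra.counit_mul, show Coalgebra.counit (R := k) b = 0 from hb.2, zero_mul]
  · intro x y hx hy
    rw [map_add, hx, hy, add_zero]

/-- The algebra map `(π_B ⊗ π_B) ∘ Δ`. -/
noncomputable def projComul : A →ₐ[k] QuotHopf B ⊗[k] QuotHopf B :=
  (Algebra.TensorProduct.map (proj B) (proj B)).comp (Bialgebra.comulAlgHom k A)

theorem projComul_apply (a : A) : projComul B a =
    TensorProduct.map (proj B).toLinearMap (proj B).toLinearMap (Coalgebra.comul (R := k) a) := rfl

theorem projComul_plus {b : A} (hb : b ∈ plus B) : projComul B b = 0 := by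
  rw [projComul_apply, ← LinearMap.rTensor_comp_lTensor, LinearMap.comp_apply,
    proj_comul B hb.1, LinearMap.rTensor_tmul]
  have : (proj B).toLinearMap b = 0 := proj_eq_zero B (plus_le B hb)
  rw [this, TensorProduct.zero_tmul]

theorem projComul_augIdeal {x : A} (hx : x ∈ augIdeal B) : projComul B x = 0 := by
  refine augIdeal_induction B (p := fun x => projComul B x = 0) ?_ ?_ hx
  · intro b hb a
    rw [map_mul, projComul_plus B hb, zero_mul]
  · intro x y hx hy
    rw [map_add, hx, hy, add_zero]

theorem antipode_plus {b : A} (hb : b ∈ plus B) : HopfAlgebra.antipode k b ∈ augIdeal B := by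
  have h1 := congrArg (LinearMap.mul' k (QuotHopf B) ∘ₗ
    ((proj B).toLinearMap ∘ₗ HopfAlgebra.antipode k).rTensor (QuotHopf B)) (proj_comul B hb.1)
  have h2 : ∀ z : A ⊗[k] A, (LinearMap.mul' k (QuotHopf B) ∘ₗ
      ((proj B).toLinearMap ∘ₗ HopfAlgebra.antipode k).rTensor (QuotHopf B))
        ((proj B).toLinearMap.lTensor A z) =
      proj B (LinearMap.mul' k A ((HopfAlgebra.antipode k).rTensor A z)) := by
    intro z
    induction z with
    | zero => simp
    | tmul x y => simp
    | add x y hx hy => simp only [map_add, hx, hy]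
  rw [h2, HopfAlgebra.mul_antipode_rTensor_comul_apply,
    show Coalgebra.counit (R := k) b = 0 from hb.2] at h1
  have h3 : proj B (HopfAlgebra.antipode k b) = 0 := by simpa using h1.symm
  exact Ideal.Quotient.eq_zero_iff_mem.1 h3

instance : (augIdeal B).IsHopfIdeal k where
  counit_eq_zero := fun _ hx => counit_augIdeal B hx
  map_mkQ_comul_eq_zero := fun _ hx => projComul_augIdeal B hx
  antipode_mem := by
    intro x hx
    refine augIdeal_induction B (p := fun x => HopfAlgebra.antipode k x ∈ augIdeal B) ?_ ?_ hx
    · intro b hb a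
      rw [HopfAlgebra.antipode_mul_antidistrib]
      exact Ideal.mul_mem_left _ _ (antipode_plus B hb)
    · intro x y hx hy
      rw [map_add]
      exact Ideal.add_mem _ hx hy

theorem comul_proj (a : A) : Coalgebra.comul (R := k) (proj B a) =
    TensorProduct.map (proj B).toLinearMap (proj B).toLinearMap (Coalgebra.comul (R := k) a) := rfl

theorem counit_proj (a : A) :
    Coalgebra.counit (R := k) (proj B a) = Coalgebra.counit (R := k) a := rfl

/-- The map `A → A ⊗_B A` sending `y` to `S(y₁) ⊗ y₂`. -/
noncomputable def transl : A →ₗ[k] BalTensor B.val A :=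
  TensorProduct.lift (balMk B.val ∘ₗ HopfAlgebra.antipode k) ∘ₗ Coalgebra.comul

theorem transl_mul {b : A} (hb : b ∈ B) (y : A) :
    transl B (b * y) = Coalgebra.counit (R := k) b • transl B y := by
  have h : ∀ (w : A ⊗[k] B) (z : A ⊗[k] A),
      TensorProduct.lift (balMk B.val ∘ₗ HopfAlgebra.antipode k)
        (B.val.toLinearMap.lTensor A w * z) =
      TensorProduct.lift (balMk B.val ∘ₗ (LinearMap.mul k A).flip
        (LinearMap.mul' k A ((HopfAlgebra.antipode k).rTensor A
          (B.val.toLinearMap.lTensor A w))) ∘ₗ HopfAlgebra.antipode k) z := by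
    intro w z
    induction z with
    | zero => simp
    | add z z' hz hz' => simp only [map_add, mul_add, hz, hz']
    | tmul y y' =>
      induction w with
      | zero => simp
      | add w w' hw hw' =>
        simp only [TensorProduct.lift.tmul, LinearMap.comp_apply, LinearMap.flip_apply,
          LinearMap.mul_apply', map_add, add_mul, LinearMap.add_apply] at hw hw' ⊢
        rw [hw, hw']
      | tmul x c =>
        simp only [LinearMap.lTensor_tmul, LinearMap.rTensor_tmul, TensorProduct.lift.tmul,
          LinearMap.comp_apply, Algebra.TensorProduct.tmul_mul_tmul, LinearMap.mul'_apply,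
          LinearMap.flip_apply, LinearMap.mul_apply', HopfAlgebra.antipode_mul_antidistrib]
        rw [← mul_assoc]
        exact (balMk_mul B.val _ c y').symm
  have h' := h (coidealComul B ⟨b, hb⟩) (Coalgebra.comul y)
  rw [coidealComul_spec, HopfAlgebra.mul_antipode_rTensor_comul_apply] at h'
  rw [transl, LinearMap.comp_apply, Bialgebra.comul_mul, h', LinearMap.comp_apply]
  generalize Coalgebra.comul (R := k) y = z
  induction z with
  | zero => simp
  | add z z' hz hz' => simp only [map_add, smul_add, hz, hz']
  | tmul y y' =>
    simp [Algebra.algebraMap_eq_smul_one]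

theorem transl_augIdeal {x : A} (hx : x ∈ augIdeal B) : transl B x = 0 := by
  refine augIdeal_induction B (p := fun x => transl B x = 0) ?_ ?_ hx
  · intro b hb a
    rw [transl_mul B hb.1, show Coalgebra.counit (R := k) b = 0 from hb.2, zero_smul]
  · intro x y hx hy
    rw [map_add, hx, hy, add_zero]

theorem smul_transl (a : A) :
    TensorProduct.lift ((act k A (BalTensor B.val A)).compl₂ (transl B)) (Coalgebra.comul a) =
      balMk B.val 1 a := by
  have h : ∀ z : A ⊗[k] A,
      TensorProduct.lift ((act k A (BalTensor B.val A)).compl₂ (transl B)) z =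
      TensorProduct.lift (balMk B.val) ((LinearMap.mul' k A ∘ₗ
        (HopfAlgebra.antipode k).lTensor A).rTensor A
          ((TensorProduct.assoc k A A A).symm (Coalgebra.comul.lTensor A z))) := by
    intro z
    induction z with
    | zero => simp
    | add z z' hz hz' => simp only [map_add, hz, hz']
    | tmul x y =>
      simp only [TensorProduct.lift.tmul, LinearMap.compl₂_apply, act_apply, transl,
        LinearMap.comp_apply, LinearMap.lTensor_tmul]
      generalize Coalgebra.comul (R := k) y = w
      induction w with
      | zero => simp
      | add z z' hz hz' => simp only [map_add, smul_add, TensorProduct.tmul_add, hz, hz']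
      | tmul y y' =>
        simp [smul_balMk]
  rw [h, ← Coalgebra.coassoc_apply, LinearEquiv.symm_apply_apply]
  have h2 : (LinearMap.mul' k A ∘ₗ (HopfAlgebra.antipode k).lTensor A).rTensor A
      (Coalgebra.comul.rTensor A (Coalgebra.comul a)) = 1 ⊗ₜ[k] a := by
    rw [← LinearMap.comp_apply, ← LinearMap.rTensor_comp, LinearMap.comp_assoc,
      HopfAlgebra.mul_antipode_lTensor_comul, LinearMap.rTensor_comp, LinearMap.comp_apply]
    simp
  rw [h2, TensorProduct.lift.tmul]

theorem balMk_eq_of_proj_comul {a : A}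
    (ha : (proj B).toLinearMap.lTensor A (Coalgebra.comul (R := k) a) = a ⊗ₜ 1) :
    balMk B.val a (1 : A) = balMk B.val 1 a := by
  let γ : QuotHopf B →ₗ[k] BalTensor B.val A :=
    ((augIdeal B).restrictScalars k).liftQ (transl B) (fun x hx => transl_augIdeal B hx)
  have h1 := congrArg (TensorProduct.lift ((act k A (BalTensor B.val A)).compl₂ γ)) ha
  have h2 : ∀ z : A ⊗[k] A, TensorProduct.lift ((act k A (BalTensor B.val A)).compl₂ γ)
      ((proj B).toLinearMap.lTensor A z) =
      TensorProduct.lift ((act k A (BalTensor B.val A)).compl₂ (transl B)) z := by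
    intro z
    induction z with
    | zero => simp
    | add z z' hz hz' => simp only [map_add, hz, hz']
    | tmul x y => rfl
  rw [h2, smul_transl, TensorProduct.lift.tmul] at h1
  have h3 : γ 1 = balMk B.val 1 1 := by
    change transl B 1 = _
    simp [transl, Algebra.TensorProduct.one_def]
  rw [h1, LinearMap.compl₂_apply, h3, act_apply, smul_balMk, mul_one]

/-- A quantum homogeneous space contains every right `π_B(A)`-coinvariant element. -/
theorem mem_of_proj_comul {a : A}
    (ha : (proj B).toLinearMap.lTensor A (Coalgebra.comul (R := k) a) = a ⊗ₜ 1) : a ∈ B := by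
  obtain ⟨b, rfl⟩ := ff_mem_range (IsQuantumHomogeneousSpace.faithfullyFlat (B := B))
    (fun _ _ => rfl) (balMk_eq_of_proj_comul B ha)
  exact b.2

end Spaces

section Pairs

variable {k : Type*} [Field k] {A : Type u} [Ring A] [HopfAlgebra k A]

/-- The subalgebra `π_B(P)` of `π_B(A)`. -/
def fiber (B P : Subalgebra k A) [IsQuantumHomogeneousSpace B] : Subalgebra k (QuotHopf B) :=
  P.map (proj B)

/-- A pair `(B, P)` of quantum homogeneous `A`-spaces is principal if `B ⊆ P` and `π_B(P)` is a
Hopf subalgebra of `π_B(A)`. -/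
class IsPrincipalPair (B P : Subalgebra k A) [IsQuantumHomogeneousSpace B]
    [IsQuantumHomogeneousSpace P] : Prop where
  le : B ≤ P
  comul_mem : ∀ t ∈ fiber B P, Coalgebra.comul (R := k) t ∈
    LinearMap.range (TensorProduct.map (fiber B P).val.toLinearMap (fiber B P).val.toLinearMap)
  antipode_mem : ∀ t ∈ fiber B P, HopfAlgebra.antipode k t ∈ fiber B P

variable (B P : Subalgebra k A) [IsQuantumHomogeneousSpace B] [IsQuantumHomogeneousSpace P]
  [IsPrincipalPair B P]

/-- The inclusion of `π_B(P)` in `π_B(A)`. -/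
abbrev fiberVal : fiber B P →ₗ[k] QuotHopf B := (fiber B P).val.toLinearMap

theorem fiberVal_inj : Function.Injective (fiberVal B P) := Subtype.val_injective

/-- The coproduct of `π_B(P)`, the restriction of the coproduct of `π_B(A)`. -/
noncomputable def fiberComul : fiber B P →ₗ[k] fiber B P ⊗[k] fiber B P :=
  liftInj (TensorProduct.map (fiberVal B P) (fiberVal B P))
    (map_inj (fiberVal_inj B P) (fiberVal_inj B P))
    (Coalgebra.comul ∘ₗ fiberVal B P)
    (fun t => IsPrincipalPair.comul_mem (t : QuotHopf B) t.2)

theorem fiberComul_spec (t : fiber B P) :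
    TensorProduct.map (fiberVal B P) (fiberVal B P) (fiberComul B P t) =
      Coalgebra.comul (R := k) (t : QuotHopf B) :=
  liftInj_spec _ _ _ _ _

noncomputable instance : CoalgebraStruct k (fiber B P) where
  comul := fiberComul B P
  counit := Coalgebra.counit ∘ₗ fiberVal B P

theorem comul_fiber (t : fiber B P) :
    TensorProduct.map (fiberVal B P) (fiberVal B P) (Coalgebra.comul (R := k) t) =
      Coalgebra.comul (R := k) (t : QuotHopf B) :=
  fiberComul_spec B P t

theorem comul_comp_fiberVal : (Coalgebra.comul (R := k)) ∘ₗ fiberVal B P =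
    TensorProduct.map (fiberVal B P) (fiberVal B P) ∘ₗ Coalgebra.comul (R := k) :=
  LinearMap.ext fun t => (comul_fiber B P t).symm

theorem counit_fiber (t : fiber B P) :
    Coalgebra.counit (R := k) t = Coalgebra.counit (R := k) (t : QuotHopf B) := rfl

noncomputable instance : Coalgebra k (fiber B P) where
  coassoc := sub_coassoc (fiberVal_inj B P) (fiberComul_spec B P)
  rTensor_counit_comp_comul := sub_rTensor_counit (fiberVal_inj B P) (fiberComul_spec B P)
  lTensor_counit_comp_comul := sub_lTensor_counit (fiberVal_inj B P) (fiberComul_spec B P)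

theorem augIdeal_le : augIdeal B ≤ augIdeal P := by
  intro x hx
  refine augIdeal_induction B (p := fun x => x ∈ augIdeal P) ?_ ?_ hx
  · intro b hb a
    exact Ideal.mul_mem_right _ _ (plus_le P ⟨IsPrincipalPair.le hb.1, hb.2⟩)
  · intro x y hx hy
    exact Ideal.add_mem _ hx hy

/-- The canonical map `π_B(A) → π_P(A)`. -/
def projPair : QuotHopf B →ₐ[k] QuotHopf P := Ideal.Quotient.factorₐ k (augIdeal_le B P)

theorem projPair_proj (a : A) : projPair B P (proj B a) = proj P a := rfl

theorem projPair_fiber (t : fiber B P) : projPair B P t =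
    algebraMap k (QuotHopf P) (Coalgebra.counit (R := k) t) := by
  obtain ⟨_, p, hp, rfl⟩ := t
  exact proj_of_mem P hp

theorem fiber_left_coinv (t : fiber B P) :
    (projPair B P).toLinearMap.rTensor (QuotHopf B) (Coalgebra.comul (R := k) (t : QuotHopf B)) =
      1 ⊗ₜ (t : QuotHopf B) := by
  have h : ∀ z : fiber B P ⊗[k] fiber B P,
      (projPair B P).toLinearMap.rTensor (QuotHopf B)
        (TensorProduct.map (fiberVal B P) (fiberVal B P) z) =
      TensorProduct.map (Algebra.linearMap k (QuotHopf P)) (fiberVal B P)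
        ((Coalgebra.counit (R := k)).rTensor (fiber B P) z) := by
    intro z
    induction z with
    | zero => simp
    | add z z' hz hz' => simp only [map_add, hz, hz']
    | tmul x y =>
      simp only [TensorProduct.map_tmul, LinearMap.rTensor_tmul]
      congr 1
      exact projPair_fiber B P x
  rw [← comul_fiber, h, Coalgebra.rTensor_counit_comul]
  simp

/-- The coaction `(id ⊗ π_B) ∘ Δ` of `π_B(A)` on `A`. -/
noncomputable def projCoact : A →ₗ[k] A ⊗[k] QuotHopf B :=
  (proj B).toLinearMap.lTensor A ∘ₗ Coalgebra.comul

theorem lTensor_fiber_coinv (z : A ⊗[k] fiber B P) :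
    ((projPair B P).toLinearMap.rTensor (QuotHopf B) ∘ₗ Coalgebra.comul).lTensor A
      ((fiberVal B P).lTensor A z) =
    (TensorProduct.mk k (QuotHopf P) (QuotHopf B) 1).lTensor A ((fiberVal B P).lTensor A z) := by
  have h : ((projPair B P).toLinearMap.rTensor (QuotHopf B) ∘ₗ Coalgebra.comul) ∘ₗ fiberVal B P =
      (TensorProduct.mk k (QuotHopf P) (QuotHopf B) 1) ∘ₗ fiberVal B P :=
    LinearMap.ext fun t => fiber_left_coinv B P t
  rw [← LinearMap.comp_apply, ← LinearMap.lTensor_comp, h, LinearMap.lTensor_comp,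
    LinearMap.comp_apply]

theorem projPair_comul : ((projPair B P).toLinearMap.rTensor (QuotHopf B) ∘ₗ Coalgebra.comul) ∘ₗ
    (proj B).toLinearMap =
    TensorProduct.map (proj P).toLinearMap (proj B).toLinearMap ∘ₗ Coalgebra.comul := by
  refine LinearMap.ext fun a => ?_
  change (projPair B P).toLinearMap.rTensor (QuotHopf B) (TensorProduct.map (proj B).toLinearMap
    (proj B).toLinearMap (Coalgebra.comul (R := k) a)) = _
  exact LinearMap.congr_fun (LinearMap.rTensor_comp_map _ _ _ _) _

theorem projCoact_coassoc (a : A) : TensorProduct.assoc k A (QuotHopf P) (QuotHopf B)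
    ((projCoact P).rTensor (QuotHopf B) (projCoact B a)) =
      ((projPair B P).toLinearMap.rTensor (QuotHopf B) ∘ₗ Coalgebra.comul).lTensor A
        (projCoact B a) := by
  have h1 : (projCoact P).rTensor (QuotHopf B) (projCoact B a) =
      TensorProduct.map (TensorProduct.map LinearMap.id (proj P).toLinearMap)
        (proj B).toLinearMap (Coalgebra.comul.rTensor A (Coalgebra.comul a)) := by
    generalize ha : Coalgebra.comul (R := k) a = z
    rw [projCoact, projCoact, LinearMap.comp_apply, ha]
    clear ha
    induction z with
    | zero => simp
    | add z z' hz hz' => simp only [map_add, hz, hz']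
    | tmul x y => rfl
  have h2 : ((projPair B P).toLinearMap.rTensor (QuotHopf B) ∘ₗ Coalgebra.comul).lTensor A
        (projCoact B a) = TensorProduct.map LinearMap.id
      (TensorProduct.map (proj P).toLinearMap (proj B).toLinearMap)
      (Coalgebra.comul.lTensor A (Coalgebra.comul a)) := by
    rw [projCoact, LinearMap.comp_apply, ← LinearMap.comp_apply, ← LinearMap.lTensor_comp,
      projPair_comul, LinearMap.lTensor_comp]
    rfl
  rw [h1, h2, assoc_map, Coalgebra.coassoc_apply]

theorem pairCoact_mem (p : P) : projCoact B (p : A) ∈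
    LinearMap.range (TensorProduct.map P.val.toLinearMap (fiberVal B P)) := by
  let q : P →ₗ[k] fiber B P :=
    ((proj B).toLinearMap ∘ₗ P.val.toLinearMap).codRestrict
      (Subalgebra.toSubmodule (fiber B P)) (fun p => ⟨p, p.2, rfl⟩)
  have hq : fiberVal B P ∘ₗ q = (proj B).toLinearMap ∘ₗ P.val.toLinearMap := rfl
  let y : A ⊗[k] fiber B P := q.lTensor A (coidealComul P p)
  have hy : (fiberVal B P).lTensor A y = projCoact B (p : A) := by
    rw [← LinearMap.comp_apply, ← LinearMap.lTensor_comp, hq, LinearMap.lTensor_comp,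
      LinearMap.comp_apply, coidealComul_spec]
    rfl
  let g : A →ₗ[k] A ⊗[k] QuotHopf P := projCoact P - (TensorProduct.mk k A (QuotHopf P)).flip 1
  have hg : Function.Exact P.val.toLinearMap g := by
    intro a
    constructor
    · intro h
      exact ⟨⟨a, mem_of_proj_comul P (sub_eq_zero.1 h)⟩, rfl⟩
    · rintro ⟨a, rfl⟩
      exact sub_eq_zero.2 (proj_comul P a.2)
  have hgy : g.rTensor (fiber B P) y = 0 := by
    refine lTensor_inj _ (fiberVal_inj B P) ?_
    have e1 : (fiberVal B P).lTensor _ (g.rTensor (fiber B P) y) =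
        g.rTensor (QuotHopf B) (projCoact B (p : A)) := by
      rw [← hy]
      exact (LinearMap.congr_fun (LinearMap.lTensor_comp_rTensor _ _ _) y).trans
        (LinearMap.congr_fun (LinearMap.rTensor_comp_lTensor _ _ _) y).symm
    have e2 := projCoact_coassoc B P (p : A)
    rw [← hy, lTensor_fiber_coinv, ← assoc_rTensor_mk, hy] at e2
    have e3 : g.rTensor (QuotHopf B) (projCoact B (p : A)) = (projCoact P).rTensor (QuotHopf B)
        (projCoact B (p : A)) - ((TensorProduct.mk k A (QuotHopf P)).flip 1).rTensor (QuotHopf B)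
        (projCoact B (p : A)) :=
      LinearMap.congr_fun (LinearMap.rTensor_sub _ _) _
    rw [e1, map_zero, e3, sub_eq_zero]
    exact (TensorProduct.assoc k A (QuotHopf P) (QuotHopf B)).injective e2
  obtain ⟨w, hw⟩ := mem_range_rTensor (fiber B P) hg hgy
  refine ⟨w, ?_⟩
  rw [← hy, ← hw]
  exact (LinearMap.congr_fun (LinearMap.lTensor_comp_rTensor _ _ _) w).symm

/-- The right coaction `P → P ⊗ π_B(P)` obtained by restricting `(id ⊗ π_B) ∘ Δ`. -/
noncomputable def pairCoact : P →ₗ[k] P ⊗[k] fiber B P :=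
  liftInj (TensorProduct.map P.val.toLinearMap (fiberVal B P))
    (map_inj Subtype.val_injective (fiberVal_inj B P))
    (projCoact B ∘ₗ P.val.toLinearMap) (pairCoact_mem B P)

theorem pairCoact_spec (p : P) :
    TensorProduct.map P.val.toLinearMap (fiberVal B P) (pairCoact B P p) = projCoact B (p : A) :=
  liftInj_spec _ _ _ _ _

end Pairs

section Bilinear

variable {k : Type*} [Field k]

theorem map₂_assoc {X Y Z V₁ V₂ W X' Y' Z' V₁' V₂' W' : Type*}
    [AddCommGroup X] [Module k X] [AddCommGroup Y] [Module k Y] [AddCommGroup Z] [Module k Z]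
    [AddCommGroup V₁] [Module k V₁] [AddCommGroup V₂] [Module k V₂] [AddCommGroup W] [Module k W]
    [AddCommGroup X'] [Module k X'] [AddCommGroup Y'] [Module k Y'] [AddCommGroup Z'] [Module k Z']
    [AddCommGroup V₁'] [Module k V₁'] [AddCommGroup V₂'] [Module k V₂'] [AddCommGroup W']
    [Module k W']
    {γ₁ : X →ₗ[k] Y →ₗ[k] V₁} {β₁ : V₁ →ₗ[k] Z →ₗ[k] W} {γ₂ : Y →ₗ[k] Z →ₗ[k] V₂}
    {β₂ : X →ₗ[k] V₂ →ₗ[k] W}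
    {γ₁' : X' →ₗ[k] Y' →ₗ[k] V₁'} {β₁' : V₁' →ₗ[k] Z' →ₗ[k] W'} {γ₂' : Y' →ₗ[k] Z' →ₗ[k] V₂'}
    {β₂' : X' →ₗ[k] V₂' →ₗ[k] W'}
    (h : ∀ x y z, β₁ (γ₁ x y) z = β₂ x (γ₂ y z))
    (h' : ∀ x y z, β₁' (γ₁' x y) z = β₂' x (γ₂' y z))
    (u : X ⊗[k] X') (v : Y ⊗[k] Y') (w : Z ⊗[k] Z') :
    TensorProduct.map₂ β₁ β₁' (TensorProduct.map₂ γ₁ γ₁' u v) w =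
      TensorProduct.map₂ β₂ β₂' u (TensorProduct.map₂ γ₂ γ₂' v w) := by
  induction u with
  | zero => simp
  | add z z' hz hz' => simp only [map_add, LinearMap.add_apply, hz, hz']
  | tmul x x' =>
    induction v with
    | zero => simp
    | add z z' hz hz' => simp only [map_add, LinearMap.add_apply, hz, hz']
    | tmul y y' =>
      induction w with
      | zero => simp
      | add z z' hz hz' => simp only [map_add, hz, hz']
      | tmul z z' => simp [TensorProduct.map₂_apply_tmul, h, h']

theorem map_map₂ {X Y Z X₁ Y₁ Z₁ X' Y' Z' X₁' Y₁' Z₁' : Type*}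
    [AddCommGroup X] [Module k X] [AddCommGroup Y] [Module k Y] [AddCommGroup Z] [Module k Z]
    [AddCommGroup X₁] [Module k X₁] [AddCommGroup Y₁] [Module k Y₁] [AddCommGroup Z₁] [Module k Z₁]
    [AddCommGroup X'] [Module k X'] [AddCommGroup Y'] [Module k Y'] [AddCommGroup Z'] [Module k Z']
    [AddCommGroup X₁'] [Module k X₁'] [AddCommGroup Y₁'] [Module k Y₁'] [AddCommGroup Z₁']
    [Module k Z₁']
    {β : X →ₗ[k] Y →ₗ[k] Z} {β₁ : X₁ →ₗ[k] Y₁ →ₗ[k] Z₁}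
    {f : X →ₗ[k] X₁} {g : Y →ₗ[k] Y₁} {h : Z →ₗ[k] Z₁}
    {β' : X' →ₗ[k] Y' →ₗ[k] Z'} {β₁' : X₁' →ₗ[k] Y₁' →ₗ[k] Z₁'}
    {f' : X' →ₗ[k] X₁'} {g' : Y' →ₗ[k] Y₁'} {h' : Z' →ₗ[k] Z₁'}
    (hβ : ∀ x y, h (β x y) = β₁ (f x) (g y)) (hβ' : ∀ x y, h' (β' x y) = β₁' (f' x) (g' y))
    (u : X ⊗[k] X') (v : Y ⊗[k] Y') :
    TensorProduct.map h h' (TensorProduct.map₂ β β' u v) =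
      TensorProduct.map₂ β₁ β₁' (TensorProduct.map f f' u) (TensorProduct.map g g' v) := by
  induction u with
  | zero => simp
  | add z z' hz hz' => simp only [map_add, LinearMap.add_apply, hz, hz']
  | tmul x x' =>
    induction v with
    | zero => simp
    | add z z' hz hz' => simp only [map_add, hz, hz']
    | tmul y y' => simp [TensorProduct.map₂_apply_tmul, hβ, hβ']

theorem assoc_map₂ {X Y Z X' Y' Z' X'' Y'' Z'' : Type*}
    [AddCommGroup X] [Module k X] [AddCommGroup Y] [Module k Y] [AddCommGroup Z] [Module k Z]
    [AddCommGroup X'] [Module k X'] [AddCommGroup Y'] [Module k Y'] [AddCommGroup Z'] [Module k Z']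
    [AddCommGroup X''] [Module k X''] [AddCommGroup Y''] [Module k Y''] [AddCommGroup Z'']
    [Module k Z'']
    (β : X →ₗ[k] Y →ₗ[k] Z) (β' : X' →ₗ[k] Y' →ₗ[k] Z') (β'' : X'' →ₗ[k] Y'' →ₗ[k] Z'')
    (u : (X ⊗[k] X') ⊗[k] X'') (v : (Y ⊗[k] Y') ⊗[k] Y'') :
    TensorProduct.assoc k Z Z' Z'' (TensorProduct.map₂ (TensorProduct.map₂ β β') β'' u v) =
      TensorProduct.map₂ β (TensorProduct.map₂ β' β'') (TensorProduct.assoc k X X' X'' u)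
        (TensorProduct.assoc k Y Y' Y'' v) := by
  induction u with
  | zero => simp
  | add z z' hz hz' => simp only [map_add, LinearMap.add_apply, hz, hz']
  | tmul x x'' =>
    induction v with
    | zero => simp
    | add z z' hz hz' => simp only [map_add, hz, hz']
    | tmul y y'' =>
      induction x with
      | zero => simp
      | add z z' hz hz' =>
        simp only [map_add, LinearMap.add_apply, TensorProduct.add_tmul, hz, hz']
      | tmul x x' =>
        induction y with
        | zero => simp
        | add z z' hz hz' => simp only [map_add, TensorProduct.add_tmul, hz, hz']
        | tmul y y' => rfl

theorem comul_mul_map₂ {C : Type*} [Ring C] [Bialgebra k C] (a b : C) :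
    Coalgebra.comul (R := k) (LinearMap.mul k C a b) =
      TensorProduct.map₂ (LinearMap.mul k C) (LinearMap.mul k C) (Coalgebra.comul a)
        (Coalgebra.comul b) := by
  rw [LinearMap.mul_apply', Bialgebra.comul_mul]
  generalize Coalgebra.comul (R := k) a = u
  generalize Coalgebra.comul (R := k) b = v
  induction u with
  | zero => simp
  | add z z' hz hz' => simp only [map_add, add_mul, LinearMap.add_apply, hz, hz']
  | tmul x x' =>
    induction v with
    | zero => simp
    | add z z' hz hz' => simp only [map_add, mul_add, hz, hz']
    | tmul y y' => simp [TensorProduct.map₂_apply_tmul]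

variable {C : Type*} [Ring C] [Bialgebra k C] {X Y Z : Type*}
  [AddCommGroup X] [Module k X] [AddCommGroup Y] [Module k Y] [AddCommGroup Z] [Module k Z]

/-- Coassociativity and counitality on products, for a bilinear map compatible with coactions. -/
theorem coassoc_of_bilin {δX : X →ₗ[k] C ⊗[k] X} {δY : Y →ₗ[k] C ⊗[k] Y} {δZ : Z →ₗ[k] C ⊗[k] Z}
    (hX : IsLeftCoaction C δX) (hY : IsLeftCoaction C δY) (β : X →ₗ[k] Y →ₗ[k] Z)
    (hβ : ∀ x y, δZ (β x y) = TensorProduct.map₂ (LinearMap.mul k C) β (δX x) (δY y))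
    (x : X) (y : Y) :
    TensorProduct.assoc k C C Z ((Coalgebra.comul (R := k)).rTensor Z (δZ (β x y))) =
      δZ.lTensor C (δZ (β x y)) ∧
    (Coalgebra.counit (R := k)).rTensor Z (δZ (β x y)) = 1 ⊗ₜ (β x y) := by
  constructor
  · rw [hβ]
    have h1 := map_map₂ (k := k) (β := LinearMap.mul k C) (f := Coalgebra.comul)
      (g := Coalgebra.comul) (h := Coalgebra.comul) comul_mul_map₂
      (β' := β) (β₁' := β) (f' := LinearMap.id) (g' := LinearMap.id) (h' := LinearMap.id)
      (fun _ _ => rfl) (δX x) (δY y)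
    have h2 := map_map₂ (k := k) (β := LinearMap.mul k C) (β₁ := LinearMap.mul k C)
      (f := LinearMap.id) (g := LinearMap.id) (h := LinearMap.id) (fun _ _ => rfl)
      (β' := β) (f' := δX) (g' := δY) (h' := δZ) hβ (δX x) (δY y)
    rw [LinearMap.rTensor, LinearMap.lTensor, h1, h2, assoc_map₂]
    have e1 := hX.coassoc x
    have e2 := hY.coassoc y
    rw [LinearMap.rTensor, LinearMap.lTensor] at e1 e2
    rw [e1, e2]
  · have h1 := map_map₂ (k := k) (β := LinearMap.mul k C) (β₁ := LinearMap.mul k k)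
      (f := Coalgebra.counit) (g := Coalgebra.counit) (h := Coalgebra.counit)
      (fun a b => Bialgebra.counit_mul a b)
      (β' := β) (β₁' := β) (f' := LinearMap.id) (g' := LinearMap.id) (h' := LinearMap.id)
      (fun _ _ => rfl) (δX x) (δY y)
    rw [hβ, LinearMap.rTensor, h1]
    have e1 := hX.counit x
    have e2 := hY.counit y
    rw [LinearMap.rTensor] at e1 e2
    rw [e1, e2, TensorProduct.map₂_apply_tmul, TensorProduct.map_tmul]
    simp

end Bilinear

section Sub

variable {k : Type*} [Field k] {C M N : Type*} [AddCommGroup C] [Module k C] [Coalgebra k C]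
  [AddCommGroup M] [Module k M] [AddCommGroup N] [Module k N]

/-- A subspace that is stable under a left coaction inherits a left coaction. -/
theorem IsLeftCoaction.sub {δM : M →ₗ[k] C ⊗[k] M} (hM : IsLeftCoaction C δM) {j : N →ₗ[k] M}
    (hj : Function.Injective j) {δN : N →ₗ[k] C ⊗[k] N}
    (h : ∀ n, j.lTensor C (δN n) = δM (j n)) : IsLeftCoaction C δN where
  coassoc := by
    intro n
    apply lTensor_inj C (lTensor_inj C hj)
    have h1 : ∀ z : C ⊗[k] N, (j.lTensor C).lTensor C (TensorProduct.assoc k C C N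
        ((Coalgebra.comul (R := k)).rTensor N z)) = TensorProduct.assoc k C C M
        ((Coalgebra.comul (R := k)).rTensor M (j.lTensor C z)) := by
      intro z
      induction z with
      | zero => simp
      | add z z' hz hz' => simp only [map_add, hz, hz']
      | tmul x y =>
        rw [LinearMap.rTensor_tmul, LinearMap.lTensor_tmul, LinearMap.rTensor_tmul]
        generalize Coalgebra.comul (R := k) x = w
        induction w with
        | zero => simp
        | add z z' hz hz' => simp only [map_add, TensorProduct.add_tmul, hz, hz']
        | tmul x y => rfl
    have h2 : (j.lTensor C) ∘ₗ δN = δM ∘ₗ j := LinearMap.ext h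
    have h3 : ∀ z : C ⊗[k] N, (j.lTensor C).lTensor C (δN.lTensor C z) =
        δM.lTensor C (j.lTensor C z) := by
      intro z
      have e1 := LinearMap.congr_fun (LinearMap.lTensor_comp C (j.lTensor C) δN) z
      have e2 := LinearMap.congr_fun (LinearMap.lTensor_comp C δM j) z
      rw [h2] at e1
      exact e1.symm.trans e2
    rw [h1, h, hM.coassoc, h3, h]
  counit := by
    intro n
    apply lTensor_inj k hj
    have h1 : ∀ z : C ⊗[k] N, j.lTensor k ((Coalgebra.counit (R := k)).rTensor N z) =
        (Coalgebra.counit (R := k)).rTensor M (j.lTensor C z) := by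
      intro z
      induction z with
      | zero => simp
      | add z z' hz hz' => simp only [map_add, hz, hz']
      | tmul x y => rfl
    rw [h1, h, hM.counit]
    rfl

theorem IsRightCoaction.sub {D : Type*} [AddCommGroup D] [Module k D] [Coalgebra k D]
    {δM : M →ₗ[k] M ⊗[k] C} (hM : IsRightCoaction C δM) {j : N →ₗ[k] M}
    (hj : Function.Injective j) {i : D →ₗ[k] C} (hi : Function.Injective i)
    (hcomul : ∀ d, TensorProduct.map i i (Coalgebra.comul (R := k) d) =
      Coalgebra.comul (R := k) (i d))
    (hcounit : ∀ d, Coalgebra.counit (R := k) d = Coalgebra.counit (R := k) (i d))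
    {δN : N →ₗ[k] N ⊗[k] D}
    (h : ∀ n, TensorProduct.map j i (δN n) = δM (j n)) : IsRightCoaction D δN where
  coassoc := by
    intro n
    apply map_inj hj (map_inj hi hi)
    have h1 : ∀ z : N ⊗[k] D, TensorProduct.map j (TensorProduct.map i i)
        ((Coalgebra.comul (R := k)).lTensor N z) =
        (Coalgebra.comul (R := k)).lTensor M (TensorProduct.map j i z) := by
      intro z
      induction z with
      | zero => simp
      | add z z' hz hz' => simp only [map_add, hz, hz']
      | tmul x y =>
        rw [LinearMap.lTensor_tmul, TensorProduct.map_tmul, hcomul]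
        rfl
    have h2 : ∀ z : N ⊗[k] D, TensorProduct.map (TensorProduct.map j i) i (δN.rTensor D z) =
        δM.rTensor C (TensorProduct.map j i z) := by
      intro z
      induction z with
      | zero => simp
      | add z z' hz hz' => simp only [map_add, hz, hz']
      | tmul x y =>
        rw [LinearMap.rTensor_tmul, TensorProduct.map_tmul, h]
        rfl
    rw [h1, ← assoc_map, h2, h, hM.coassoc]
  counit := by
    intro n
    apply rTensor_inj k hj
    have h1 : ∀ z : N ⊗[k] D, j.rTensor k ((Coalgebra.counit (R := k)).lTensor N z) =
        (Coalgebra.counit (R := k)).lTensor M (TensorProduct.map j i z) := by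
      intro z
      induction z with
      | zero => simp
      | add z z' hz hz' => simp only [map_add, hz, hz']
      | tmul x y =>
        rw [LinearMap.lTensor_tmul, LinearMap.rTensor_tmul, hcounit]
        rfl
    rw [h1, h, hM.counit]
    rfl

/-- A coalgebra is a left comodule over itself. -/
theorem isLeftCoaction_comul : IsLeftCoaction C (Coalgebra.comul (R := k) (A := C)) :=
  ⟨Coalgebra.coassoc_apply, Coalgebra.rTensor_counit_comul⟩

/-- A free left comodule `C ⊗ M`. -/
theorem isLeftCoaction_free : IsLeftCoaction C
    ((TensorProduct.assoc k C C M).toLinearMap ∘ₗ (Coalgebra.comul (R := k)).rTensor M) where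
  coassoc := by
    intro z
    have key : ∀ w : C ⊗[k] C, ∀ m : M, TensorProduct.assoc k C C (C ⊗[k] M)
        ((Coalgebra.comul (R := k)).rTensor (C ⊗[k] M) (TensorProduct.assoc k C C M (w ⊗ₜ m))) =
        ((TensorProduct.assoc k C C M).toLinearMap).lTensor C (TensorProduct.assoc k C (C ⊗[k] C) M
          (TensorProduct.assoc k C C C ((Coalgebra.comul (R := k)).rTensor C w) ⊗ₜ m)) := by
      intro w m
      induction w with
      | zero => simp
      | add z z' hz hz' => simp only [map_add, TensorProduct.add_tmul, hz, hz']
      | tmul x y =>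
        rw [TensorProduct.assoc_tmul, LinearMap.rTensor_tmul, LinearMap.rTensor_tmul]
        generalize Coalgebra.comul (R := k) x = w
        induction w with
        | zero => simp
        | add z z' hz hz' => simp only [map_add, TensorProduct.add_tmul, hz, hz']
        | tmul x y => rfl
    have key2 : ∀ w : C ⊗[k] C, ∀ m : M,
        ((TensorProduct.assoc k C C M).toLinearMap ∘ₗ (Coalgebra.comul (R := k)).rTensor M).lTensor
          C (TensorProduct.assoc k C C M (w ⊗ₜ m)) =
        ((TensorProduct.assoc k C C M).toLinearMap).lTensor C (TensorProduct.assoc k C (C ⊗[k] C) M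
          ((Coalgebra.comul (R := k)).lTensor C w ⊗ₜ m)) := by
      intro w m
      induction w with
      | zero => simp
      | add z z' hz hz' => simp only [map_add, TensorProduct.add_tmul, hz, hz']
      | tmul x y => rfl
    induction z with
    | zero => simp
    | add z z' hz hz' => simp only [map_add, hz, hz']
    | tmul x y =>
      rw [LinearMap.comp_apply, LinearMap.rTensor_tmul, LinearEquiv.coe_coe, key, key2,
        Coalgebra.coassoc_apply]
  counit := by
    intro z
    have key : ∀ w : C ⊗[k] C, ∀ m : M, (Coalgebra.counit (R := k)).rTensor (C ⊗[k] M)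
        (TensorProduct.assoc k C C M (w ⊗ₜ m)) = TensorProduct.assoc k k C M
          ((Coalgebra.counit (R := k)).rTensor C w ⊗ₜ m) := by
      intro w m
      induction w with
      | zero => simp
      | add z z' hz hz' => simp only [map_add, TensorProduct.add_tmul, hz, hz']
      | tmul x y => rfl
    induction z with
    | zero => simp
    | add z z' hz hz' => simp only [map_add, TensorProduct.tmul_add, hz, hz']
    | tmul x y =>
      rw [LinearMap.comp_apply, LinearMap.rTensor_tmul, LinearEquiv.coe_coe, key,
        Coalgebra.rTensor_counit_comul]
      rfl

end Sub

section LeftComodules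

variable (k : Type*) [Field k] (C : Type u) [AddCommGroup C] [Module k C] [Coalgebra k C]

/-- Left comodules over the coalgebra `C`. -/
structure LeftComod where
  carrier : Type u
  [grp : AddCommGroup carrier]
  [mod : Module k carrier]
  coact : carrier →ₗ[k] C ⊗[k] carrier
  isLeftCoaction : IsLeftCoaction C coact

attribute [instance] LeftComod.grp LeftComod.mod

variable {k C}

/-- Morphisms of left comodules. -/
@[ext]
structure LeftComod.Hom (V W : LeftComod k C) where
  lin : V.carrier →ₗ[k] W.carrier
  comm : ∀ v, W.coact (lin v) = lin.lTensor C (V.coact v)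

instance : Category (LeftComod k C) where
  Hom V W := LeftComod.Hom V W
  id V := ⟨LinearMap.id, fun v => by simp⟩
  comp f g := ⟨g.lin ∘ₗ f.lin, fun v => by
    rw [LinearMap.comp_apply, g.comm, f.comm, LinearMap.lTensor_comp, LinearMap.comp_apply]⟩

theorem LeftComod.id_lin (V : LeftComod k C) : LeftComod.Hom.lin (𝟙 V) = LinearMap.id := rfl

theorem LeftComod.comp_lin {V W U : LeftComod k C} (f : V ⟶ W) (g : W ⟶ U) :
    LeftComod.Hom.lin (f ≫ g) = LeftComod.Hom.lin g ∘ₗ LeftComod.Hom.lin f := rfl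

end LeftComodules

section RelativeHopfModules

variable {k : Type*} [Field k] {A : Type u} [Ring A] [HopfAlgebra k A]

/-- Relative Hopf modules, the objects of `^A_B Mod`: left `B`-modules `M` with a left
`A`-comodule structure such that `Δ_L(b m) = Δ(b) Δ_L(m)`. -/
structure RelHopfMod (B : Subalgebra k A) [IsQuantumHomogeneousSpace B] where
  carrier : Type u
  [grp : AddCommGroup carrier]
  [mod : Module k carrier]
  [modB : Module B carrier]
  [tower : IsScalarTower k B carrier]
  coact : carrier →ₗ[k] A ⊗[k] carrier
  isLeftCoaction : IsLeftCoaction A coact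
  coact_smul : ∀ (b : B) (m : carrier), coact (b • m) =
    TensorProduct.map₂ (LinearMap.mul k A) (act k B carrier) (coidealComul B b) (coact m)

attribute [instance] RelHopfMod.grp RelHopfMod.mod RelHopfMod.modB RelHopfMod.tower

variable {B : Subalgebra k A} [IsQuantumHomogeneousSpace B]

/-- Morphisms of relative Hopf modules: left `B`-module and left `A`-comodule maps. -/
@[ext]
structure RelHopfMod.Hom (M N : RelHopfMod B) where
  lin : M.carrier →ₗ[B] N.carrier
  comm : ∀ m, N.coact (lin m) = (lin.restrictScalars k).lTensor A (M.coact m)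

/-- The identity morphism. -/
def RelHopfMod.Hom.id (M : RelHopfMod B) : RelHopfMod.Hom M M :=
  ⟨LinearMap.id, fun _ => (LinearMap.congr_fun (LinearMap.lTensor_id A M.carrier) _).symm⟩

/-- Composition of morphisms. -/
def RelHopfMod.Hom.comp {M N L : RelHopfMod B} (f : RelHopfMod.Hom M N)
    (g : RelHopfMod.Hom N L) : RelHopfMod.Hom M L :=
  ⟨g.lin ∘ₗ f.lin, fun m => by
    rw [LinearMap.comp_apply, g.comm, f.comm]
    exact (LinearMap.congr_fun (LinearMap.lTensor_comp A (g.lin.restrictScalars k)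
      (f.lin.restrictScalars k)) (M.coact m)).symm⟩

instance : Category (RelHopfMod B) where
  Hom M N := RelHopfMod.Hom M N
  id M := RelHopfMod.Hom.id M
  comp f g := RelHopfMod.Hom.comp f g

theorem RelHopfMod.id_lin (M : RelHopfMod B) : RelHopfMod.Hom.lin (𝟙 M) = LinearMap.id := rfl

theorem RelHopfMod.comp_lin {M N L : RelHopfMod B} (f : M ⟶ N) (g : N ⟶ L) :
    RelHopfMod.Hom.lin (f ≫ g) = RelHopfMod.Hom.lin g ∘ₗ RelHopfMod.Hom.lin f := rfl

theorem isLeftCoaction_coidealComul (B : Subalgebra k A) [IsQuantumHomogeneousSpace B] :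
    IsLeftCoaction A (coidealComul B) :=
  isLeftCoaction_comul.sub (j := B.val.toLinearMap) Subtype.val_injective (coidealComul_spec B)

theorem coidealComul_mul (b c : B) : coidealComul B (b * c) =
    TensorProduct.map₂ (LinearMap.mul k A) (LinearMap.mul k B) (coidealComul B b)
      (coidealComul B c) := by
  apply lTensor_inj A (f := B.val.toLinearMap) Subtype.val_injective
  rw [coidealComul_spec]
  have h := map_map₂ (k := k) (β := LinearMap.mul k A) (β₁ := LinearMap.mul k A)
    (f := LinearMap.id) (g := LinearMap.id) (h := LinearMap.id) (fun _ _ => rfl)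
    (β' := LinearMap.mul k B) (β₁' := LinearMap.mul k A) (f' := B.val.toLinearMap)
    (g' := B.val.toLinearMap) (h' := B.val.toLinearMap) (fun _ _ => rfl)
    (coidealComul B b) (coidealComul B c)
  have e1 := coidealComul_spec B b
  have e2 := coidealComul_spec B c
  rw [LinearMap.lTensor] at e1 e2 ⊢
  rw [h, e1, e2]
  exact comul_mul_map₂ (b : A) (c : A)

end RelativeHopfModules

section PairModules

variable {k : Type*} [Field k] {A : Type u} [Ring A] [HopfAlgebra k A]

/-- The objects of `^A_P Mod^{π_B(P)}`: relative Hopf modules `M` in `^A_P Mod` with a right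
`π_B(P)`-comodule structure `Δ_R` which commutes with the left `A`-coaction and satisfies
`Δ_R(p m) = Δ_R(p) Δ_R(m)`. -/
structure PairMod (B P : Subalgebra k A) [IsQuantumHomogeneousSpace B]
    [IsQuantumHomogeneousSpace P] [IsPrincipalPair B P] extends RelHopfMod P where
  rcoact : carrier →ₗ[k] carrier ⊗[k] fiber B P
  isRightCoaction : IsRightCoaction (fiber B P) rcoact
  rcoact_smul : ∀ (p : P) (m : carrier), rcoact (p • m) =
    TensorProduct.map₂ (act k P carrier) (LinearMap.mul k (fiber B P)) (pairCoact B P p) (rcoact m)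
  bicomodule : ∀ m : carrier, TensorProduct.assoc k A carrier (fiber B P)
    (coact.rTensor (fiber B P) (rcoact m)) = rcoact.lTensor A (coact m)

variable {B P : Subalgebra k A} [IsQuantumHomogeneousSpace B]
    [IsQuantumHomogeneousSpace P] [IsPrincipalPair B P]

/-- Morphisms in `^A_P Mod^{π_B(P)}`: left `P`-module maps that are maps of left `A`-comodules and
of right `π_B(P)`-comodules. -/
@[ext]
structure PairMod.Hom (M N : PairMod B P) where
  lin : M.carrier →ₗ[P] N.carrier
  comm : ∀ m, N.coact (lin m) = (lin.restrictScalars k).lTensor A (M.coact m)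
  rcomm : ∀ m, N.rcoact (lin m) = (lin.restrictScalars k).rTensor (fiber B P) (M.rcoact m)

/-- The identity morphism. -/
def PairMod.Hom.id (M : PairMod B P) : PairMod.Hom M M :=
  ⟨LinearMap.id, fun _ => (LinearMap.congr_fun (LinearMap.lTensor_id A M.carrier) _).symm,
    fun _ => (LinearMap.congr_fun (LinearMap.rTensor_id (fiber B P) M.carrier) _).symm⟩

/-- Composition of morphisms. -/
def PairMod.Hom.comp {M N L : PairMod B P} (f : PairMod.Hom M N)
    (g : PairMod.Hom N L) : PairMod.Hom M L :=
  ⟨g.lin ∘ₗ f.lin, fun m => by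
    rw [LinearMap.comp_apply, g.comm, f.comm]
    exact (LinearMap.congr_fun (LinearMap.lTensor_comp A (g.lin.restrictScalars k)
      (f.lin.restrictScalars k)) (M.coact m)).symm, fun m => by
    rw [LinearMap.comp_apply, g.rcomm, f.rcomm]
    exact (LinearMap.congr_fun (LinearMap.rTensor_comp (fiber B P) (g.lin.restrictScalars k)
      (f.lin.restrictScalars k)) (M.rcoact m)).symm⟩

instance : Category (PairMod B P) where
  Hom M N := PairMod.Hom M N
  id M := PairMod.Hom.id M
  comp f g := PairMod.Hom.comp f g

theorem PairMod.id_lin (M : PairMod B P) : PairMod.Hom.lin (𝟙 M) = LinearMap.id := rfl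

theorem PairMod.comp_lin {M N L : PairMod B P} (f : M ⟶ N) (g : N ⟶ L) :
    PairMod.Hom.lin (f ≫ g) = PairMod.Hom.lin g ∘ₗ PairMod.Hom.lin f := rfl

end PairModules

section Takeuchi

variable {k : Type*} [Field k] {A : Type u} [Ring A] [HopfAlgebra k A]
variable (B : Subalgebra k A) [IsQuantumHomogeneousSpace B]

/-- The subspace `B⁺M` of `M`. -/
def plusSub (M : RelHopfMod B) : Submodule k M.carrier :=
  Submodule.span k {x | ∃ (b : B) (m : M.carrier), (b : A) ∈ plus B ∧ x = b • m}

theorem mkQ_smul (M : RelHopfMod B) (b : B) (m : M.carrier) :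
    (plusSub B M).mkQ (b • m) = Coalgebra.counit (R := k) (b : A) • (plusSub B M).mkQ m := by
  rw [← map_smul, ← sub_eq_zero, ← map_sub, Submodule.mkQ_apply, Submodule.Quotient.mk_eq_zero]
  refine Submodule.subset_span
    ⟨b - algebraMap k B (Coalgebra.counit (R := k) (b : A)), m, ⟨Subtype.property _, ?_⟩, ?_⟩
  · simp
  · rw [sub_smul, algebraMap_smul]

/-- The map `m ↦ π_B(m₋₁) ⊗ [m₀]`. -/
noncomputable def phiCoactAux (M : RelHopfMod B) :
    M.carrier →ₗ[k] QuotHopf B ⊗[k] (M.carrier ⧸ plusSub B M) :=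
  TensorProduct.map (proj B).toLinearMap (plusSub B M).mkQ ∘ₗ M.coact

theorem phiCoactAux_plusSub (M : RelHopfMod B) :
    plusSub B M ≤ LinearMap.ker (phiCoactAux B M) := by
  refine Submodule.span_le.2 ?_
  rintro _ ⟨b, m, hb, rfl⟩
  rw [SetLike.mem_coe, LinearMap.mem_ker, phiCoactAux, LinearMap.comp_apply, M.coact_smul]
  have h := map_map₂ (k := k) (β := LinearMap.mul k A) (β₁ := LinearMap.mul k (QuotHopf B))
    (f := (proj B).toLinearMap) (g := (proj B).toLinearMap) (h := (proj B).toLinearMap)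
    (fun x y => map_mul (proj B) x y)
    (β' := act k B M.carrier) (β₁' := LinearMap.lsmul k (M.carrier ⧸ plusSub B M))
    (f' := Coalgebra.counit (R := k) (A := A) ∘ₗ B.val.toLinearMap)
    (g' := (plusSub B M).mkQ) (h' := (plusSub B M).mkQ)
    (fun x y => mkQ_smul B M x y) (coidealComul B b) (M.coact m)
  have h2 : TensorProduct.map (proj B).toLinearMap
      (Coalgebra.counit (R := k) (A := A) ∘ₗ B.val.toLinearMap) (coidealComul B b) = 0 := by
    have h3 := congrArg ((proj B).toLinearMap.rTensor k) (lTensor_counit_coidealComul B b)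
    rw [LinearMap.rTensor_tmul, show (proj B).toLinearMap (b : A) = 0 from
      proj_eq_zero B (plus_le B hb), TensorProduct.zero_tmul] at h3
    exact (LinearMap.congr_fun (LinearMap.rTensor_comp_lTensor _ _ _) _).symm.trans h3
  rw [h, h2, map_zero, LinearMap.zero_apply]

/-- The left `π_B(A)`-coaction `[m] ↦ π_B(m₋₁) ⊗ [m₀]` on `M / B⁺M`. -/
noncomputable def phiCoact (M : RelHopfMod B) :
    (M.carrier ⧸ plusSub B M) →ₗ[k] QuotHopf B ⊗[k] (M.carrier ⧸ plusSub B M) :=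
  (plusSub B M).liftQ (phiCoactAux B M) (phiCoactAux_plusSub B M)

theorem phiCoact_mk (M : RelHopfMod B) (m : M.carrier) : phiCoact B M ((plusSub B M).mkQ m) =
    TensorProduct.map (proj B).toLinearMap (plusSub B M).mkQ (M.coact m) := rfl

theorem isLeftCoaction_quot {C D M N : Type*} [AddCommGroup C] [Module k C] [Coalgebra k C]
    [AddCommGroup D] [Module k D] [Coalgebra k D] [AddCommGroup M] [Module k M] [AddCommGroup N]
    [Module k N] {δM : M →ₗ[k] C ⊗[k] M} (hM : IsLeftCoaction C δM) {δN : N →ₗ[k] D ⊗[k] N}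
    {f : C →ₗ[k] D} {q : M →ₗ[k] N} (hq : Function.Surjective q)
    (hcomul : ∀ c, Coalgebra.comul (R := k) (f c) = TensorProduct.map f f (Coalgebra.comul c))
    (hcounit : ∀ c, Coalgebra.counit (R := k) (f c) = Coalgebra.counit (R := k) c)
    (h : ∀ m, δN (q m) = TensorProduct.map f q (δM m)) : IsLeftCoaction D δN where
  coassoc := by
    intro n
    obtain ⟨m, rfl⟩ := hq n
    have h1 : ∀ z : C ⊗[k] M, (Coalgebra.comul (R := k)).rTensor N (TensorProduct.map f q z) =
        TensorProduct.map (TensorProduct.map f f) q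
          ((Coalgebra.comul (R := k)).rTensor M z) := by
      intro z
      induction z with
      | zero => simp
      | add z z' hz hz' => simp only [map_add, hz, hz']
      | tmul x y =>
        rw [TensorProduct.map_tmul, LinearMap.rTensor_tmul, hcomul]
        rfl
    have h2 : ∀ z : C ⊗[k] M, δN.lTensor D (TensorProduct.map f q z) =
        TensorProduct.map f (TensorProduct.map f q) (δM.lTensor C z) := by
      intro z
      induction z with
      | zero => simp
      | add z z' hz hz' => simp only [map_add, hz, hz']
      | tmul x y =>
        rw [TensorProduct.map_tmul, LinearMap.lTensor_tmul, h]
        rfl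
    rw [h, h1, h2, assoc_map, hM.coassoc]
  counit := by
    intro n
    obtain ⟨m, rfl⟩ := hq n
    have h1 : ∀ z : C ⊗[k] M, (Coalgebra.counit (R := k)).rTensor N (TensorProduct.map f q z) =
        q.lTensor k ((Coalgebra.counit (R := k)).rTensor M z) := by
      intro z
      induction z with
      | zero => simp
      | add z z' hz hz' => simp only [map_add, hz, hz']
      | tmul x y =>
        rw [TensorProduct.map_tmul, LinearMap.rTensor_tmul, hcounit]
        rfl
    rw [h, h1, hM.counit]
    rfl

/-- The functor `Φ : ^A_B Mod → ^{π_B} Mod`, `M ↦ M / B⁺M`. -/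
noncomputable def takeuchiPhi : RelHopfMod B ⥤ LeftComod k (QuotHopf B) where
  obj M :=
    { carrier := M.carrier ⧸ plusSub B M
      coact := phiCoact B M
      isLeftCoaction := isLeftCoaction_quot M.isLeftCoaction (Submodule.mkQ_surjective _)
        (comul_proj B) (counit_proj B) (phiCoact_mk B M) }
  map {M N} f :=
    { lin := Submodule.mapQ (plusSub B M) (plusSub B N)
        ((RelHopfMod.Hom.lin f).restrictScalars k) (by
          refine Submodule.span_le.2 ?_
          rintro _ ⟨b, m, hb, rfl⟩
          exact Submodule.subset_span ⟨b, RelHopfMod.Hom.lin f m, hb, (RelHopfMod.Hom.lin f).map_smul b m⟩)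
      comm := by
        intro v
        obtain ⟨m, rfl⟩ := Submodule.mkQ_surjective _ v
        change phiCoact B N ((plusSub B N).mkQ (RelHopfMod.Hom.lin f m)) = _
        rw [phiCoact_mk, phiCoact_mk, RelHopfMod.Hom.comm]
        generalize M.coact m = z
        induction z with
        | zero => simp
        | add z z' hz hz' => simp only [map_add, hz, hz']
        | tmul x y => rfl }
  map_id M := by
    refine LeftComod.Hom.ext (Submodule.linearMap_qext _ ?_)
    rfl
  map_comp f g := by
    refine LeftComod.Hom.ext (Submodule.linearMap_qext _ ?_)
    rfl

end Takeuchi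

section Cotensor

variable {k : Type*} [Field k] {A : Type u} [Ring A] [HopfAlgebra k A]
variable (B : Subalgebra k A) [IsQuantumHomogeneousSpace B]

theorem projCoact_mul (a c : A) : projCoact B (a * c) =
    TensorProduct.map₂ (LinearMap.mul k A) (LinearMap.mul k (QuotHopf B)) (projCoact B a)
      (projCoact B c) := by
  have h := map_map₂ (k := k) (β := LinearMap.mul k A) (β₁ := LinearMap.mul k A)
    (f := LinearMap.id) (g := LinearMap.id) (h := LinearMap.id) (fun _ _ => rfl)
    (β' := LinearMap.mul k A) (β₁' := LinearMap.mul k (QuotHopf B)) (f' := (proj B).toLinearMap)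
    (g' := (proj B).toLinearMap) (h' := (proj B).toLinearMap) (fun x y => map_mul (proj B) x y)
    (Coalgebra.comul a) (Coalgebra.comul c)
  rw [← comul_mul_map₂] at h
  exact h

theorem projCoact_of_mem {b : A} (hb : b ∈ B) : projCoact B b = b ⊗ₜ 1 := proj_comul B hb

theorem projCoact_smul (b : B) (a : A) : projCoact B ((b : A) * a) = (b : A) • projCoact B a := by
  rw [projCoact_mul, projCoact_of_mem B b.2]
  generalize projCoact B a = z
  induction z with
  | zero => simp
  | add z z' hz hz' => simp only [map_add, smul_add, hz, hz']
  | tmul x y => simp [TensorProduct.map₂_apply_tmul, TensorProduct.smul_tmul']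

/-- The right coaction of `π_B(A)` on `A` is a right coaction. -/
theorem isRightCoaction_projCoact : IsRightCoaction (QuotHopf B) (projCoact B) where
  coassoc := by
    intro a
    have h1 : ∀ z : A ⊗[k] A, (projCoact B).rTensor (QuotHopf B) ((proj B).toLinearMap.lTensor A z) =
        TensorProduct.map (TensorProduct.map LinearMap.id (proj B).toLinearMap)
          (proj B).toLinearMap (Coalgebra.comul.rTensor A z) := by
      intro z
      induction z with
      | zero => simp
      | add z z' hz hz' => simp only [map_add, hz, hz']
      | tmul x y => rfl
    have h2 : ∀ z : A ⊗[k] A,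
        (Coalgebra.comul (R := k)).lTensor A ((proj B).toLinearMap.lTensor A z) =
        TensorProduct.map LinearMap.id (TensorProduct.map (proj B).toLinearMap
          (proj B).toLinearMap) (Coalgebra.comul.lTensor A z) := by
      intro z
      induction z with
      | zero => simp
      | add z z' hz hz' => simp only [map_add, hz, hz']
      | tmul x y => rfl
    have e : projCoact B a = (proj B).toLinearMap.lTensor A (Coalgebra.comul a) := rfl
    rw [e, h1, assoc_map, h2, Coalgebra.coassoc_apply]
  counit := by
    intro a
    have h1 : ∀ z : A ⊗[k] A,
        (Coalgebra.counit (R := k)).lTensor A ((proj B).toLinearMap.lTensor A z) =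
        (Coalgebra.counit (R := k)).lTensor A z := by
      intro z
      induction z with
      | zero => simp
      | add z z' hz hz' => simp only [map_add, hz, hz']
      | tmul x y => rfl
    have e : projCoact B a = (proj B).toLinearMap.lTensor A (Coalgebra.comul a) := rfl
    rw [e, h1, Coalgebra.lTensor_counit_comul]

/-- The difference of the two maps `A ⊗ V → A ⊗ π_B(A) ⊗ V` whose equaliser is the cotensor
product. -/
noncomputable def cotDiff (V : LeftComod k (QuotHopf B)) :
    A ⊗[k] V.carrier →ₗ[k] A ⊗[k] (QuotHopf B ⊗[k] V.carrier) :=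
  (TensorProduct.assoc k A (QuotHopf B) V.carrier).toLinearMap ∘ₗ (projCoact B).rTensor V.carrier -
    V.coact.lTensor A

theorem cotDiff_tmul (V : LeftComod k (QuotHopf B)) (a : A) (v : V.carrier) : cotDiff B V (a ⊗ₜ v) =
    TensorProduct.assoc k A (QuotHopf B) V.carrier (projCoact B a ⊗ₜ v) - a ⊗ₜ V.coact v := rfl

theorem cotDiff_smul (V : LeftComod k (QuotHopf B)) (b : B) (z : A ⊗[k] V.carrier) :
    cotDiff B V (b • z) = (b : A) • cotDiff B V z := by
  induction z with
  | zero => simp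
  | add z z' hz hz' => simp only [map_add, smul_add, hz, hz']
  | tmul a v =>
    have e : b • (a ⊗ₜ[k] v) = ((b : A) * a) ⊗ₜ[k] v := rfl
    rw [e, cotDiff_tmul, cotDiff_tmul, projCoact_smul, smul_sub]
    congr 1
    generalize projCoact B a = w
    induction w with
    | zero => simp
    | add z z' hz hz' => simp only [map_add, smul_add, TensorProduct.add_tmul, hz, hz']
    | tmul x y => rfl

/-- The cotensor product `A □_{π_B} V`, a `B`-submodule of `A ⊗ V`. -/
noncomputable def cotensor (V : LeftComod k (QuotHopf B)) : Submodule B (A ⊗[k] V.carrier) where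
  carrier := {z | cotDiff B V z = 0}
  add_mem' := by
    intro x y hx hy
    rw [Set.mem_ofPred_eq] at hx hy ⊢
    rw [map_add, hx, hy, add_zero]
  zero_mem' := map_zero _
  smul_mem' := by
    intro b z hz
    rw [Set.mem_ofPred_eq] at hz ⊢
    rw [cotDiff_smul, hz, smul_zero]

theorem mem_cotensor (V : LeftComod k (QuotHopf B)) (z : A ⊗[k] V.carrier) :
    z ∈ cotensor B V ↔ cotDiff B V z = 0 := Iff.rfl

/-- The left `B`-module `A □_{π_B} V`. -/
def Cotensor (V : LeftComod k (QuotHopf B)) : Type u := cotensor B V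

noncomputable instance (V : LeftComod k (QuotHopf B)) : AddCommGroup (Cotensor B V) :=
  inferInstanceAs (AddCommGroup (cotensor B V))

noncomputable instance (V : LeftComod k (QuotHopf B)) : Module k (Cotensor B V) :=
  inferInstanceAs (Module k (cotensor B V))

noncomputable instance (V : LeftComod k (QuotHopf B)) : Module B (Cotensor B V) :=
  inferInstanceAs (Module B (cotensor B V))

instance (V : LeftComod k (QuotHopf B)) : IsScalarTower k B (Cotensor B V) :=
  inferInstanceAs (IsScalarTower k B (cotensor B V))

/-- The inclusion of `A □_{π_B} V` in `A ⊗ V`. -/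
noncomputable def cotVal (V : LeftComod k (QuotHopf B)) : Cotensor B V →ₗ[k] A ⊗[k] V.carrier :=
  (cotensor B V).subtype.restrictScalars k

theorem cotVal_inj (V : LeftComod k (QuotHopf B)) : Function.Injective (cotVal B V) :=
  Subtype.val_injective

theorem cotVal_smul (V : LeftComod k (QuotHopf B)) (b : B) (z : Cotensor B V) :
    cotVal B V (b • z) = b • cotVal B V z := rfl

theorem cotDiff_cotVal (V : LeftComod k (QuotHopf B)) (z : Cotensor B V) :
    cotDiff B V (cotVal B V z) = 0 := z.2

theorem cotVal_exact (V : LeftComod k (QuotHopf B)) :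
    Function.Exact (cotVal B V) (cotDiff B V) := by
  intro z
  exact ⟨fun h => ⟨⟨z, h⟩, rfl⟩, fun ⟨y, hy⟩ => hy ▸ cotDiff_cotVal B V y⟩

/-- The coaction `Δ ⊗ id` on `A ⊗ M`. -/
noncomputable def freeCoact (A M : Type*) [Ring A] [HopfAlgebra k A] [AddCommGroup M]
    [Module k M] : A ⊗[k] M →ₗ[k] A ⊗[k] (A ⊗[k] M) :=
  (TensorProduct.assoc k A A M).toLinearMap ∘ₗ (Coalgebra.comul (R := k)).rTensor M

theorem freeCoact_tmul {M : Type*} [AddCommGroup M] [Module k M] (a : A) (m : M) :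
    freeCoact A M (a ⊗ₜ[k] m) = TensorProduct.assoc k A A M (Coalgebra.comul (R := k) a ⊗ₜ m) := rfl

theorem projCoact_comul (a : A) : (projCoact B).lTensor A (Coalgebra.comul (R := k) a) =
    freeCoact A (QuotHopf B) (projCoact B a) := by
  have h1 : ∀ z : A ⊗[k] A, freeCoact A (QuotHopf B) ((proj B).toLinearMap.lTensor A z) =
      ((proj B).toLinearMap.lTensor A).lTensor A
        (TensorProduct.assoc k A A A ((Coalgebra.comul (R := k)).rTensor A z)) := by
    intro z
    induction z with
    | zero => simp
    | add z z' hz hz' => simp only [map_add, hz, hz']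
    | tmul x y =>
      rw [LinearMap.lTensor_tmul, LinearMap.rTensor_tmul, freeCoact_tmul]
      generalize Coalgebra.comul (R := k) x = w
      induction w with
      | zero => simp
      | add z z' hz hz' => simp only [map_add, TensorProduct.add_tmul, hz, hz']
      | tmul x y => rfl
  have e : projCoact B a = (proj B).toLinearMap.lTensor A (Coalgebra.comul a) := rfl
  rw [e, h1, Coalgebra.coassoc_apply, projCoact, LinearMap.lTensor_comp, LinearMap.comp_apply]

theorem cotDiff_freeCoact (V : LeftComod k (QuotHopf B)) (z : A ⊗[k] V.carrier) :
    (cotDiff B V).lTensor A (freeCoact A V.carrier z) =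
      freeCoact A (QuotHopf B ⊗[k] V.carrier) (cotDiff B V z) := by
  have h1 : ∀ (w : A ⊗[k] A) (v : V.carrier), (cotDiff B V).lTensor A
      (TensorProduct.assoc k A A V.carrier (w ⊗ₜ v)) =
      (TensorProduct.assoc k A (QuotHopf B) V.carrier).toLinearMap.lTensor A
        (TensorProduct.assoc k A (A ⊗[k] QuotHopf B) V.carrier ((projCoact B).lTensor A w ⊗ₜ v)) -
      TensorProduct.assoc k A A (QuotHopf B ⊗[k] V.carrier) (w ⊗ₜ V.coact v) := by
    intro w v
    induction w with
    | zero => simp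
    | add z z' hz hz' =>
      simp only [map_add, TensorProduct.add_tmul, hz, hz']
      abel
    | tmul x y =>
      rw [TensorProduct.assoc_tmul, LinearMap.lTensor_tmul, cotDiff_tmul, TensorProduct.tmul_sub]
      rfl
  have h2 : ∀ (w : A ⊗[k] QuotHopf B) (v : V.carrier),
      (TensorProduct.assoc k A (QuotHopf B) V.carrier).toLinearMap.lTensor A
        (TensorProduct.assoc k A (A ⊗[k] QuotHopf B) V.carrier (freeCoact A (QuotHopf B) w ⊗ₜ v)) =
      freeCoact A (QuotHopf B ⊗[k] V.carrier)
        (TensorProduct.assoc k A (QuotHopf B) V.carrier (w ⊗ₜ v)) := by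
    intro w v
    induction w with
    | zero => simp
    | add z z' hz hz' => simp only [map_add, TensorProduct.add_tmul, hz, hz']
    | tmul x y =>
      rw [TensorProduct.assoc_tmul, freeCoact_tmul, freeCoact_tmul]
      generalize Coalgebra.comul (R := k) x = w
      induction w with
      | zero => simp
      | add z z' hz hz' => simp only [map_add, TensorProduct.add_tmul, hz, hz']
      | tmul x y => rfl
  induction z with
  | zero => simp
  | add z z' hz hz' => simp only [map_add, hz, hz']
  | tmul a v =>
    rw [freeCoact_tmul, cotDiff_tmul, h1, projCoact_comul, h2, map_sub, freeCoact_tmul]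

theorem psiCoact_mem (V : LeftComod k (QuotHopf B)) (z : Cotensor B V) :
    (freeCoact A V.carrier ∘ₗ cotVal B V) z ∈ LinearMap.range ((cotVal B V).lTensor A) := by
  refine mem_range_lTensor A (cotVal_exact B V) ?_
  rw [LinearMap.comp_apply, cotDiff_freeCoact, cotDiff_cotVal, map_zero]

/-- The left `A`-coaction `Δ ⊗ id` on `A □_{π_B} V`. -/
noncomputable def psiCoact (V : LeftComod k (QuotHopf B)) :
    Cotensor B V →ₗ[k] A ⊗[k] Cotensor B V :=
  liftInj ((cotVal B V).lTensor A) (lTensor_inj A (cotVal_inj B V))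
    (freeCoact A V.carrier ∘ₗ cotVal B V) (psiCoact_mem B V)

theorem psiCoact_spec (V : LeftComod k (QuotHopf B)) (z : Cotensor B V) :
    (cotVal B V).lTensor A (psiCoact B V z) = freeCoact A V.carrier (cotVal B V z) :=
  liftInj_spec _ _ _ _ _

theorem freeCoact_smul {M : Type*} [AddCommGroup M] [Module k M] (b : B) (z : A ⊗[k] M) :
    freeCoact A M (b • z) = TensorProduct.map₂ (LinearMap.mul k A) (act k B (A ⊗[k] M))
      (coidealComul B b) (freeCoact A M z) := by
  have key : ∀ (w : A ⊗[k] B) (y : A ⊗[k] A) (m : M), TensorProduct.assoc k A A M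
      (TensorProduct.map₂ (LinearMap.mul k A) (LinearMap.mul k A)
        (B.val.toLinearMap.lTensor A w) y ⊗ₜ m) =
      TensorProduct.map₂ (LinearMap.mul k A) (act k B (A ⊗[k] M)) w
        (TensorProduct.assoc k A A M (y ⊗ₜ m)) := by
    intro w y m
    induction w with
    | zero => simp
    | add z z' hz hz' =>
      simp only [map_add, LinearMap.add_apply, TensorProduct.add_tmul, hz, hz']
    | tmul x x' =>
      induction y with
      | zero => simp
      | add z z' hz hz' => simp only [map_add, TensorProduct.add_tmul, hz, hz']
      | tmul y y' => rfl
  induction z with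
  | zero => simp
  | add z z' hz hz' => simp only [map_add, smul_add, hz, hz']
  | tmul a m =>
    have e : b • (a ⊗ₜ[k] m) = (LinearMap.mul k A (b : A) a) ⊗ₜ[k] m := rfl
    rw [e, freeCoact_tmul, freeCoact_tmul, comul_mul_map₂, ← coidealComul_spec, key]

theorem psiCoact_smul (V : LeftComod k (QuotHopf B)) (b : B) (z : Cotensor B V) :
    psiCoact B V (b • z) = TensorProduct.map₂ (LinearMap.mul k A) (act k B (Cotensor B V))
      (coidealComul B b) (psiCoact B V z) := by
  apply lTensor_inj A (cotVal_inj B V)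
  have h := map_map₂ (k := k) (β := LinearMap.mul k A) (β₁ := LinearMap.mul k A)
    (f := LinearMap.id) (g := LinearMap.id) (h := LinearMap.id) (fun _ _ => rfl)
    (β' := act k B (Cotensor B V)) (β₁' := act k B (A ⊗[k] V.carrier)) (f' := LinearMap.id)
    (g' := cotVal B V) (h' := cotVal B V) (fun _ _ => rfl)
    (coidealComul B b) (psiCoact B V z)
  have e := psiCoact_spec B V z
  rw [TensorProduct.map_id, LinearMap.id_apply] at h
  refine (psiCoact_spec B V (b • z)).trans ((freeCoact_smul B b (cotVal B V z)).trans ?_)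
  rw [← e]
  exact h.symm

variable {B}

theorem cotDiff_lTensor {V W : LeftComod k (QuotHopf B)} (f : LeftComod.Hom V W)
    (z : A ⊗[k] V.carrier) : cotDiff B W (f.lin.lTensor A z) =
      (f.lin.lTensor (QuotHopf B)).lTensor A (cotDiff B V z) := by
  induction z with
  | zero => simp
  | add z z' hz hz' => simp only [map_add, hz, hz']
  | tmul a v =>
    rw [LinearMap.lTensor_tmul, cotDiff_tmul, cotDiff_tmul, map_sub,
      LinearMap.lTensor_tmul, LeftComod.Hom.comm]
    congr 1
    generalize projCoact B a = w
    induction w with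
    | zero => simp
    | add z z' hz hz' => simp only [map_add, TensorProduct.add_tmul, hz, hz']
    | tmul x y => rfl

theorem lTensor_smul {V W : LeftComod k (QuotHopf B)} (f : LeftComod.Hom V W) (b : B)
    (z : A ⊗[k] V.carrier) : f.lin.lTensor A (b • z) = b • f.lin.lTensor A z := by
  induction z with
  | zero => simp
  | add z z' hz hz' => simp only [map_add, smul_add, hz, hz']
  | tmul a v => rfl

theorem freeCoact_lTensor {M N : Type*} [AddCommGroup M] [Module k M] [AddCommGroup N] [Module k N]
    (f : M →ₗ[k] N) (z : A ⊗[k] M) :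
    freeCoact A N (f.lTensor A z) = (f.lTensor A).lTensor A (freeCoact A M z) := by
  induction z with
  | zero => simp
  | add z z' hz hz' => simp only [map_add, hz, hz']
  | tmul a v =>
    rw [LinearMap.lTensor_tmul, freeCoact_tmul, freeCoact_tmul]
    generalize Coalgebra.comul (R := k) a = w
    induction w with
    | zero => simp
    | add z z' hz hz' => simp only [map_add, TensorProduct.add_tmul, hz, hz']
    | tmul x y => rfl

/-- The restriction `A □_{π_B} V → A □_{π_B} W` of `id ⊗ f`. -/
noncomputable def psiMap {V W : LeftComod k (QuotHopf B)} (f : LeftComod.Hom V W) :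
    Cotensor B V →ₗ[B] Cotensor B W where
  toFun z := ⟨f.lin.lTensor A (cotVal B V z), by
    rw [mem_cotensor, cotDiff_lTensor, cotDiff_cotVal, map_zero]⟩
  map_add' _ _ := Subtype.ext (map_add _ _ _)
  map_smul' b z := Subtype.ext (lTensor_smul f b (cotVal B V z))

theorem cotVal_psiMap {V W : LeftComod k (QuotHopf B)} (f : LeftComod.Hom V W) (z : Cotensor B V) :
    cotVal B W (psiMap f z) = f.lin.lTensor A (cotVal B V z) := rfl

theorem psiMap_comm {V W : LeftComod k (QuotHopf B)} (f : LeftComod.Hom V W) (z : Cotensor B V) :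
    psiCoact B W (psiMap f z) = ((psiMap f).restrictScalars k).lTensor A (psiCoact B V z) := by
  apply lTensor_inj A (cotVal_inj B W)
  have h : cotVal B W ∘ₗ (psiMap f).restrictScalars k = f.lin.lTensor A ∘ₗ cotVal B V := rfl
  have h2 := LinearMap.congr_fun (LinearMap.lTensor_comp A (cotVal B W)
    ((psiMap f).restrictScalars k)) (psiCoact B V z)
  have h3 := LinearMap.congr_fun (LinearMap.lTensor_comp A (f.lin.lTensor A) (cotVal B V))
    (psiCoact B V z)
  rw [h] at h2
  refine Eq.trans ?_ (h3.symm.trans h2)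
  rw [LinearMap.comp_apply, psiCoact_spec, psiCoact_spec, cotVal_psiMap, freeCoact_lTensor]

variable (B)

/-- The functor `Ψ : ^{π_B} Mod → ^A_B Mod`, `V ↦ A □_{π_B} V`. -/
noncomputable def takeuchiPsi : LeftComod k (QuotHopf B) ⥤ RelHopfMod B where
  obj V :=
    { carrier := Cotensor B V
      coact := psiCoact B V
      isLeftCoaction := IsLeftCoaction.sub isLeftCoaction_free (cotVal_inj B V) (psiCoact_spec B V)
      coact_smul := psiCoact_smul B V }
  map f := { lin := psiMap f, comm := psiMap_comm f }
  map_id V := by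
    refine RelHopfMod.Hom.ext (LinearMap.ext fun z => Subtype.ext ?_)
    exact LinearMap.congr_fun (LinearMap.lTensor_id A V.carrier) (cotVal B V z)
  map_comp {V W U} f g := by
    refine RelHopfMod.Hom.ext (LinearMap.ext fun z => Subtype.ext ?_)
    exact LinearMap.congr_fun (LinearMap.lTensor_comp A (LeftComod.Hom.lin g)
      (LeftComod.Hom.lin f)) (cotVal B V z)

end Cotensor

section Helper

variable {k : Type*} [Field k]

theorem map_lTensor_assoc {C X T H : Type*} [AddCommGroup C] [Module k C] [Coalgebra k C]
    [AddCommGroup X] [Module k X] [AddCommGroup T] [Module k T] [AddCommGroup H] [Module k H]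
    {j : X →ₗ[k] C} {i : T →ₗ[k] H} {δ : X →ₗ[k] C ⊗[k] X}
    (h : ∀ x, j.lTensor C (δ x) = Coalgebra.comul (R := k) (j x)) (z : X ⊗[k] T) :
    (TensorProduct.map j i).lTensor C (TensorProduct.assoc k C X T (δ.rTensor T z)) =
      TensorProduct.assoc k C C H ((Coalgebra.comul (R := k)).rTensor H
        (TensorProduct.map j i z)) := by
  induction z with
  | zero => simp
  | add z z' hz hz' => simp only [map_add, hz, hz']
  | tmul x y =>
    rw [LinearMap.rTensor_tmul, TensorProduct.map_tmul, LinearMap.rTensor_tmul, ← h]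
    generalize δ x = w
    induction w with
    | zero => simp
    | add z z' hz hz' => simp only [map_add, TensorProduct.add_tmul, hz, hz']
    | tmul x y => rfl

/-- If a linear map `g` intertwines `δX` and `δY`, then `δY` is coassociative and counital on the
image of `g`. -/
theorem IsRightCoaction.image {C X Y : Type*} [AddCommGroup C] [Module k C] [Coalgebra k C]
    [AddCommGroup X] [Module k X] [AddCommGroup Y] [Module k Y] {δX : X →ₗ[k] X ⊗[k] C}
    {δY : Y →ₗ[k] Y ⊗[k] C} (hX : IsRightCoaction C δX) (g : X →ₗ[k] Y)
    (h : ∀ x, δY (g x) = g.rTensor C (δX x)) (x : X) :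
    TensorProduct.assoc k Y C C (δY.rTensor C (δY (g x))) =
      (Coalgebra.comul (R := k)).lTensor Y (δY (g x)) ∧
    (Coalgebra.counit (R := k)).lTensor Y (δY (g x)) = (g x) ⊗ₜ 1 := by
  constructor
  · have h1 : ∀ z : X ⊗[k] C, δY.rTensor C (g.rTensor C z) =
        TensorProduct.map (TensorProduct.map g LinearMap.id) LinearMap.id (δX.rTensor C z) := by
      intro z
      induction z with
      | zero => simp
      | add z z' hz hz' => simp only [map_add, hz, hz']
      | tmul x y =>
        rw [LinearMap.rTensor_tmul, LinearMap.rTensor_tmul, h]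
        rfl
    have h2 : ∀ z : X ⊗[k] C, (Coalgebra.comul (R := k)).lTensor Y (g.rTensor C z) =
        TensorProduct.map g (TensorProduct.map LinearMap.id LinearMap.id)
          ((Coalgebra.comul (R := k)).lTensor X z) := by
      intro z
      induction z with
      | zero => simp
      | add z z' hz hz' => simp only [map_add, hz, hz']
      | tmul x y =>
        rw [TensorProduct.map_id]
        rfl
    rw [h, h1, h2, assoc_map, hX.coassoc]
  · have h1 : ∀ z : X ⊗[k] C, (Coalgebra.counit (R := k)).lTensor Y (g.rTensor C z) =
        g.rTensor k ((Coalgebra.counit (R := k)).lTensor X z) := by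
      intro z
      induction z with
      | zero => simp
      | add z z' hz hz' => simp only [map_add, hz, hz']
      | tmul x y => rfl
    rw [h, h1, hX.counit]
    rfl

/-- The coaction `x ⊗ n ↦ (x₀ ⊗ n) ⊗ x₁`, in bilinear form. -/
noncomputable def slide {X N Z T : Type*} [AddCommGroup X] [Module k X]
    [AddCommGroup N] [Module k N] [AddCommGroup Z] [Module k Z] [AddCommGroup T] [Module k T]
    (β : X →ₗ[k] N →ₗ[k] Z) : X ⊗[k] T →ₗ[k] N →ₗ[k] Z ⊗[k] T :=
  LinearMap.mk₂ k (fun z n => (β.flip n).rTensor T z)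
    (fun _ _ _ => map_add _ _ _) (fun _ _ _ => map_smul _ _ _)
    (fun z n n' => by rw [map_add, LinearMap.rTensor_add, LinearMap.add_apply])
    (fun c z n => by rw [map_smul, LinearMap.rTensor_smul, LinearMap.smul_apply])

theorem slide_apply {X N Z T : Type*} [AddCommGroup X] [Module k X]
    [AddCommGroup N] [Module k N] [AddCommGroup Z] [Module k Z] [AddCommGroup T] [Module k T]
    (β : X →ₗ[k] N →ₗ[k] Z) (z : X ⊗[k] T) (n : N) :
    slide β z n = (β.flip n).rTensor T z := rfl

theorem assoc_slide {C X N Z T : Type*} [AddCommGroup C] [Module k C] [AddCommGroup X]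
    [Module k X] [AddCommGroup N] [Module k N] [AddCommGroup Z] [Module k Z] [AddCommGroup T]
    [Module k T] (μ : C →ₗ[k] C →ₗ[k] C) (β : X →ₗ[k] N →ₗ[k] Z) (w : (C ⊗[k] X) ⊗[k] T)
    (v : C ⊗[k] N) : TensorProduct.assoc k C Z T
      (((TensorProduct.map₂ μ β).flip v).rTensor T w) =
      TensorProduct.map₂ μ (slide β) (TensorProduct.assoc k C X T w) v := by
  induction w with
  | zero => simp
  | add z z' hz hz' => simp only [map_add, LinearMap.add_apply, hz, hz']
  | tmul u t =>
    rw [LinearMap.rTensor_tmul]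
    induction u with
    | zero => simp
    | add z z' hz hz' => simp only [map_add, LinearMap.add_apply, TensorProduct.add_tmul, hz, hz']
    | tmul c x =>
      induction v with
      | zero => simp
      | add z z' hz hz' => simp only [map_add, LinearMap.add_apply, TensorProduct.add_tmul, hz, hz']
      | tmul c' n => rfl

end Helper

section Schneider

variable {k : Type*} [Field k] {A : Type u} [Ring A] [HopfAlgebra k A]
variable (B P : Subalgebra k A) [IsQuantumHomogeneousSpace B] [IsQuantumHomogeneousSpace P]
  [IsPrincipalPair B P]

/-- The inclusion `B → P`. -/
def incl : B →ₐ[k] P := Subalgebra.inclusion (IsPrincipalPair.le (B := B) (P := P))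

theorem coidealComul_incl (b : B) : coidealComul P (incl B P b) =
    (incl B P).toLinearMap.lTensor A (coidealComul B b) := by
  apply lTensor_inj A (f := P.val.toLinearMap) Subtype.val_injective
  have h := LinearMap.congr_fun (LinearMap.lTensor_comp A P.val.toLinearMap
    (incl B P).toLinearMap) (coidealComul B b)
  rw [coidealComul_spec]
  exact (coidealComul_spec B b).symm.trans h

theorem pairVal_inj :
    Function.Injective (TensorProduct.map P.val.toLinearMap (fiberVal B P)) :=
  map_inj Subtype.val_injective (fiberVal_inj B P)

theorem pairCoact_incl (b : B) : pairCoact B P (incl B P b) = (incl B P b) ⊗ₜ 1 := by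
  apply pairVal_inj
  rw [pairCoact_spec]
  exact projCoact_of_mem B b.2

theorem pairCoact_mul (p q : P) : pairCoact B P (p * q) =
    TensorProduct.map₂ (LinearMap.mul k P) (LinearMap.mul k (fiber B P)) (pairCoact B P p)
      (pairCoact B P q) := by
  apply pairVal_inj
  have h := map_map₂ (k := k) (β := LinearMap.mul k P) (β₁ := LinearMap.mul k A)
    (f := P.val.toLinearMap) (g := P.val.toLinearMap) (h := P.val.toLinearMap) (fun _ _ => rfl)
    (β' := LinearMap.mul k (fiber B P)) (β₁' := LinearMap.mul k (QuotHopf B)) (f' := fiberVal B P)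
    (g' := fiberVal B P) (h' := fiberVal B P) (fun _ _ => rfl)
    (pairCoact B P p) (pairCoact B P q)
  rw [h, pairCoact_spec, pairCoact_spec, pairCoact_spec]
  exact projCoact_mul B (p : A) (q : A)

theorem isRightCoaction_pairCoact : IsRightCoaction (fiber B P) (pairCoact B P) :=
  (isRightCoaction_projCoact B).sub (j := P.val.toLinearMap) Subtype.val_injective
    (fiberVal_inj B P) (comul_fiber B P) (counit_fiber B P) (pairCoact_spec B P)

/-- The left `A`-coaction and the right `π_B(P)`-coaction on `P` commute. -/
theorem pair_bicomodule (p : P) : TensorProduct.assoc k A P (fiber B P)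
    ((coidealComul P).rTensor (fiber B P) (pairCoact B P p)) =
      (pairCoact B P).lTensor A (coidealComul P p) := by
  apply lTensor_inj A (pairVal_inj B P)
  have h1 := map_lTensor_assoc (j := P.val.toLinearMap) (i := fiberVal B P)
    (coidealComul_spec P) (pairCoact B P p)
  have h2 : TensorProduct.map P.val.toLinearMap (fiberVal B P) ∘ₗ pairCoact B P =
      projCoact B ∘ₗ P.val.toLinearMap := LinearMap.ext (pairCoact_spec B P)
  have h3 := LinearMap.congr_fun (LinearMap.lTensor_comp A
    (TensorProduct.map P.val.toLinearMap (fiberVal B P)) (pairCoact B P)) (coidealComul P p)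
  have h4 := LinearMap.congr_fun (LinearMap.lTensor_comp A
    (projCoact B) P.val.toLinearMap) (coidealComul P p)
  rw [h2] at h3
  refine Eq.trans ?_ (h4.symm.trans h3)
  rw [LinearMap.comp_apply, coidealComul_spec]
  refine h1.trans ?_
  rw [pairCoact_spec]
  exact (projCoact_comul B (p : A)).symm

section Coinvariants

variable {B P}
variable (M : PairMod B P)

/-- The map `m ↦ Δ_R(m) - m ⊗ 1`. -/
noncomputable def coinvDiff : M.carrier →ₗ[k] M.carrier ⊗[k] fiber B P :=
  M.rcoact - (TensorProduct.mk k M.carrier (fiber B P)).flip 1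

theorem coinvDiff_eq_zero (m : M.carrier) : coinvDiff M m = 0 ↔ M.rcoact m = m ⊗ₜ 1 := sub_eq_zero

/-- The subspace of right `π_B(P)`-coinvariant elements of `M`. -/
noncomputable def coinvSub : Submodule k M.carrier := LinearMap.ker (coinvDiff M)

theorem mem_coinvSub (m : M.carrier) : m ∈ coinvSub M ↔ M.rcoact m = m ⊗ₜ 1 :=
  coinvDiff_eq_zero M m

theorem smul_mem_coinvSub (b : B) {m : M.carrier} (hm : m ∈ coinvSub M) :
    incl B P b • m ∈ coinvSub M := by
  rw [mem_coinvSub] at hm ⊢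
  rw [M.rcoact_smul, pairCoact_incl, hm, TensorProduct.map₂_apply_tmul, TensorProduct.map_tmul]
  simp

/-- The left `B`-module `M^{co(π_B(P))}` of right `π_B(P)`-coinvariant elements of `M`. -/
def Coinv : Type u := coinvSub M

noncomputable instance : AddCommGroup (Coinv M) := inferInstanceAs (AddCommGroup (coinvSub M))

noncomputable instance : Module k (Coinv M) := inferInstanceAs (Module k (coinvSub M))

/-- The inclusion of `M^{co(π_B(P))}` in `M`. -/
noncomputable def coinvVal : Coinv M →ₗ[k] M.carrier := (coinvSub M).subtype

theorem coinvVal_inj : Function.Injective (coinvVal M) := Subtype.val_injective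

noncomputable instance : SMul B (Coinv M) where
  smul b m := ⟨incl B P b • coinvVal M m, smul_mem_coinvSub M b m.2⟩

theorem coinvVal_smul (b : B) (m : Coinv M) :
    coinvVal M (b • m) = incl B P b • coinvVal M m := rfl

noncomputable instance : Module B (Coinv M) where
  one_smul m := coinvVal_inj M (by rw [coinvVal_smul, map_one, one_smul])
  mul_smul b c m := coinvVal_inj M (by
    rw [coinvVal_smul, coinvVal_smul, coinvVal_smul, map_mul, mul_smul])
  smul_zero b := coinvVal_inj M (by rw [coinvVal_smul, map_zero, smul_zero])
  smul_add b m n := coinvVal_inj M (by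
    rw [map_add, coinvVal_smul, coinvVal_smul, coinvVal_smul, map_add, smul_add])
  add_smul b c m := coinvVal_inj M (by
    rw [map_add, coinvVal_smul, coinvVal_smul, coinvVal_smul, map_add, add_smul])
  zero_smul m := coinvVal_inj M (by rw [coinvVal_smul, map_zero, map_zero, zero_smul])

instance : IsScalarTower k B (Coinv M) where
  smul_assoc c b m := coinvVal_inj M (by
    rw [coinvVal_smul, (coinvVal M).map_smul, coinvVal_smul, map_smul, smul_assoc])

theorem coinvVal_exact : Function.Exact (coinvVal M) (coinvDiff M) := by
  intro m
  exact ⟨fun h => ⟨⟨m, h⟩, rfl⟩, fun ⟨y, hy⟩ => hy ▸ y.2⟩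

theorem rcoact_coinvVal (m : Coinv M) : M.rcoact (coinvVal M m) = coinvVal M m ⊗ₜ 1 :=
  (mem_coinvSub M _).1 m.2

theorem coact_coinv_mem (m : Coinv M) : (M.coact ∘ₗ coinvVal M) m ∈
    LinearMap.range ((coinvVal M).lTensor A) := by
  refine mem_range_lTensor A (coinvVal_exact M) ?_
  have h := LinearMap.congr_fun (LinearMap.lTensor_sub (M := A) M.rcoact
    ((TensorProduct.mk k M.carrier (fiber B P)).flip 1)) (M.coact (coinvVal M m))
  refine h.trans (sub_eq_zero.2 ?_)
  rw [← M.bicomodule, rcoact_coinvVal, LinearMap.rTensor_tmul]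
  generalize M.coact (coinvVal M m) = z
  induction z with
  | zero => simp
  | add z z' hz hz' => simp only [map_add, TensorProduct.add_tmul, hz, hz']
  | tmul x y => rfl

/-- The restriction of the left `A`-coaction of `M` to `M^{co(π_B(P))}`. -/
noncomputable def coinvCoact : Coinv M →ₗ[k] A ⊗[k] Coinv M :=
  liftInj ((coinvVal M).lTensor A) (lTensor_inj A (coinvVal_inj M)) (M.coact ∘ₗ coinvVal M)
    (coact_coinv_mem M)

theorem coinvCoact_spec (m : Coinv M) :
    (coinvVal M).lTensor A (coinvCoact M m) = M.coact (coinvVal M m) :=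
  liftInj_spec _ _ _ _ _

theorem coinvCoact_smul (b : B) (m : Coinv M) : coinvCoact M (b • m) =
    TensorProduct.map₂ (LinearMap.mul k A) (act k B (Coinv M)) (coidealComul B b)
      (coinvCoact M m) := by
  apply lTensor_inj A (coinvVal_inj M)
  have h := map_map₂ (k := k) (β := LinearMap.mul k A) (β₁ := LinearMap.mul k A)
    (f := LinearMap.id) (g := LinearMap.id) (h := LinearMap.id) (fun _ _ => rfl)
    (β' := act k B (Coinv M)) (β₁' := act k P M.carrier) (f' := (incl B P).toLinearMap)
    (g' := coinvVal M) (h' := coinvVal M) (fun _ _ => rfl)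
    (coidealComul B b) (coinvCoact M m)
  refine Eq.trans ?_ h.symm
  rw [coinvCoact_spec, coinvVal_smul, M.coact_smul, coidealComul_incl, ← coinvCoact_spec]
  rfl

variable {M}
variable {N : PairMod B P}

/-- The restriction of a morphism to the coinvariant elements. -/
noncomputable def coinvMap (f : PairMod.Hom M N) : Coinv M →ₗ[B] Coinv N where
  toFun m := ⟨f.lin (coinvVal M m), by
    rw [mem_coinvSub, f.rcomm, rcoact_coinvVal, LinearMap.rTensor_tmul]
    rfl⟩
  map_add' m m' := Subtype.ext (f.lin.map_add (coinvVal M m) (coinvVal M m'))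
  map_smul' b m := Subtype.ext (f.lin.map_smul (incl B P b) (coinvVal M m))

theorem coinvVal_coinvMap (f : PairMod.Hom M N) (m : Coinv M) :
    coinvVal N (coinvMap f m) = f.lin (coinvVal M m) := rfl

theorem coinvMap_comm (f : PairMod.Hom M N) (m : Coinv M) :
    coinvCoact N (coinvMap f m) = ((coinvMap f).restrictScalars k).lTensor A (coinvCoact M m) := by
  apply lTensor_inj A (coinvVal_inj N)
  have h : coinvVal N ∘ₗ (coinvMap f).restrictScalars k =
    f.lin.restrictScalars k ∘ₗ coinvVal M := rfl
  have h2 := LinearMap.congr_fun (LinearMap.lTensor_comp A (coinvVal N)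
    ((coinvMap f).restrictScalars k)) (coinvCoact M m)
  have h3 := LinearMap.congr_fun (LinearMap.lTensor_comp A (f.lin.restrictScalars k) (coinvVal M))
    (coinvCoact M m)
  rw [h] at h2
  refine Eq.trans ?_ (h3.symm.trans h2)
  rw [LinearMap.comp_apply, coinvCoact_spec, coinvCoact_spec, coinvVal_coinvMap, f.comm]

end Coinvariants

/-- The functor `^A_P Mod^{π_B(P)} → ^A_B Mod` of right `π_B(P)`-coinvariants. -/
noncomputable def coinvFunctor : PairMod B P ⥤ RelHopfMod B where
  obj M :=
    { carrier := Coinv M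
      coact := coinvCoact M
      isLeftCoaction := M.isLeftCoaction.sub (coinvVal_inj M) (coinvCoact_spec M)
      coact_smul := coinvCoact_smul M }
  map f := { lin := coinvMap f, comm := coinvMap_comm f }
  map_id _ := rfl
  map_comp _ _ := rfl

section Induction

variable {B}
variable (N : RelHopfMod B)

/-- The left `P`-module `P ⊗_B N`. -/
abbrev Ind : Type u := BalTensor (incl B P) N.carrier

/-- The class of `p ⊗ n` in `P ⊗_B N`. -/
abbrev indMk : P →ₗ[k] N.carrier →ₗ[k] Ind P N := balMk (incl B P)

/-- The map `(p, n) ↦ p₋₁ n₋₁ ⊗ (p₀ ⊗ n₀)`. -/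
noncomputable def indCoactAux : P →ₗ[k] N.carrier →ₗ[k] A ⊗[k] Ind P N :=
  (TensorProduct.map₂ (LinearMap.mul k A) (indMk P N)).compl₁₂ (coidealComul P) N.coact

theorem indCoactAux_apply (p : P) (n : N.carrier) : indCoactAux P N p n =
    TensorProduct.map₂ (LinearMap.mul k A) (indMk P N) (coidealComul P p) (N.coact n) := rfl

theorem indCoactAux_balanced (p : P) (b : B) (n : N.carrier) :
    indCoactAux P N (p * incl B P b) n = indCoactAux P N p (b • n) := by
  rw [indCoactAux_apply, indCoactAux_apply, coidealComul_mul, N.coact_smul]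
  have h := map₂_assoc (k := k) (γ₁ := LinearMap.mul k A) (β₁ := LinearMap.mul k A)
    (γ₂ := LinearMap.mul k A) (β₂ := LinearMap.mul k A) (fun x y z => mul_assoc x y z)
    (γ₁' := (LinearMap.mul k P).compl₂ (incl B P).toLinearMap) (β₁' := indMk P N)
    (γ₂' := act k B N.carrier) (β₂' := indMk P N)
    (fun p b n => balMk_mul (incl B P) p b n)
    (coidealComul P p) (coidealComul B b) (N.coact n)
  rw [← h, coidealComul_incl]
  congr 1
  have h2 := map_map₂ (k := k) (β := LinearMap.mul k A) (β₁ := LinearMap.mul k A)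
    (f := LinearMap.id) (g := LinearMap.id) (h := LinearMap.id) (fun _ _ => rfl)
    (β' := (LinearMap.mul k P).compl₂ (incl B P).toLinearMap) (β₁' := LinearMap.mul k P)
    (f' := LinearMap.id) (g' := (incl B P).toLinearMap) (h' := LinearMap.id) (fun _ _ => rfl)
    (coidealComul P p) (coidealComul B b)
  rw [TensorProduct.map_id, LinearMap.id_apply, LinearMap.id_apply] at h2
  exact congrArg _ h2.symm

/-- The tensor product left `A`-coaction `p ⊗ n ↦ p₋₁ n₋₁ ⊗ (p₀ ⊗ n₀)` on `P ⊗_B N`. -/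
noncomputable def indCoact : Ind P N →ₗ[k] A ⊗[k] Ind P N :=
  balLift (incl B P) (indCoactAux P N) (indCoactAux_balanced P N)

theorem indCoact_mk (p : P) (n : N.carrier) : indCoact P N (indMk P N p n) =
    TensorProduct.map₂ (LinearMap.mul k A) (indMk P N) (coidealComul P p) (N.coact n) := rfl

theorem isLeftCoaction_indCoact : IsLeftCoaction A (indCoact P N) where
  coassoc m := by
    refine bal_induction (incl B P) (p := fun m => TensorProduct.assoc k A A _
      ((Coalgebra.comul (R := k)).rTensor _ (indCoact P N m)) =
      (indCoact P N).lTensor A (indCoact P N m)) m ?_ ?_ ?_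
    · simp
    · intro p n
      exact (coassoc_of_bilin (isLeftCoaction_coidealComul P) N.isLeftCoaction (indMk P N)
        (indCoact_mk P N) p n).1
    · intro x y hx hy
      simp only [map_add, hx, hy]
  counit m := by
    refine bal_induction (incl B P) (p := fun m =>
      (Coalgebra.counit (R := k)).rTensor _ (indCoact P N m) = 1 ⊗ₜ m) m ?_ ?_ ?_
    · simp
    · intro p n
      exact (coassoc_of_bilin (isLeftCoaction_coidealComul P) N.isLeftCoaction (indMk P N)
        (indCoact_mk P N) p n).2
    · intro x y hx hy
      simp only [map_add, hx, hy, TensorProduct.tmul_add]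

theorem indCoact_smul (p : P) (m : Ind P N) : indCoact P N (p • m) =
    TensorProduct.map₂ (LinearMap.mul k A) (act k P (Ind P N)) (coidealComul P p)
      (indCoact P N m) := by
  refine bal_induction (incl B P) (p := fun m : Ind P N => indCoact P N (p • m) =
    TensorProduct.map₂ (LinearMap.mul k A) (act k P (Ind P N)) (coidealComul P p)
      (indCoact P N m)) m ?_ ?_ ?_
  · simp
  · intro q n
    refine (indCoact_mk P N (p * q) n).trans ?_
    rw [coidealComul_mul]
    refine Eq.trans ?_ (congrArg _ (indCoact_mk P N q n).symm)
    exact map₂_assoc (fun x y z => mul_assoc x y z) (fun x y z => rfl) _ _ _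
  · intro x y hx hy
    simp only [smul_add, map_add, hx, hy]

/-- The map `(p, n) ↦ (p₀ ⊗ n) ⊗ p₁`. -/
noncomputable def indRcoactAux : P →ₗ[k] N.carrier →ₗ[k] Ind P N ⊗[k] fiber B P :=
  slide (indMk P N) ∘ₗ pairCoact B P

theorem indRcoactAux_apply (p : P) (n : N.carrier) : indRcoactAux P N p n =
    ((indMk P N).flip n).rTensor (fiber B P) (pairCoact B P p) := rfl

theorem indRcoactAux_balanced (p : P) (b : B) (n : N.carrier) :
    indRcoactAux P N (p * incl B P b) n = indRcoactAux P N p (b • n) := by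
  rw [indRcoactAux_apply, indRcoactAux_apply, pairCoact_mul, pairCoact_incl]
  generalize pairCoact B P p = z
  induction z with
  | zero => simp
  | add z z' hz hz' => simp only [map_add, LinearMap.add_apply, hz, hz']
  | tmul x y =>
    rw [TensorProduct.map₂_apply_tmul, TensorProduct.map_tmul, LinearMap.rTensor_tmul,
      LinearMap.rTensor_tmul, LinearMap.mul_apply', LinearMap.mul_apply', mul_one]
    congr 1
    exact balMk_mul (incl B P) x b n

/-- The right `π_B(P)`-coaction `p ⊗ n ↦ (p₀ ⊗ n) ⊗ p₁` on `P ⊗_B N`. -/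
noncomputable def indRcoact : Ind P N →ₗ[k] Ind P N ⊗[k] fiber B P :=
  balLift (incl B P) (indRcoactAux P N) (indRcoactAux_balanced P N)

theorem indRcoact_mk (p : P) (n : N.carrier) : indRcoact P N (indMk P N p n) =
    ((indMk P N).flip n).rTensor (fiber B P) (pairCoact B P p) := rfl

theorem isRightCoaction_indRcoact : IsRightCoaction (fiber B P) (indRcoact P N) where
  coassoc m := by
    refine bal_induction (incl B P) (p := fun m => TensorProduct.assoc k _ _ _
      ((indRcoact P N).rTensor _ (indRcoact P N m)) =
      (Coalgebra.comul (R := k)).lTensor _ (indRcoact P N m)) m ?_ ?_ ?_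
    · simp
    · intro p n
      exact ((isRightCoaction_pairCoact B P).image ((indMk P N).flip n)
        (fun p => indRcoact_mk P N p n) p).1
    · intro x y hx hy
      simp only [map_add, hx, hy]
  counit m := by
    refine bal_induction (incl B P) (p := fun m =>
      (Coalgebra.counit (R := k)).lTensor _ (indRcoact P N m) = m ⊗ₜ 1) m ?_ ?_ ?_
    · simp
    · intro p n
      exact ((isRightCoaction_pairCoact B P).image ((indMk P N).flip n)
        (fun p => indRcoact_mk P N p n) p).2
    · intro x y hx hy
      simp only [map_add, hx, hy, TensorProduct.add_tmul]

theorem indRcoact_smul (p : P) (m : Ind P N) : indRcoact P N (p • m) =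
    TensorProduct.map₂ (act k P (Ind P N)) (LinearMap.mul k (fiber B P)) (pairCoact B P p)
      (indRcoact P N m) := by
  refine bal_induction (incl B P) (p := fun m : Ind P N => indRcoact P N (p • m) =
    TensorProduct.map₂ (act k P (Ind P N)) (LinearMap.mul k (fiber B P)) (pairCoact B P p)
      (indRcoact P N m)) m ?_ ?_ ?_
  · simp
  · intro q n
    refine (indRcoact_mk P N (p * q) n).trans ?_
    rw [pairCoact_mul]
    refine Eq.trans ?_ (congrArg _ (indRcoact_mk P N q n).symm)
    have h := map_map₂ (k := k) (β := LinearMap.mul k P) (β₁ := act k P (Ind P N))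
      (f := LinearMap.id) (g := (indMk P N).flip n) (h := (indMk P N).flip n) (fun _ _ => rfl)
      (β' := LinearMap.mul k (fiber B P)) (β₁' := LinearMap.mul k (fiber B P))
      (f' := LinearMap.id) (g' := LinearMap.id) (h' := LinearMap.id) (fun _ _ => rfl)
      (pairCoact B P p) (pairCoact B P q)
    rw [TensorProduct.map_id, LinearMap.id_apply] at h
    exact h
  · intro x y hx hy
    simp only [smul_add, map_add, hx, hy]

theorem ind_bicomodule (m : Ind P N) : TensorProduct.assoc k A (Ind P N) (fiber B P)
    ((indCoact P N).rTensor (fiber B P) (indRcoact P N m)) =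
      (indRcoact P N).lTensor A (indCoact P N m) := by
  refine bal_induction (incl B P) (p := fun m => TensorProduct.assoc k A (Ind P N) (fiber B P)
    ((indCoact P N).rTensor (fiber B P) (indRcoact P N m)) =
      (indRcoact P N).lTensor A (indCoact P N m)) m ?_ ?_ ?_
  · simp
  · intro p n
    have e1 : indCoact P N ∘ₗ (indMk P N).flip n =
        ((TensorProduct.map₂ (LinearMap.mul k A) (indMk P N)).flip (N.coact n)) ∘ₗ
          coidealComul P := rfl
    have h1 := LinearMap.congr_fun (LinearMap.rTensor_comp (fiber B P) (indCoact P N)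
      ((indMk P N).flip n)) (pairCoact B P p)
    have h2 := LinearMap.congr_fun (LinearMap.rTensor_comp (fiber B P)
      ((TensorProduct.map₂ (LinearMap.mul k A) (indMk P N)).flip (N.coact n))
      (coidealComul P)) (pairCoact B P p)
    rw [e1] at h1
    have h3 := assoc_slide (LinearMap.mul k A) (indMk P N)
      ((coidealComul P).rTensor (fiber B P) (pairCoact B P p)) (N.coact n)
    have h4 := map_map₂ (k := k) (β := LinearMap.mul k A) (β₁ := LinearMap.mul k A)
      (f := LinearMap.id) (g := LinearMap.id) (h := LinearMap.id) (fun _ _ => rfl)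
      (β' := indMk P N) (β₁' := slide (indMk P N)) (f' := pairCoact B P)
      (g' := LinearMap.id) (h' := indRcoact P N) (fun p n => indRcoact_mk P N p n)
      (coidealComul P p) (N.coact n)
    rw [TensorProduct.map_id, LinearMap.id_apply] at h4
    refine (congrArg _ (h1.symm.trans h2)).trans (h3.trans ?_)
    rw [pair_bicomodule]
    exact h4.symm
  · intro x y hx hy
    simp only [map_add, hx, hy]

variable {N}
variable {L : RelHopfMod B}

theorem indMap_comm (f : RelHopfMod.Hom N L) (m : Ind P N) :
    indCoact P L (balMap (incl B P) f.lin m) =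
      ((balMap (incl B P) f.lin).restrictScalars k).lTensor A (indCoact P N m) := by
  refine bal_induction (incl B P) (p := fun m : Ind P N => indCoact P L (balMap (incl B P) f.lin m) =
      ((balMap (incl B P) f.lin).restrictScalars k).lTensor A (indCoact P N m)) m ?_ ?_ ?_
  · simp
  · intro p n
    have h := map_map₂ (k := k) (β := LinearMap.mul k A) (β₁ := LinearMap.mul k A)
      (f := LinearMap.id) (g := LinearMap.id) (h := LinearMap.id) (fun _ _ => rfl)
      (β' := indMk P N) (β₁' := indMk P L) (f' := LinearMap.id) (g' := f.lin.restrictScalars k)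
      (h' := (balMap (incl B P) f.lin).restrictScalars k) (fun _ _ => rfl)
      (coidealComul P p) (N.coact n)
    rw [TensorProduct.map_id, LinearMap.id_apply] at h
    refine Eq.trans ?_ h.symm
    refine (indCoact_mk P L p (f.lin n)).trans ?_
    rw [f.comm]
    rfl
  · intro x y hx hy
    simp only [map_add, hx, hy]

theorem indMap_rcomm (f : RelHopfMod.Hom N L) (m : Ind P N) :
    indRcoact P L (balMap (incl B P) f.lin m) =
      ((balMap (incl B P) f.lin).restrictScalars k).rTensor (fiber B P) (indRcoact P N m) := by
  refine bal_induction (incl B P) (p := fun m : Ind P N => indRcoact P L (balMap (incl B P) f.lin m) =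
      ((balMap (incl B P) f.lin).restrictScalars k).rTensor (fiber B P) (indRcoact P N m))
      m ?_ ?_ ?_
  · simp
  · intro p n
    exact LinearMap.congr_fun (LinearMap.rTensor_comp (fiber B P)
      ((balMap (incl B P) f.lin).restrictScalars k) ((indMk P N).flip n)) (pairCoact B P p)
  · intro x y hx hy
    simp only [map_add, hx, hy]

end Induction

/-- The functor `P ⊗_B - : ^A_B Mod → ^A_P Mod^{π_B(P)}`. -/
noncomputable def indFunctor : RelHopfMod B ⥤ PairMod B P where
  obj N :=
    { carrier := Ind P N
      coact := indCoact P N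
      isLeftCoaction := isLeftCoaction_indCoact P N
      coact_smul := indCoact_smul P N
      rcoact := indRcoact P N
      isRightCoaction := isRightCoaction_indRcoact P N
      rcoact_smul := indRcoact_smul P N
      bicomodule := ind_bicomodule P N }
  map f :=
    { lin := balMap (incl B P) (RelHopfMod.Hom.lin f)
      comm := indMap_comm P f
      rcomm := indMap_rcomm P f }
  map_id N := by
    refine PairMod.Hom.ext (LinearMap.ext fun m => ?_)
    refine bal_induction (incl B P) (p := fun m =>
      balMap (incl B P) (RelHopfMod.Hom.lin (𝟙 N)) m = m) m rfl (fun _ _ => rfl) ?_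
    intro x y hx hy
    rw [map_add, hx, hy]
  map_comp {N L K} f g := by
    refine PairMod.Hom.ext (LinearMap.ext fun m => ?_)
    refine bal_induction (incl B P) (p := fun m =>
      balMap (incl B P) (RelHopfMod.Hom.lin (f ≫ g)) m =
        balMap (incl B P) (RelHopfMod.Hom.lin g) (balMap (incl B P) (RelHopfMod.Hom.lin f) m))
      m rfl (fun _ _ => rfl) ?_
    intro x y hx hy
    rw [map_add, map_add, map_add, hx, hy]

end Schneider

end HopfPair

open HopfPair

/-! For a quantum homogeneous space Q put Φ_Q(N) = N/Q⁺N. Morphisms are tested after applying Φ_B or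
Φ_P, and these functors are exact and reflect bijectivity. Both properties come from faithful
flatness. The map [n] ↦ S(n₋₁) ⊗ n₀ embeds Φ_Q(N) naturally in A ⊗_Q N, with natural retraction a ⊗
n ↦ ε(a)[n], so Φ_Q inherits exactness from A ⊗_Q - (`phiMap_exact`, `phiMap_injective`).
Conversely, a ⊗ n ↦ a n₋₁ ⊗ [n₀] embeds A ⊗_Q N naturally in A ⊗ Φ_Q(N), and the copy of Φ_Q(N)
generates A ⊗_Q N over A. So a morphism that becomes bijective under Φ_Q is bijective after A ⊗_Q -,
hence bijective (`bijective_of_phiMap`).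

Takeuchi's equivalence follows. The cotensor product A □ V is the kernel of a morphism A ⊗ V → A ⊗
(π_B(A) ⊗ V) of relative Hopf modules. Exactness turns it into π_B(A) □ V, which is V
(`phiPsi_bijective`). The map N → A □ Φ_B(N) then becomes bijective under Φ_B, so it is bijective
(`psiPhi_bijective`).

Now let H = π_B(P), let M be an object of the category of P-modules with both coactions, and let W =
M/B⁺M. Since Φ_P(P ⊗_B N) is Φ_B(N) (`fiberInd_bijective`), applying Φ_P to the counit P ⊗_B M^{co
H} → M gives the natural map Φ_B(M^{co H}) → M/P⁺M. Three facts make this map bijective. The space W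
is a Hopf module over H, where the action is well defined because P ∩ B⁺A = B⁺P. Exactness of Φ_B
identifies Φ_B(M^{co H}) with W^{co H}. Finally M/P⁺M is W/H⁺W, and the fundamental theorem of Hopf
modules gives W^{co H} ≅ W/H⁺W, the inverse being induced by w ↦ S⁻¹(w₁) w₀. The map is assembled in
`fiberQuot_phiMap_coinvHom_bijective`.

The inverse antipode appears because H acts on the left and coacts on the right, so S⁻¹ has to
preserve H. Exactness of Φ_B, applied to P as a kernel, shows that H contains all right
π_P(A)-coinvariants of π_B(A) (`mem_fiber_of_coinv`). Elements of H are left π_P(A)-coinvariant, and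
S⁻¹ exchanges left and right coinvariants (`antipodeInv_mem_fiber`).

The unit needs no further computation. By the triangle identity P ⊗_B - makes the unit bijective,
Φ_P of that map is Φ_B of the unit, and Φ_B reflects bijectivity (`pairUnit_bijective`). The second
equivalence is the composite with Takeuchi's. -/

namespace HopfPair

/-! ### The antipode and its inverse: anti-comultiplicativity and cancellation identities. -/

section Antipode

open HopfAlgebra

variable {k : Type*} [Field k] {C : Type*} [Ring C] [HopfAlgebra k C]

/-- The map `c ↦ S(c₂) ⊗ S(c₁)`. -/
noncomputable def antipodeSwap (k C : Type*) [Field k] [Ring C] [HopfAlgebra k C] :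
    C →ₗ[k] C ⊗[k] C :=
  (TensorProduct.comm k C C).toLinearMap ∘ₗ
    TensorProduct.map (antipode k) (antipode k) ∘ₗ Coalgebra.comul

/-- The inner cancellation in the convolution product of `antipodeSwap` with Δ: by coassociativity
the left tensor factors form S(c₁) c₂, which collapses to the counit, while the factor S(a) is
carried along. -/
theorem tmul_antipode_mul_comul (c : C) (z : C ⊗[k] C) (hz : z = Coalgebra.comul c) (a : C) :
    LinearMap.mul' k (C ⊗[k] C) (TensorProduct.map
      ((TensorProduct.mk k C C).flip (antipode k a) ∘ₗ antipode k) Coalgebra.comul z) =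
      1 ⊗ₜ (antipode k a * c) := by
  have h : ∀ z : C ⊗[k] C, LinearMap.mul' k (C ⊗[k] C) (TensorProduct.map
      ((TensorProduct.mk k C C).flip (antipode k a) ∘ₗ antipode k) Coalgebra.comul z) =
      TensorProduct.map (LinearMap.mul' k C ∘ₗ (antipode k).rTensor C)
        (LinearMap.mulLeft k (antipode k a))
        ((TensorProduct.assoc k C C C).symm (Coalgebra.comul.lTensor C z)) := by
    intro z
    induction z with
    | zero => simp
    | add z z' hz hz' => simp only [map_add, hz, hz']
    | tmul x y =>
      rw [TensorProduct.map_tmul, LinearMap.lTensor_tmul]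
      generalize Coalgebra.comul (R := k) y = w
      induction w with
      | zero => simp
      | add z z' hz hz' => simp only [map_add, TensorProduct.tmul_add, hz, hz']
      | tmul y y' => simp
  rw [h, hz, ← Coalgebra.coassoc_apply, LinearEquiv.symm_apply_apply]
  have h2 : ∀ z : C ⊗[k] C, TensorProduct.map (LinearMap.mul' k C ∘ₗ (antipode k).rTensor C)
        (LinearMap.mulLeft k (antipode k a)) (Coalgebra.comul.rTensor C z) =
      1 ⊗ₜ (antipode k a * TensorProduct.lid k C (Coalgebra.counit.rTensor C z)) := by
    intro z
    induction z with
    | zero => simp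
    | add z z' hz hz' => simp only [map_add, mul_add, TensorProduct.tmul_add, hz, hz']
    | tmul x y =>
      simp [mul_antipode_rTensor_comul_apply, Algebra.algebraMap_eq_smul_one,
        TensorProduct.smul_tmul]
  rw [h2, Coalgebra.rTensor_counit_comul]
  simp

/-- The product is (S(c₂) ⊗ S(c₁)) Δ(c₃). Coassociativity allows c₁ to be split off first. The sum
over the remaining legs is then `tmul_antipode_mul_comul` with a = c₁, which leaves 1 ⊗ S(c₁) c₂. -/
theorem antipodeSwap_convMul_comul (c : C) : LinearMap.mul' k (C ⊗[k] C)
    (TensorProduct.map (antipodeSwap k C) Coalgebra.comul (Coalgebra.comul (R := k) c)) =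
      algebraMap k _ (Coalgebra.counit (R := k) c) := by
  let F : C →ₗ[k] C ⊗[k] C →ₗ[k] C ⊗[k] C :=
    LinearMap.mk₂ k (fun a z => LinearMap.mul' k (C ⊗[k] C) (TensorProduct.map
      ((TensorProduct.mk k C C).flip (antipode k a) ∘ₗ antipode k) Coalgebra.comul z))
      (fun a a' z => by
        simp only [map_add, LinearMap.add_comp, TensorProduct.map_add_left, LinearMap.add_apply])
      (fun r a z => by
        simp only [map_smul, LinearMap.smul_comp, TensorProduct.map_smul_left,
          LinearMap.smul_apply])
      (fun a z z' => by simp only [map_add])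
      (fun r a z => by simp only [map_smul])
  have h : ∀ z : C ⊗[k] C, LinearMap.mul' k (C ⊗[k] C)
      (TensorProduct.map (antipodeSwap k C) Coalgebra.comul z) =
      TensorProduct.lift F
        (TensorProduct.assoc k C C C (Coalgebra.comul.rTensor C z)) := by
    intro z
    induction z with
    | zero => simp
    | add z z' hz hz' => simp only [map_add, hz, hz']
    | tmul x y =>
      rw [TensorProduct.map_tmul, LinearMap.rTensor_tmul, antipodeSwap, LinearMap.comp_apply,
        LinearMap.comp_apply]
      generalize Coalgebra.comul (R := k) x = w
      induction w with
      | zero => simp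
      | add z z' hz hz' => simp only [map_add, TensorProduct.add_tmul, hz, hz']
      | tmul x x' => simp [F]
  rw [h, Coalgebra.coassoc_apply]
  have h2 : ∀ z : C ⊗[k] C, TensorProduct.lift F (Coalgebra.comul.lTensor C z) =
      (1 : C) ⊗ₜ LinearMap.mul' k C ((antipode k).rTensor C z) := by
    intro z
    induction z with
    | zero => simp
    | add z z' hz hz' => simp only [map_add, TensorProduct.tmul_add, hz, hz']
    | tmul x y =>
      rw [LinearMap.lTensor_tmul, LinearMap.rTensor_tmul, LinearMap.mul'_apply,
        TensorProduct.lift.tmul, LinearMap.mk₂_apply, tmul_antipode_mul_comul y _ rfl x]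
  rw [h2, mul_antipode_rTensor_comul_apply, Algebra.algebraMap_eq_smul_one,
    Algebra.algebraMap_eq_smul_one, TensorProduct.tmul_smul, Algebra.TensorProduct.one_def]

/-- The antipode is anti-comultiplicative. -/
theorem comul_antipode (c : C) : Coalgebra.comul (R := k) (antipode k c) =
    TensorProduct.comm k C C (TensorProduct.map (antipode k) (antipode k)
      (Coalgebra.comul (R := k) c)) := by
  -- In the convolution algebra Hom(C, C ⊗ C) the swapped map is a left inverse of Δ and Δ ∘ S is a
  -- right inverse of Δ, so the two coincide.
  have h1 : WithConv.toConv (antipodeSwap k C) *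
      WithConv.toConv (Coalgebra.comul (R := k) (A := C)) = 1 := by
    apply WithConv.ofConv_injective
    exact LinearMap.ext fun c => antipodeSwap_convMul_comul c
  have h := left_inv_eq_right_inv h1 LinearMap.comul_right_inv
  exact (LinearMap.congr_fun (congrArg WithConv.ofConv h) c).symm

variable (hS : Function.Bijective (antipode k : C → C))

/-- The inverse of a bijective antipode. -/
noncomputable def antipodeInv : C →ₗ[k] C :=
  (LinearEquiv.ofBijective (antipode k : C →ₗ[k] C) hS).symm.toLinearMap

theorem antipode_antipodeInv (c : C) : antipode k (antipodeInv hS c) = c :=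
  (LinearEquiv.ofBijective (antipode k : C →ₗ[k] C) hS).apply_symm_apply c

theorem antipodeInv_antipode (c : C) : antipodeInv hS (antipode k c) = c :=
  (LinearEquiv.ofBijective (antipode k : C →ₗ[k] C) hS).symm_apply_apply c

theorem antipodeInv_mul (c d : C) :
    antipodeInv hS (c * d) = antipodeInv hS d * antipodeInv hS c := by
  apply hS.1
  rw [antipode_mul_antidistrib]
  simp only [antipode_antipodeInv]

theorem antipodeInv_one : antipodeInv hS (1 : C) = 1 := by
  apply hS.1
  rw [antipode_antipodeInv, antipode_one]

theorem counit_antipodeInv (c : C) :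
    Coalgebra.counit (R := k) (antipodeInv hS c) = Coalgebra.counit (R := k) c := by
  rw [← counit_antipode, antipode_antipodeInv]

theorem comul_antipodeInv (c : C) : Coalgebra.comul (R := k) (antipodeInv hS c) =
    TensorProduct.comm k C C (TensorProduct.map (antipodeInv hS) (antipodeInv hS)
      (Coalgebra.comul (R := k) c)) := by
  obtain ⟨d, rfl⟩ := hS.2 c
  rw [antipodeInv_antipode, comul_antipode]
  generalize Coalgebra.comul (R := k) d = z
  induction z with
  | zero => simp
  | add z z' hz hz' =>
    simp only [map_add]
    rw [← hz, ← hz']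
  | tmul x y => simp [antipodeInv_antipode]

/-- The map `x ⊗ y ↦ T(y) x`. -/
noncomputable def swapMul {C : Type*} [Ring C] [Algebra k C] (T : C →ₗ[k] C) :
    C ⊗[k] C →ₗ[k] C :=
  LinearMap.mul' k C ∘ₗ T.rTensor C ∘ₗ (TensorProduct.comm k C C).toLinearMap

@[simp]
theorem swapMul_tmul {C : Type*} [Ring C] [Algebra k C] (T : C →ₗ[k] C) (x y : C) :
    swapMul T (x ⊗ₜ y) = T y * x := rfl

/-- Applying the antipode turns S⁻¹(c₂) c₁ into S(c₁) c₂. This form of the antipode identity is the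
one that fits a left action with a right coaction. -/
theorem swapMul_antipodeInv_comul (c : C) :
    swapMul (antipodeInv hS) (Coalgebra.comul (R := k) c) =
      algebraMap k C (Coalgebra.counit (R := k) c) := by
  apply hS.1
  have h : ∀ z : C ⊗[k] C, antipode k (swapMul (antipodeInv hS) z) =
      LinearMap.mul' k C ((antipode k).rTensor C z) := by
    intro z
    induction z with
    | zero => simp
    | add z z' hz hz' => simp only [map_add, hz, hz']
    | tmul x y => simp [antipode_mul_antidistrib, antipode_antipodeInv]
  rw [h, mul_antipode_rTensor_comul_apply, Algebra.algebraMap_eq_smul_one, map_smul, antipode_one]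

/-- Applying the antipode turns c₂ S⁻¹(c₁) into c₁ S(c₂). -/
theorem mul_antipodeInv_comul (c : C) :
    LinearMap.mul' k C (TensorProduct.comm k C C ((antipodeInv hS).rTensor C
      (Coalgebra.comul (R := k) c))) = algebraMap k C (Coalgebra.counit (R := k) c) := by
  apply hS.1
  have h : ∀ z : C ⊗[k] C, antipode k (LinearMap.mul' k C (TensorProduct.comm k C C
      ((antipodeInv hS).rTensor C z))) = LinearMap.mul' k C ((antipode k).lTensor C z) := by
    intro z
    induction z with
    | zero => simp
    | add z z' hz hz' => simp only [map_add, hz, hz']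
    | tmul x y => simp [antipode_mul_antidistrib, antipode_antipodeInv]
  rw [h, mul_antipode_lTensor_comul_apply, Algebra.algebraMap_eq_smul_one, map_smul, antipode_one]

end Antipode

/-! ### Hopf modules with left action and right coaction: the projection onto coinvariants. -/

section HopfModule

variable {k : Type*} [Field k] {H W : Type*} [Ring H] [Algebra k H] [Coalgebra k H]
  [AddCommGroup W] [Module k W] (α : H →ₗ[k] W →ₗ[k] W) (T : H →ₗ[k] H)

/-- The map `w ⊗ h ↦ T(h) w`. -/
noncomputable def twistEval : W ⊗[k] H →ₗ[k] W := TensorProduct.lift (α ∘ₗ T).flip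

theorem twistEval_tmul (w : W) (h : H) : twistEval α T (w ⊗ₜ h) = α (T h) w := rfl

variable {α T} {ρ : W →ₗ[k] W ⊗[k] H}

theorem twistEval_of_coinv (h1 : ∀ w, α 1 w = w) (hT1 : T 1 = 1) {w : W} (hw : ρ w = w ⊗ₜ 1) :
    twistEval α T (ρ w) = w := by
  rw [hw, twistEval_tmul, hT1, h1]

/-- With E(w) = T(w₁) w₀, one has E(hw) = T(h₂ w₁) h₁ w₀ = T(w₁) T(h₂) h₁ w₀, and T(h₂) h₁ collapses
to ε(h). Thus E kills H⁺W. Only the needed properties of an inverse antipode are assumed of `T`; the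
lemma is applied to `fiberInv`. -/
theorem twistEval_smul (h1 : ∀ w, α 1 w = w) (hα : ∀ g h w, α (g * h) w = α g (α h w))
    (hT : ∀ g h, T (g * h) = T h * T g)
    (hTl : ∀ h, swapMul T (Coalgebra.comul (R := k) h) =
      algebraMap k H (Coalgebra.counit (R := k) h))
    (hρ : ∀ h w, ρ (α h w) = TensorProduct.map₂ α (LinearMap.mul k H) (Coalgebra.comul h) (ρ w))
    (h : H) (w : W) :
    twistEval α T (ρ (α h w)) = Coalgebra.counit (R := k) h • twistEval α T (ρ w) := by
  have key : ∀ (z : H ⊗[k] H) (w : W) (g : H),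
      twistEval α T (TensorProduct.map₂ α (LinearMap.mul k H) z (w ⊗ₜ g)) =
        α (T g) (α (swapMul T z) w) := by
    intro z w g
    induction z with
    | zero => simp
    | add z z' hz hz' => simp only [map_add, LinearMap.add_apply, hz, hz']
    | tmul x y =>
      rw [TensorProduct.map₂_apply_tmul, TensorProduct.map_tmul, twistEval_tmul,
        LinearMap.mul_apply', hT, swapMul_tmul, hα, hα]
  rw [hρ]
  generalize ρ w = y
  induction y with
  | zero => simp
  | add z z' hz hz' => simp only [map_add, smul_add, hz, hz']
  | tmul w g =>
    rw [key, hTl, Algebra.algebraMap_eq_smul_one, map_smul, LinearMap.smul_apply, h1, map_smul,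
      twistEval_tmul]

/-- A map q on which H acts through ε sends T(w₁) w₀ to ε(w₁) q(w₀). Hence the projection does not
change classes in W/H⁺W. -/
theorem map_twistEval {V : Type*} [AddCommGroup V] [Module k V] (q : W →ₗ[k] V)
    (hq : ∀ h w, q (α h w) = Coalgebra.counit (R := k) h • q w)
    (hTε : ∀ h, Coalgebra.counit (R := k) (T h) = Coalgebra.counit (R := k) h)
    (hW : IsRightCoaction H ρ) (w : W) : q (twistEval α T (ρ w)) = q w := by
  have key : ∀ z : W ⊗[k] H, q (twistEval α T z) =
      q (TensorProduct.rid k W ((Coalgebra.counit (R := k)).lTensor W z)) := by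
    intro z
    induction z with
    | zero => simp
    | add z z' hz hz' => simp only [map_add, hz, hz']
    | tmul w h => simp [twistEval_tmul, hq, hTε]
  rw [key, hW.counit]
  simp

/-- The elements `T(w₁) w₀` are coinvariant. -/
theorem twistEval_coinv
    (hTΔ : ∀ h, Coalgebra.comul (R := k) (T h) =
      TensorProduct.comm k H H (TensorProduct.map T T (Coalgebra.comul (R := k) h)))
    (hTl : ∀ h, swapMul T (Coalgebra.comul (R := k) h) =
      algebraMap k H (Coalgebra.counit (R := k) h))
    (hρ : ∀ h w, ρ (α h w) = TensorProduct.map₂ α (LinearMap.mul k H) (Coalgebra.comul h) (ρ w))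
    (hW : IsRightCoaction H ρ) (w : W) :
    ρ (twistEval α T (ρ w)) = twistEval α T (ρ w) ⊗ₜ 1 := by
  -- G records the value of ρ(T(x) w): since T is anti-comultiplicative, the legs of Δ(x) act in
  -- exchanged order.
  let G : W ⊗[k] H →ₗ[k] H ⊗[k] H →ₗ[k] W ⊗[k] H :=
    ((TensorProduct.map₂ α (LinearMap.mul k H)) ∘ₗ (TensorProduct.comm k H H).toLinearMap ∘ₗ
      TensorProduct.map T T).flip
  have hG : ∀ (w : W) (g h h' : H), G (w ⊗ₜ g) (h ⊗ₜ h') = α (T h') w ⊗ₜ (T h * g) :=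
    fun _ _ _ _ => rfl
  have e1 : ∀ z : W ⊗[k] H, ρ (twistEval α T z) =
      TensorProduct.lift (G ∘ₗ ρ) ((Coalgebra.comul (R := k)).lTensor W z) := by
    intro z
    induction z with
    | zero => simp
    | add z z' hz hz' => simp only [map_add, hz, hz']
    | tmul w h =>
      rw [twistEval_tmul, hρ, hTΔ]
      rfl
  have e2 : ∀ (u : W ⊗[k] H) (h : H), TensorProduct.lift (G ∘ₗ ρ)
      (TensorProduct.assoc k W H H (u ⊗ₜ h)) =
      TensorProduct.lift (G.compl₂ ((TensorProduct.mk k H H).flip h)) (ρ.rTensor H u) := by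
    intro u h
    induction u with
    | zero => simp
    | add z z' hz hz' => simp only [map_add, TensorProduct.add_tmul, hz, hz']
    | tmul w g => rfl
  have e3 : ∀ (y : W ⊗[k] H) (h : H),
      TensorProduct.lift (G.compl₂ ((TensorProduct.mk k H H).flip h))
        ((TensorProduct.assoc k W H H).symm ((Coalgebra.comul (R := k)).lTensor W y)) =
      α (T h) (TensorProduct.rid k W ((Coalgebra.counit (R := k)).lTensor W y)) ⊗ₜ 1 := by
    intro y h
    induction y with
    | zero => simp
    | add z z' hz hz' => simp only [map_add, TensorProduct.add_tmul, hz, hz']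
    | tmul w g =>
      have e4 : ∀ v : H ⊗[k] H, TensorProduct.lift (G.compl₂ ((TensorProduct.mk k H H).flip h))
          ((TensorProduct.assoc k W H H).symm (w ⊗ₜ v)) = α (T h) w ⊗ₜ swapMul T v := by
        intro v
        induction v with
        | zero => simp
        | add z z' hz hz' => simp only [map_add, TensorProduct.tmul_add, hz, hz']
        | tmul g g' => rfl
      rw [LinearMap.lTensor_tmul, e4, hTl, LinearMap.lTensor_tmul, TensorProduct.rid_tmul,
        map_smul, Algebra.algebraMap_eq_smul_one, TensorProduct.tmul_smul,
        TensorProduct.smul_tmul']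
  have e5 : ∀ z : W ⊗[k] H, TensorProduct.lift (G ∘ₗ ρ)
      (TensorProduct.assoc k W H H (ρ.rTensor H z)) = twistEval α T z ⊗ₜ 1 := by
    intro z
    induction z with
    | zero => simp
    | add z z' hz hz' => simp only [map_add, TensorProduct.add_tmul, hz, hz']
    | tmul w h =>
      have e6 := congrArg (TensorProduct.assoc k W H H).symm (hW.coassoc w)
      rw [LinearEquiv.symm_apply_apply] at e6
      rw [LinearMap.rTensor_tmul, e2, e6, e3, hW.counit, TensorProduct.rid_tmul, one_smul,
        twistEval_tmul]
  -- Altogether ρ(T(w₁) w₀) = T(w₃) w₀ ⊗ T(w₂) w₁. Coassociativity brings the middle legs into the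
  -- form T(h₂) h₁ = ε(h), which leaves T(w₁) w₀ ⊗ 1.
  rw [e1, ← hW.coassoc, e5]

end HopfModule

/-! ### Exactness of N ↦ N/B⁺N and reflection of bijectivity. -/

section Exactness

variable {k : Type*} [Field k] {A : Type u} [Ring A] [HopfAlgebra k A]
  (B : Subalgebra k A) [IsQuantumHomogeneousSpace B]

section Descent

variable (N : RelHopfMod B)

/-- The map `A ⊗ N → A ⊗_B N` sending `a ⊗ n` to `S(a) ⊗ n`. -/
noncomputable def antipodeMk : A ⊗[k] N.carrier →ₗ[k] BalTensor B.val N.carrier :=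
  TensorProduct.lift (balMk B.val ∘ₗ HopfAlgebra.antipode k)

theorem antipodeMk_tmul (a : A) (n : N.carrier) :
    antipodeMk B N (a ⊗ₜ n) = balMk B.val (HopfAlgebra.antipode k a) n := rfl

/-- S reverses products and the tensor product is balanced over B, so S(xy) ⊗ cn = S(y) (S(x) c) ⊗
n. For x ⊗ c = Δ(b) the bracket becomes ε(b). -/
theorem antipodeMk_map₂ (w : A ⊗[k] B) (z : A ⊗[k] N.carrier) :
    antipodeMk B N (TensorProduct.map₂ (LinearMap.mul k A) (act k B N.carrier) w z) =
      TensorProduct.lift (balMk B.val ∘ₗ (LinearMap.mul k A).flip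
        (LinearMap.mul' k A ((HopfAlgebra.antipode k).rTensor A
          (B.val.toLinearMap.lTensor A w))) ∘ₗ HopfAlgebra.antipode k) z := by
  induction z with
  | zero => simp
  | add z z' hz hz' => simp only [map_add, hz, hz']
  | tmul y n =>
    induction w with
    | zero => simp
    | add w w' hw hw' =>
      simp only [TensorProduct.lift.tmul, LinearMap.comp_apply, LinearMap.flip_apply,
        LinearMap.mul_apply', map_add, LinearMap.add_apply] at hw hw' ⊢
      rw [hw, hw']
    | tmul x c =>
      rw [TensorProduct.map₂_apply_tmul, TensorProduct.map_tmul, antipodeMk_tmul,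
        LinearMap.mul_apply', act_apply, HopfAlgebra.antipode_mul_antidistrib, ← balMk_mul,
        mul_assoc]
      rfl

/-- The map `N → A ⊗_B N` sending `n` to `S(n₋₁) ⊗ n₀`. -/
noncomputable def descentAux : N.carrier →ₗ[k] BalTensor B.val N.carrier :=
  antipodeMk B N ∘ₗ N.coact

/-- S(b₁ n₋₁) ⊗ b₂ n₀ = S(n₋₁) S(b₁) b₂ ⊗ n₀. This is what lets the map descend to N/B⁺N. -/
theorem descentAux_smul (b : B) (n : N.carrier) :
    descentAux B N (b • n) = Coalgebra.counit (R := k) (b : A) • descentAux B N n := by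
  rw [descentAux, LinearMap.comp_apply, N.coact_smul, antipodeMk_map₂, coidealComul_spec,
    HopfAlgebra.mul_antipode_rTensor_comul_apply, LinearMap.comp_apply]
  generalize N.coact n = z
  induction z with
  | zero => simp
  | add z z' hz hz' => simp only [map_add, smul_add, hz, hz']
  | tmul y n =>
    rw [antipodeMk_tmul]
    simp [Algebra.algebraMap_eq_smul_one]

/-- The map `N / B⁺N → A ⊗_B N` sending `[n]` to `S(n₋₁) ⊗ n₀`. -/
noncomputable def descent : (N.carrier ⧸ plusSub B N) →ₗ[k] BalTensor B.val N.carrier :=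
  (plusSub B N).liftQ (descentAux B N) (by
    refine Submodule.span_le.2 ?_
    rintro _ ⟨b, m, hb, rfl⟩
    rw [SetLike.mem_coe, LinearMap.mem_ker, descentAux_smul,
      show Coalgebra.counit (R := k) (b : A) = 0 from hb.2, zero_smul])

theorem descent_mk (n : N.carrier) :
    descent B N ((plusSub B N).mkQ n) = antipodeMk B N (N.coact n) := rfl

/-- The map `A ⊗_B N → N / B⁺N` sending `a ⊗ n` to `ε(a) [n]`. -/
noncomputable def counitBal : BalTensor B.val N.carrier →ₗ[k] (N.carrier ⧸ plusSub B N) :=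
  balLift B.val ((LinearMap.lsmul k _).compl₁₂ (Coalgebra.counit (R := k) (A := A))
    (plusSub B N).mkQ) (by
      intro a b n
      change Coalgebra.counit (R := k) (a * (b : A)) • (plusSub B N).mkQ n =
        Coalgebra.counit (R := k) a • (plusSub B N).mkQ (b • n)
      rw [mkQ_smul, Bialgebra.counit_mul, mul_smul])

theorem counitBal_mk (a : A) (n : N.carrier) :
    counitBal B N (balMk B.val a n) = Coalgebra.counit (R := k) a • (plusSub B N).mkQ n := rfl

/-- Since ε ∘ S = ε, the composite is [n] ↦ ε(n₋₁)[n₀]. So N/B⁺N is a direct summand of A ⊗_B N as a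
vector space. -/
theorem counitBal_descent (x : N.carrier ⧸ plusSub B N) : counitBal B N (descent B N x) = x := by
  obtain ⟨n, rfl⟩ := Submodule.mkQ_surjective _ x
  have h : ∀ z : A ⊗[k] N.carrier, counitBal B N (antipodeMk B N z) =
      (plusSub B N).mkQ (TensorProduct.lid k _
        ((Coalgebra.counit (R := k)).rTensor N.carrier z)) := by
    intro z
    induction z with
    | zero => simp
    | add z z' hz hz' => simp only [map_add, hz, hz']
    | tmul x y =>
      rw [antipodeMk_tmul, counitBal_mk, HopfAlgebra.counit_antipode]
      simp
  rw [descent_mk, h, N.isLeftCoaction.counit]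
  simp

/-- The map `A ⊗ N → A ⊗_B N` sending `a ⊗ n` to `a S(n₋₁) ⊗ n₀`. -/
noncomputable def smulDescent :
    A ⊗[k] (N.carrier ⧸ plusSub B N) →ₗ[k] BalTensor B.val N.carrier :=
  TensorProduct.lift ((act k A (BalTensor B.val N.carrier)).compl₂ (descent B N))

theorem smulDescent_tmul (a : A) (x : N.carrier ⧸ plusSub B N) :
    smulDescent B N (a ⊗ₜ x) = a • descent B N x := rfl

/-- The element is n₋₂ S(n₋₁) ⊗ n₀, and the antipode identity removes the first two legs. -/
theorem smulDescent_coact (n : N.carrier) :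
    smulDescent B N ((plusSub B N).mkQ.lTensor A (N.coact n)) = balMk B.val 1 n := by
  have h : ∀ z : A ⊗[k] N.carrier, smulDescent B N ((plusSub B N).mkQ.lTensor A z) =
      TensorProduct.lift (balMk B.val) ((LinearMap.mul' k A ∘ₗ
        (HopfAlgebra.antipode k).lTensor A).rTensor N.carrier
          ((TensorProduct.assoc k A A N.carrier).symm (N.coact.lTensor A z))) := by
    intro z
    induction z with
    | zero => simp
    | add z z' hz hz' => simp only [map_add, hz, hz']
    | tmul x y =>
      rw [LinearMap.lTensor_tmul, smulDescent_tmul, descent_mk, LinearMap.lTensor_tmul]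
      generalize N.coact y = w
      induction w with
      | zero => simp
      | add z z' hz hz' => simp only [map_add, smul_add, TensorProduct.tmul_add, hz, hz']
      | tmul y y' => rfl
  have h2 : (LinearMap.mul' k A ∘ₗ (HopfAlgebra.antipode k).lTensor A).rTensor N.carrier
      (Coalgebra.comul.rTensor N.carrier (N.coact n)) = 1 ⊗ₜ[k] n := by
    rw [← LinearMap.comp_apply, ← LinearMap.rTensor_comp, LinearMap.comp_assoc,
      HopfAlgebra.mul_antipode_lTensor_comul, LinearMap.rTensor_comp, LinearMap.comp_apply,
      N.isLeftCoaction.counit]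
    simp
  rw [h, ← N.isLeftCoaction.coassoc, LinearEquiv.symm_apply_apply, h2, TensorProduct.lift.tmul]

/-- By `smulDescent_coact`, a ⊗ n = a n₋₁ · `descent` [n₀]: the image of `descent` generates A ⊗_B N
over A. -/
theorem balTensor_span_descent {p : BalTensor B.val N.carrier → Prop} (h0 : p 0)
    (h : ∀ (a : A) x, p (a • descent B N x)) (hadd : ∀ x y, p x → p y → p (x + y))
    (y : BalTensor B.val N.carrier) : p y := by
  refine bal_induction B.val y h0 (fun a n => ?_) hadd
  have e : balMk B.val a n =
      a • smulDescent B N ((plusSub B N).mkQ.lTensor A (N.coact n)) := by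
    rw [smulDescent_coact, smul_balMk, mul_one]
  rw [e]
  generalize (plusSub B N).mkQ.lTensor A (N.coact n) = z
  induction z with
  | zero => simpa using h0
  | add z z' hz hz' =>
    rw [map_add, smul_add]
    exact hadd _ _ hz hz'
  | tmul c x =>
    rw [smulDescent_tmul, smul_smul]
    exact h _ x

/-- On N/B⁺N the leg b₂ acts as the scalar ε(b₂), so only b₁ ε(b₂) = b remains, in the first factor.
It makes `balCoact` balanced and `psiPhiLin` B-linear. -/
theorem lTensor_mkQ_coact_smul (b : B) (n : N.carrier) :
    (plusSub B N).mkQ.lTensor A (N.coact (b • n)) =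
      (b : A) • (plusSub B N).mkQ.lTensor A (N.coact n) := by
  have h := map_map₂ (k := k) (β := LinearMap.mul k A) (β₁ := LinearMap.mul k A)
    (f := LinearMap.id) (g := LinearMap.id) (h := LinearMap.id) (fun _ _ => rfl)
    (β' := act k B N.carrier) (β₁' := LinearMap.lsmul k (N.carrier ⧸ plusSub B N))
    (f' := Coalgebra.counit (R := k) (A := A) ∘ₗ B.val.toLinearMap)
    (g' := (plusSub B N).mkQ) (h' := (plusSub B N).mkQ)
    (fun x y => mkQ_smul B N x y) (coidealComul B b) (N.coact n)
  rw [N.coact_smul]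
  refine h.trans ?_
  have h2 := lTensor_counit_coidealComul B b
  rw [LinearMap.lTensor] at h2
  rw [h2, LinearMap.lTensor]
  generalize TensorProduct.map LinearMap.id (plusSub B N).mkQ (N.coact n) = z
  induction z with
  | zero => simp
  | add z z' hz hz' => simp only [map_add, smul_add, hz, hz']
  | tmul x y => simp [TensorProduct.map₂_apply_tmul, TensorProduct.smul_tmul']

/-- The map `A ⊗_B N → A ⊗ N / B⁺N` sending `a ⊗ n` to `a n₋₁ ⊗ [n₀]`. -/
noncomputable def balCoact :
    BalTensor B.val N.carrier →ₗ[k] A ⊗[k] (N.carrier ⧸ plusSub B N) :=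
  balLift B.val ((act k A (A ⊗[k] (N.carrier ⧸ plusSub B N))).compl₂
      ((plusSub B N).mkQ.lTensor A ∘ₗ N.coact)) (by
    intro a b n
    change (a * (b : A)) • (plusSub B N).mkQ.lTensor A (N.coact n) =
      a • (plusSub B N).mkQ.lTensor A (N.coact (b • n))
    rw [lTensor_mkQ_coact_smul, smul_smul])

theorem balCoact_mk (a : A) (n : N.carrier) :
    balCoact B N (balMk B.val a n) = a • (plusSub B N).mkQ.lTensor A (N.coact n) := rfl

theorem smulDescent_smul (a : A) (z : A ⊗[k] (N.carrier ⧸ plusSub B N)) :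
    smulDescent B N (a • z) = a • smulDescent B N z := by
  induction z with
  | zero => simp
  | add z z' hz hz' => simp only [map_add, smul_add, hz, hz']
  | tmul x y =>
    rw [TensorProduct.smul_tmul', smulDescent_tmul, smulDescent_tmul, smul_smul, smul_eq_mul]

/-- This composite alone gives that `balCoact` is injective, which is what the reflection of
injectivity uses. -/
theorem smulDescent_balCoact (x : BalTensor B.val N.carrier) :
    smulDescent B N (balCoact B N x) = x := by
  refine bal_induction B.val (p := fun x => smulDescent B N (balCoact B N x) = x) x (by simp) ?_ ?_
  · intro a n
    rw [balCoact_mk, smulDescent_smul, smulDescent_coact, smul_balMk, mul_one]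
  · intro x y hx hy
    rw [map_add, map_add, hx, hy]

end Descent

variable {B}
variable {N N' N'' : RelHopfMod B}

/-- The map `N / B⁺N → N' / B⁺N'` induced by a morphism of relative Hopf modules. -/
noncomputable abbrev phiMap (f : N ⟶ N') :
    (N.carrier ⧸ plusSub B N) →ₗ[k] (N'.carrier ⧸ plusSub B N') :=
  LeftComod.Hom.lin ((takeuchiPhi B).map f)

theorem phiMap_mk (f : N ⟶ N') (n : N.carrier) : phiMap f ((plusSub B N).mkQ n) =
    (plusSub B N').mkQ (RelHopfMod.Hom.lin f n) := rfl

theorem balMap_descent (f : N ⟶ N') (x : N.carrier ⧸ plusSub B N) :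
    balMap B.val (RelHopfMod.Hom.lin f) (descent B N x) = descent B N' (phiMap f x) := by
  obtain ⟨n, rfl⟩ := Submodule.mkQ_surjective _ x
  rw [phiMap_mk, descent_mk, descent_mk, RelHopfMod.Hom.comm]
  generalize N.coact n = z
  induction z with
  | zero => simp
  | add z z' hz hz' => simp only [map_add, hz, hz']
  | tmul x y => rfl

theorem counitBal_balMap (f : N ⟶ N') (x : BalTensor B.val N.carrier) :
    counitBal B N' (balMap B.val (RelHopfMod.Hom.lin f) x) = phiMap f (counitBal B N x) := by
  refine bal_induction B.val (p := fun x => counitBal B N' (balMap B.val (RelHopfMod.Hom.lin f) x) =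
    phiMap f (counitBal B N x)) x (by simp) ?_ ?_
  · intro a n
    rw [balMap_mk, counitBal_mk, counitBal_mk, map_smul, phiMap_mk]
  · intro x y hx hy
    simp only [map_add, hx, hy]

theorem balCoact_balMap (f : N ⟶ N') (x : BalTensor B.val N.carrier) :
    balCoact B N' (balMap B.val (RelHopfMod.Hom.lin f) x) =
      (phiMap f).lTensor A (balCoact B N x) := by
  refine bal_induction B.val (p := fun x => balCoact B N' (balMap B.val (RelHopfMod.Hom.lin f) x) =
    (phiMap f).lTensor A (balCoact B N x)) x (by simp) ?_ ?_
  · intro a n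
    rw [balMap_mk, balCoact_mk, balCoact_mk, RelHopfMod.Hom.comm]
    generalize N.coact n = z
    induction z with
    | zero => simp
    | add z z' hz hz' => simp only [map_add, smul_add, hz, hz']
    | tmul x y => rfl
  · intro x y hx hy
    simp only [map_add, hx, hy]

/-- The functor `Φ` preserves exactness. -/
theorem phiMap_exact (f : N ⟶ N') (g : N' ⟶ N'')
    (h : Function.Exact (RelHopfMod.Hom.lin f) (RelHopfMod.Hom.lin g)) :
    Function.Exact (phiMap f) (phiMap g) := by
  have h' := (IsQuantumHomogeneousSpace.faithfullyFlat (B := B) _ _ _ _ _).1 h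
  intro x
  constructor
  · intro hx
    have h1 := balMap_descent g x
    rw [hx, map_zero] at h1
    -- By naturality `descent` x lies in the kernel of A ⊗_B g, hence in the image of A ⊗_B f. The
    -- natural retraction `counitBal` carries a preimage back to N/B⁺N.
    obtain ⟨y, hy⟩ := (h' _).1 h1
    refine ⟨counitBal B N y, ?_⟩
    rw [← counitBal_balMap, hy, counitBal_descent]
  · rintro ⟨y, rfl⟩
    obtain ⟨n, rfl⟩ := Submodule.mkQ_surjective _ y
    rw [phiMap_mk, phiMap_mk, h.apply_apply_eq_zero, map_zero]

/-- The functor `Φ` preserves injectivity. -/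
theorem phiMap_injective (f : N ⟶ N') (h : Function.Injective (RelHopfMod.Hom.lin f)) :
    Function.Injective (phiMap f) := by
  rw [injective_iff_map_eq_zero]
  intro x hx
  have h1 := balMap_descent f x
  rw [hx, map_zero] at h1
  have h2 := ff_injective IsQuantumHomogeneousSpace.faithfullyFlat _ h _ h1
  rw [← counitBal_descent B N x, h2, map_zero]

/-- Injectivity is exactness of 0 → M → M', with `PUnit` as the zero module. -/
theorem ff_reflects_injective {S R : Type u} [Ring S] [Algebra k S] [Ring R] [Algebra k R]
    {i : S →ₐ[k] R} (hi : RightFaithfullyFlat i) {M M' : Type u} [AddCommGroup M] [Module k M]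
    [Module S M] [IsScalarTower k S M] [AddCommGroup M'] [Module k M'] [Module S M']
    [IsScalarTower k S M'] (f : M →ₗ[S] M') (hf : Function.Injective (balMap i f)) :
    Function.Injective f := by
  have h := (hi PUnit.{u+1} M M' (0 : PUnit.{u+1} →ₗ[S] M) f).2 (by
    intro x
    rw [map_eq_zero_iff _ hf]
    constructor
    · rintro rfl
      exact ⟨0, map_zero _⟩
    · rintro ⟨y, rfl⟩
      refine bal_induction i
        (p := fun y => balMap i (0 : PUnit.{u+1} →ₗ[S] M) y = 0) y (map_zero _) ?_ ?_
      · intro r n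
        rw [balMap_mk, LinearMap.zero_apply, map_zero]
      · intro x y hx hy
        rw [map_add, hx, hy, add_zero])
  rw [injective_iff_map_eq_zero]
  intro x hx
  obtain ⟨y, rfl⟩ := (h x).1 hx
  rfl

/-- Surjectivity is exactness of M → M' → 0, with `PUnit` as the zero module. -/
theorem ff_reflects_surjective {S R : Type u} [Ring S] [Algebra k S] [Ring R] [Algebra k R]
    {i : S →ₐ[k] R} (hi : RightFaithfullyFlat i) {M M' : Type u} [AddCommGroup M] [Module k M]
    [Module S M] [IsScalarTower k S M] [AddCommGroup M'] [Module k M'] [Module S M']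
    [IsScalarTower k S M'] (f : M →ₗ[S] M') (hf : Function.Surjective (balMap i f)) :
    Function.Surjective f := by
  have h := (hi M M' PUnit.{u+1} f (0 : M' →ₗ[S] PUnit.{u+1})).2 (by
    intro x
    refine ⟨fun _ => hf x, fun _ => ?_⟩
    refine bal_induction i
      (p := fun y => balMap i (0 : M' →ₗ[S] PUnit.{u+1}) y = 0) x (map_zero _) ?_ ?_
    · intro r n
      rw [balMap_mk, LinearMap.zero_apply, map_zero]
    · intro x y hx hy
      rw [map_add, hx, hy, add_zero])
  exact fun x => (h x).1 rfl

/-- The functor `Φ` reflects bijectivity. -/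
theorem bijective_of_phiMap (f : N ⟶ N') (h : Function.Bijective (phiMap f)) :
    Function.Bijective (RelHopfMod.Hom.lin f) := by
  have hB := IsQuantumHomogeneousSpace.faithfullyFlat (B := B)
  constructor
  -- A ⊗_B N embeds naturally in A ⊗ N/B⁺N by `balCoact`, and there the map is id ⊗ Φ(f), injective
  -- because A is flat over the field.
  · refine ff_reflects_injective hB _ fun x y hxy => ?_
    have h1 := congrArg (balCoact B N') hxy
    rw [balCoact_balMap, balCoact_balMap] at h1
    have h2 := lTensor_inj A h.1 h1
    rw [← smulDescent_balCoact B N x, h2, smulDescent_balCoact]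
  -- The generators a · `descent` x of A ⊗_B N' have preimages, since x lifts along Φ(f) and
  -- `descent` is natural.
  · refine ff_reflects_surjective hB _ fun y => ?_
    refine balTensor_span_descent B N'
      (p := fun y => ∃ x, balMap B.val (RelHopfMod.Hom.lin f) x = y) ⟨0, map_zero _⟩ ?_ ?_ y
    · intro a x
      obtain ⟨x, rfl⟩ := h.2 x
      exact ⟨a • descent B N x, by rw [map_smul, balMap_descent]⟩
    · rintro _ _ ⟨x, rfl⟩ ⟨y, rfl⟩
      exact ⟨x + y, map_add _ _ _⟩

end Exactness

/-! ### The relative Hopf modules A and N ⊗ T, and their quotients by B⁺. -/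

section TensorObjects

variable {k : Type*} [Field k]

/-- The coaction `Δ ⊗ id` on `N ⊗ T` of a left coaction on `N`. -/
noncomputable def tensorCoact {C N : Type*} (T : Type*) [AddCommGroup C] [Module k C]
    [AddCommGroup N] [Module k N] [AddCommGroup T] [Module k T] (δ : N →ₗ[k] C ⊗[k] N) :
    N ⊗[k] T →ₗ[k] C ⊗[k] (N ⊗[k] T) :=
  (TensorProduct.assoc k C N T).toLinearMap ∘ₗ δ.rTensor T

theorem tensorCoact_tmul {C N T : Type*} [AddCommGroup C] [Module k C]
    [AddCommGroup N] [Module k N] [AddCommGroup T] [Module k T] (δ : N →ₗ[k] C ⊗[k] N)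
    (n : N) (t : T) : tensorCoact T δ (n ⊗ₜ t) = TensorProduct.assoc k C N T (δ n ⊗ₜ t) := rfl

theorem isLeftCoaction_tensorCoact {C N T : Type*} [AddCommGroup C] [Module k C] [Coalgebra k C]
    [AddCommGroup N] [Module k N] [AddCommGroup T] [Module k T] {δ : N →ₗ[k] C ⊗[k] N}
    (h : IsLeftCoaction C δ) : IsLeftCoaction C (tensorCoact T δ) := by
  have main : ∀ (t : T) (n : N),
      TensorProduct.assoc k C C _ ((Coalgebra.comul (R := k)).rTensor _
        (tensorCoact T δ (n ⊗ₜ t))) = (tensorCoact T δ).lTensor C (tensorCoact T δ (n ⊗ₜ t)) ∧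
      (Coalgebra.counit (R := k)).rTensor _ (tensorCoact T δ (n ⊗ₜ t)) = 1 ⊗ₜ (n ⊗ₜ t) := by
    intro t n
    have e : ∀ z : C ⊗[k] N, TensorProduct.assoc k C N T (z ⊗ₜ t) =
        ((TensorProduct.mk k N T).flip t).lTensor C z := by
      intro z
      induction z with
      | zero => simp
      | add z z' hz hz' => simp only [map_add, TensorProduct.add_tmul, hz, hz']
      | tmul x y => rfl
    have h1 : ∀ z : C ⊗[k] N, TensorProduct.assoc k C C _ ((Coalgebra.comul (R := k)).rTensor _
        (((TensorProduct.mk k N T).flip t).lTensor C z)) =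
        (((TensorProduct.mk k N T).flip t).lTensor C).lTensor C
          (TensorProduct.assoc k C C _ ((Coalgebra.comul (R := k)).rTensor _ z)) := by
      intro z
      induction z with
      | zero => simp
      | add z z' hz hz' => simp only [map_add, hz, hz']
      | tmul x y =>
        rw [LinearMap.lTensor_tmul, LinearMap.rTensor_tmul, LinearMap.rTensor_tmul]
        generalize Coalgebra.comul (R := k) x = w
        induction w with
        | zero => simp
        | add z z' hz hz' => simp only [map_add, TensorProduct.add_tmul, hz, hz']
        | tmul x y => rfl
    have h2 : ∀ z : C ⊗[k] N, (tensorCoact T δ).lTensor C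
        (((TensorProduct.mk k N T).flip t).lTensor C z) =
        (((TensorProduct.mk k N T).flip t).lTensor C).lTensor C (δ.lTensor C z) := by
      intro z
      induction z with
      | zero => simp
      | add z z' hz hz' => simp only [map_add, hz, hz']
      | tmul x y =>
        rw [LinearMap.lTensor_tmul, LinearMap.lTensor_tmul, LinearMap.lTensor_tmul,
          LinearMap.lTensor_tmul, ← e]
        rfl
    have h3 : ∀ z : C ⊗[k] N, (Coalgebra.counit (R := k)).rTensor _
        (((TensorProduct.mk k N T).flip t).lTensor C z) =
        ((TensorProduct.mk k N T).flip t).lTensor k ((Coalgebra.counit (R := k)).rTensor _ z) := by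
      intro z
      induction z with
      | zero => simp
      | add z z' hz hz' => simp only [map_add, hz, hz']
      | tmul x y => rfl
    rw [tensorCoact_tmul, e, h1, h2, h3, h.coassoc, h.counit]
    exact ⟨rfl, rfl⟩
  constructor
  · intro z
    induction z with
    | zero => simp
    | add z z' hz hz' => simp only [map_add, hz, hz']
    | tmul n t => exact (main t n).1
  · intro z
    induction z with
    | zero => simp
    | add z z' hz hz' => simp only [map_add, TensorProduct.tmul_add, hz, hz']
    | tmul n t => exact (main t n).2

variable {A : Type u} [Ring A] [HopfAlgebra k A]
  (B : Subalgebra k A) [IsQuantumHomogeneousSpace B]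

/-- `A` as a relative Hopf module over `B`. -/
noncomputable abbrev RelHopfMod.self : RelHopfMod B where
  carrier := A
  coact := Coalgebra.comul
  isLeftCoaction := isLeftCoaction_comul
  coact_smul b a := by
    refine (comul_mul_map₂ (b : A) a).trans ?_
    rw [← coidealComul_spec]
    have h := map_map₂ (k := k) (β := LinearMap.mul k A) (β₁ := LinearMap.mul k A)
      (f := LinearMap.id) (g := LinearMap.id) (h := LinearMap.id) (fun _ _ => rfl)
      (β' := act k B A) (β₁' := LinearMap.mul k A) (f' := B.val.toLinearMap)
      (g' := LinearMap.id) (h' := LinearMap.id) (fun _ _ => rfl)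
      (coidealComul B b) (Coalgebra.comul (R := k) a)
    rw [TensorProduct.map_id] at h
    exact h.symm

variable {B}

/-- The relative Hopf module `N ⊗ T`, where `T` is a vector space. -/
noncomputable abbrev RelHopfMod.tensor (N : RelHopfMod B) (T : Type u) [AddCommGroup T] [Module k T] :
    RelHopfMod B where
  carrier := N.carrier ⊗[k] T
  coact := tensorCoact T N.coact
  isLeftCoaction := isLeftCoaction_tensorCoact N.isLeftCoaction
  coact_smul b z := by
    have key : ∀ (w : A ⊗[k] B) (y : A ⊗[k] N.carrier) (t : T),
        TensorProduct.assoc k A N.carrier T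
          (TensorProduct.map₂ (LinearMap.mul k A) (act k B N.carrier) w y ⊗ₜ t) =
        TensorProduct.map₂ (LinearMap.mul k A) (act k B (N.carrier ⊗[k] T)) w
          (TensorProduct.assoc k A N.carrier T (y ⊗ₜ t)) := by
      intro w y m
      induction w with
      | zero => simp
      | add z z' hz hz' =>
        simp only [map_add, LinearMap.add_apply, TensorProduct.add_tmul, hz, hz']
      | tmul x x' =>
        induction y with
        | zero => simp
        | add z z' hz hz' => simp only [map_add, TensorProduct.add_tmul, hz, hz']
        | tmul y y' => rfl
    induction z with
    | zero => simp
    | add z z' hz hz' => simp only [map_add, smul_add, hz, hz']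
    | tmul n t =>
      rw [TensorProduct.smul_tmul', tensorCoact_tmul, N.coact_smul, key]
      rfl

/-- Tensoring over the field is exact, so the kernel is the image of B⁺N ⊗ T, and that lies in B⁺(N
⊗ T) because B acts on the first factor only. Hence vanishing in Φ(N ⊗ T) can be checked in Φ(N) ⊗
T. -/
theorem ker_mkQ_rTensor_le (N : RelHopfMod B) (T : Type u) [AddCommGroup T] [Module k T]
    {z : N.carrier ⊗[k] T} (hz : (plusSub B N).mkQ.rTensor T z = 0) :
    (plusSub B (N.tensor T)).mkQ z = 0 := by
  obtain ⟨y, rfl⟩ := mem_range_rTensor T (LinearMap.exact_subtype_mkQ (plusSub B N)) hz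
  clear hz
  refine (Submodule.Quotient.mk_eq_zero (plusSub B (N.tensor T))).2 ?_
  induction y with
  | zero => exact (map_zero ((plusSub B N).subtype.rTensor T)) ▸ Submodule.zero_mem _
  | add y y' hy hy' =>
    exact (map_add ((plusSub B N).subtype.rTensor T) y y') ▸ Submodule.add_mem _ hy hy'
  | tmul x t =>
    obtain ⟨x, hx⟩ := x
    change x ⊗ₜ t ∈ _
    refine Submodule.span_induction (p := fun x _ => x ⊗ₜ[k] t ∈ plusSub B (N.tensor T))
      ?_ ?_ ?_ ?_ hx
    · rintro _ ⟨b, m, hb, rfl⟩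
      exact Submodule.subset_span ⟨b, m ⊗ₜ t, hb, rfl⟩
    · rw [TensorProduct.zero_tmul]
      exact Submodule.zero_mem _
    · intro x y _ _ hx hy
      rw [TensorProduct.add_tmul]
      exact Submodule.add_mem _ hx hy
    · intro c x _ hx
      rw [← TensorProduct.smul_tmul']
      exact Submodule.smul_mem _ c hx

theorem mem_plusSub_self {a : A} : a ∈ plusSub B (RelHopfMod.self B) ↔ a ∈ augIdeal B := by
  constructor
  · intro h
    refine Submodule.span_le (p := (augIdeal B).restrictScalars k).2 ?_ h
    rintro _ ⟨b, m, hb, rfl⟩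
    exact Ideal.mul_mem_right _ _ (plus_le B hb)
  · intro h
    refine augIdeal_induction B (p := fun x => x ∈ plusSub B (RelHopfMod.self B)) ?_ ?_ h
    · intro b hb a
      exact Submodule.subset_span ⟨⟨b, hb.1⟩, a, hb, rfl⟩
    · intro x y hx hy
      exact Submodule.add_mem _ hx hy

theorem mkQ_self_tensor_eq_zero {T : Type u} [AddCommGroup T] [Module k T] {z : A ⊗[k] T}
    (hz : (proj B).toLinearMap.rTensor T z = 0) :
    (plusSub B ((RelHopfMod.self B).tensor T)).mkQ z = 0 := by
  apply ker_mkQ_rTensor_le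
  -- The ideal `augIdeal B` and the subspace `plusSub B` of A have the same elements; g compares the
  -- two quotients of A.
  let g : QuotHopf B →ₗ[k] (A ⧸ plusSub B (RelHopfMod.self B)) :=
    ((augIdeal B).restrictScalars k).liftQ (plusSub B (RelHopfMod.self B)).mkQ (fun x hx => by
      exact (Submodule.Quotient.mk_eq_zero _).2 (mem_plusSub_self.2 hx))
  have h := congrArg (g.rTensor T) hz
  rw [map_zero] at h
  exact (LinearMap.congr_fun (LinearMap.rTensor_comp T g (proj B).toLinearMap) z).trans h

end TensorObjects

/-! ### Takeuchi's equivalence. -/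

section Takeuchi

variable {k : Type*} [Field k] {A : Type u} [Ring A] [HopfAlgebra k A]
  {B : Subalgebra k A} [IsQuantumHomogeneousSpace B]

section Counit

variable (V : LeftComod k (QuotHopf B))

/-- The inclusion of `A □ V` in `A ⊗ V` as a morphism of relative Hopf modules. -/
noncomputable def cotHom : (takeuchiPsi B).obj V ⟶ (RelHopfMod.self B).tensor V.carrier :=
  RelHopfMod.Hom.mk (N := (RelHopfMod.self B).tensor V.carrier) (cotensor B V).subtype
    (fun z => (psiCoact_spec B V z).symm)

/-- The difference map of the cotensor product as a morphism of relative Hopf modules. -/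
noncomputable def cotDiffHom : (RelHopfMod.self B).tensor V.carrier ⟶
    (RelHopfMod.self B).tensor (QuotHopf B ⊗[k] V.carrier) :=
  RelHopfMod.Hom.mk (M := (RelHopfMod.self B).tensor V.carrier)
    (N := (RelHopfMod.self B).tensor (QuotHopf B ⊗[k] V.carrier))
    { toFun := cotDiff B V
      map_add' := map_add _
      map_smul' := fun b z => cotDiff_smul B V b z }
    (fun z => (cotDiff_freeCoact B V z).symm)

/-- The map `a ⊗ v ↦ ε(a) v`. -/
noncomputable def counitEval {k : Type*} [Field k] (A V : Type*) [Ring A] [HopfAlgebra k A] [AddCommGroup V]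
    [Module k V] : A ⊗[k] V →ₗ[k] V :=
  (TensorProduct.lid k V).toLinearMap ∘ₗ (Coalgebra.counit (R := k)).rTensor V

theorem counitEval_tmul {V : Type*} [AddCommGroup V] [Module k V] (a : A) (v : V) :
    counitEval A V (a ⊗ₜ[k] v) = Coalgebra.counit (R := k) a • v := rfl

theorem counitEval_smul {V : Type*} [AddCommGroup V] [Module k V] (a : A) (z : A ⊗[k] V) :
    counitEval A V (a • z) = Coalgebra.counit (R := k) a • counitEval A V z := by
  induction z with
  | zero => simp
  | add z z' hz hz' => simp only [map_add, smul_add, hz, hz']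
  | tmul c v =>
    rw [TensorProduct.smul_tmul', counitEval_tmul, counitEval_tmul, smul_eq_mul,
      Bialgebra.counit_mul, mul_smul]

/-- The map `(A □ V) / B⁺(A □ V) → V` sending `[a ⊗ v]` to `ε(a) v`. -/
noncomputable def phiPsi :
    (Cotensor B V ⧸ plusSub B ((takeuchiPsi B).obj V)) →ₗ[k] V.carrier :=
  (plusSub B ((takeuchiPsi B).obj V)).liftQ (counitEval A V.carrier ∘ₗ cotVal B V) (by
    refine Submodule.span_le.2 ?_
    rintro _ ⟨b, m, hb, rfl⟩
    refine (counitEval_smul (b : A) (cotVal B V m)).trans ?_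
    rw [show Coalgebra.counit (R := k) (b : A) = 0 from hb.2, zero_smul])

/-- On A □ V the left side vanishes, so (π_B ⊗ id)(z) is the coaction of (ε ⊗ id)(z). This gives
both the injectivity of `phiPsi` and its colinearity. -/
theorem counitEval_cotDiff (z : A ⊗[k] V.carrier) :
    counitEval A (QuotHopf B ⊗[k] V.carrier) (cotDiff B V z) =
      (proj B).toLinearMap.rTensor V.carrier z - V.coact (counitEval A V.carrier z) := by
  induction z with
  | zero => simp
  | add z z' hz hz' =>
    simp only [map_add, hz, hz']
    abel
  | tmul a v =>
    rw [cotDiff_tmul, map_sub, counitEval_tmul, counitEval_tmul, map_smul,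
      LinearMap.rTensor_tmul]
    congr 1
    have h : ∀ z : A ⊗[k] A, counitEval A (QuotHopf B ⊗[k] V.carrier)
        (TensorProduct.assoc k A (QuotHopf B) V.carrier
          ((proj B).toLinearMap.lTensor A z ⊗ₜ v)) =
        (proj B (TensorProduct.lid k A ((Coalgebra.counit (R := k)).rTensor A z))) ⊗ₜ v := by
      intro z
      induction z with
      | zero => simp
      | add z z' hz hz' => simp only [map_add, TensorProduct.add_tmul, hz, hz']
      | tmul x y =>
        rw [LinearMap.lTensor_tmul, TensorProduct.assoc_tmul, counitEval_tmul,
          LinearMap.rTensor_tmul, TensorProduct.lid_tmul, map_smul, TensorProduct.smul_tmul']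
        rfl
    refine (h (Coalgebra.comul a)).trans ?_
    rw [Coalgebra.rTensor_counit_comul, TensorProduct.lid_tmul, one_smul]
    rfl

/-- Modulo B⁺A in the first factor, the map defining A □ V becomes the defect Δ ⊗ id - id ⊗ δ of
coassociativity, which vanishes on the image of the coaction δ of V. -/
theorem rTensor_proj_cotDiff (z : A ⊗[k] V.carrier) :
    (proj B).toLinearMap.rTensor _ (cotDiff B V z) =
      TensorProduct.assoc k _ _ _ ((Coalgebra.comul (R := k)).rTensor V.carrier
        ((proj B).toLinearMap.rTensor V.carrier z)) -
      V.coact.lTensor _ ((proj B).toLinearMap.rTensor V.carrier z) := by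
  induction z with
  | zero => simp
  | add z z' hz hz' =>
    simp only [map_add, hz, hz']
    abel
  | tmul a v =>
    rw [cotDiff_tmul, map_sub, LinearMap.rTensor_tmul, LinearMap.rTensor_tmul,
      LinearMap.rTensor_tmul, LinearMap.lTensor_tmul]
    congr 1
    have h : ∀ z : A ⊗[k] A, (proj B).toLinearMap.rTensor _
        (TensorProduct.assoc k A (QuotHopf B) V.carrier
          ((proj B).toLinearMap.lTensor A z ⊗ₜ v)) =
        TensorProduct.assoc k _ _ _
          (TensorProduct.map (proj B).toLinearMap (proj B).toLinearMap z ⊗ₜ v) := by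
      intro z
      induction z with
      | zero => simp
      | add z z' hz hz' => simp only [map_add, TensorProduct.add_tmul, hz, hz']
      | tmul x y => rfl
    exact h (Coalgebra.comul a)

theorem counitEval_rTensor {z : A ⊗[k] V.carrier} :
    counitEval A V.carrier z =
      TensorProduct.lid k _ ((Coalgebra.counit (R := k)).rTensor V.carrier
        ((proj B).toLinearMap.rTensor V.carrier z)) := by
  induction z with
  | zero => simp
  | add z z' hz hz' => simp only [map_add, hz, hz']
  | tmul a v => rfl

/-- Exactness of Φ turns the kernel A □ V into the kernel of the induced map on π_B(A) ⊗ V. That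
kernel is the image of V under its coaction, and ε inverts the coaction. -/
theorem phiPsi_bijective : Function.Bijective (phiPsi V) := by
  constructor
  · rw [injective_iff_map_eq_zero]
    intro x hx
    obtain ⟨z, rfl⟩ := Submodule.mkQ_surjective _ x
    replace hx : counitEval A V.carrier (cotVal B V z) = 0 := hx
    have h1 := counitEval_cotDiff V (cotVal B V z)
    rw [cotDiff_cotVal, hx, map_zero, map_zero, sub_zero] at h1
    have h2 := mkQ_self_tensor_eq_zero h1.symm
    -- The class of z already vanishes in Φ(A ⊗ V), because (π_B ⊗ id)(z) is the coaction of 0; and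
    -- Φ(A □ V) embeds there.
    refine phiMap_injective (cotHom V) (cotensor B V).injective_subtype ?_
    rw [map_zero]
    exact h2
  · intro v
    -- A lift y of the coaction of v to A ⊗ V need not lie in A □ V. Its class does lie in the
    -- kernel of Φ of the defining map, so exactness replaces y by an element of Φ(A □ V).
    obtain ⟨y, hy⟩ := LinearMap.rTensor_surjective V.carrier (g := (proj B).toLinearMap)
      (proj_surjective B) (V.coact v)
    have h1 := rTensor_proj_cotDiff V y
    rw [hy, V.isLeftCoaction.coassoc, sub_self] at h1
    have h2 := mkQ_self_tensor_eq_zero h1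
    have h3 := phiMap_exact (cotHom V) (cotDiffHom V) (cotVal_exact B V)
    obtain ⟨x, hx⟩ := (h3 ((plusSub B ((RelHopfMod.self B).tensor V.carrier)).mkQ y)).1 h2
    refine ⟨x, ?_⟩
    -- Evaluation by ε on Φ(A ⊗ V), of which `phiPsi` is the restriction. On the class of y it gives
    -- (ε ⊗ id) of the coaction of v, which is v.
    let e : (A ⊗[k] V.carrier ⧸ plusSub B ((RelHopfMod.self B).tensor V.carrier)) →ₗ[k]
        V.carrier := Submodule.liftQ _ (counitEval A V.carrier) (by
      refine Submodule.span_le.2 ?_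
      rintro _ ⟨b, m, hb, rfl⟩
      refine (counitEval_smul (b : A) m).trans ?_
      rw [show Coalgebra.counit (R := k) (b : A) = 0 from hb.2, zero_smul])
    have h4 : ∀ x, e (phiMap (cotHom V) x) = phiPsi V x := by
      intro x
      obtain ⟨z, rfl⟩ := Submodule.mkQ_surjective _ x
      rfl
    have h5 : e ((plusSub B ((RelHopfMod.self B).tensor V.carrier)).mkQ y) =
        counitEval A V.carrier y := rfl
    rw [← h4, hx, h5, counitEval_rTensor, hy, V.isLeftCoaction.counit]
    simp

end Counit

section Unit

variable (N : RelHopfMod B)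

/-- Both terms of the difference are n₋₂ ⊗ π_B(n₋₁) ⊗ [n₀], by coassociativity. -/
theorem cotDiff_lTensor_mkQ_coact (n : N.carrier) :
    cotDiff B ((takeuchiPhi B).obj N) ((plusSub B N).mkQ.lTensor A (N.coact n)) = 0 := by
  have h1 : ∀ z : A ⊗[k] N.carrier,
      TensorProduct.assoc k A (QuotHopf B) (N.carrier ⧸ plusSub B N)
        ((projCoact B).rTensor _ ((plusSub B N).mkQ.lTensor A z)) =
      (TensorProduct.map (proj B).toLinearMap (plusSub B N).mkQ).lTensor A
        (TensorProduct.assoc k A A N.carrier (Coalgebra.comul.rTensor _ z)) := by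
    intro z
    induction z with
    | zero => simp
    | add z z' hz hz' => simp only [map_add, hz, hz']
    | tmul x y =>
      rw [LinearMap.lTensor_tmul, LinearMap.rTensor_tmul, LinearMap.rTensor_tmul, projCoact,
        LinearMap.comp_apply]
      generalize Coalgebra.comul (R := k) x = w
      induction w with
      | zero => simp
      | add z z' hz hz' => simp only [map_add, TensorProduct.add_tmul, hz, hz']
      | tmul x x' => rfl
  have h2 : ∀ z : A ⊗[k] N.carrier,
      (phiCoact B N).lTensor A ((plusSub B N).mkQ.lTensor A z) =
      (TensorProduct.map (proj B).toLinearMap (plusSub B N).mkQ).lTensor A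
        (N.coact.lTensor A z) := by
    intro z
    induction z with
    | zero => simp
    | add z z' hz hz' => simp only [map_add, hz, hz']
    | tmul x y => rfl
  refine sub_eq_zero.2 ((h1 (N.coact n)).trans ?_)
  rw [N.isLeftCoaction.coassoc]
  exact (h2 (N.coact n)).symm

/-- The map `N → A □ (N / B⁺N)` sending `n` to `n₋₁ ⊗ [n₀]`. -/
noncomputable def psiPhiLin : N.carrier →ₗ[B] Cotensor B ((takeuchiPhi B).obj N) where
  toFun n := ⟨(plusSub B N).mkQ.lTensor A (N.coact n), cotDiff_lTensor_mkQ_coact N n⟩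
  map_add' n n' := Subtype.ext
    (map_add ((plusSub B N).mkQ.lTensor A ∘ₗ N.coact) n n')
  map_smul' b n := Subtype.ext (lTensor_mkQ_coact_smul B N b n)

theorem cotVal_psiPhiLin (n : N.carrier) : cotVal B ((takeuchiPhi B).obj N) (psiPhiLin N n) =
    (plusSub B N).mkQ.lTensor A (N.coact n) := rfl

theorem psiPhiLin_comm (n : N.carrier) :
    psiCoact B ((takeuchiPhi B).obj N) (psiPhiLin N n) =
      ((psiPhiLin N).restrictScalars k).lTensor A (N.coact n) := by
  apply lTensor_inj A (cotVal_inj B ((takeuchiPhi B).obj N))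
  rw [psiCoact_spec, cotVal_psiPhiLin]
  refine (freeCoact_lTensor (plusSub B N).mkQ (N.coact n)).trans ?_
  have h1 := N.isLeftCoaction.coassoc n
  have h2 : freeCoact A N.carrier (N.coact n) = N.coact.lTensor A (N.coact n) := h1
  have h3 : (((plusSub B N).mkQ.lTensor A).lTensor A) ∘ₗ (N.coact.lTensor A) =
      (cotVal B ((takeuchiPhi B).obj N)).lTensor A ∘ₗ
        ((psiPhiLin N).restrictScalars k).lTensor A := TensorProduct.ext' fun _ _ => rfl
  rw [h2]
  exact LinearMap.congr_fun h3 (N.coact n)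

/-- The unit `N → A □ (N / B⁺N)` of the Takeuchi equivalence. -/
noncomputable def psiPhi : N ⟶ (takeuchiPsi B).obj ((takeuchiPhi B).obj N) :=
  RelHopfMod.Hom.mk (N := (takeuchiPsi B).obj ((takeuchiPhi B).obj N)) (psiPhiLin N)
    (psiPhiLin_comm N)

/-- A triangle identity: [n] goes to ε(n₋₁)[n₀]. -/
theorem phiPsi_phiMap_psiPhi (x : N.carrier ⧸ plusSub B N) :
    phiPsi ((takeuchiPhi B).obj N) (phiMap (psiPhi N) x) = x := by
  obtain ⟨n, rfl⟩ := Submodule.mkQ_surjective _ x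
  change counitEval A (N.carrier ⧸ plusSub B N) ((plusSub B N).mkQ.lTensor A (N.coact n)) = _
  have h : ∀ z : A ⊗[k] N.carrier,
      counitEval A (N.carrier ⧸ plusSub B N) ((plusSub B N).mkQ.lTensor A z) =
      (plusSub B N).mkQ (TensorProduct.lid k _ ((Coalgebra.counit (R := k)).rTensor _ z)) := by
    intro z
    induction z with
    | zero => simp
    | add z z' hz hz' => simp only [map_add, hz, hz']
    | tmul x y =>
      rw [LinearMap.lTensor_tmul, counitEval_tmul, LinearMap.rTensor_tmul, TensorProduct.lid_tmul,
        map_smul]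
  rw [h, N.isLeftCoaction.counit, TensorProduct.lid_tmul, one_smul]

/-- The triangle identity and the bijectivity of `phiPsi` show that Φ makes this map bijective, and
Φ reflects bijectivity. -/
theorem psiPhi_bijective : Function.Bijective (RelHopfMod.Hom.lin (psiPhi N)) := by
  apply bijective_of_phiMap
  have h : Function.Bijective (phiPsi ((takeuchiPhi B).obj N) ∘ phiMap (psiPhi N)) := by
    have e : phiPsi ((takeuchiPhi B).obj N) ∘ phiMap (psiPhi N) = id :=
      funext (phiPsi_phiMap_psiPhi N)
    rw [e]
    exact Function.bijective_id
  exact (phiPsi_bijective _).of_comp_iff' _ |>.1 h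

end Unit

/-- A bijective morphism of relative Hopf modules is an isomorphism. -/
noncomputable def RelHopfMod.isoOfBijective {N N' : RelHopfMod B} (f : N ⟶ N')
    (hf : Function.Bijective (RelHopfMod.Hom.lin f)) : N ≅ N' where
  hom := f
  inv := RelHopfMod.Hom.mk (LinearEquiv.ofBijective _ hf).symm.toLinearMap (by
    intro m
    obtain ⟨n, rfl⟩ := hf.2 m
    have e : (LinearEquiv.ofBijective _ hf).symm (RelHopfMod.Hom.lin f n) = n :=
      (LinearEquiv.ofBijective _ hf).symm_apply_apply n
    refine (congrArg N.coact e).trans ?_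
    rw [RelHopfMod.Hom.comm]
    generalize N.coact n = z
    induction z with
    | zero => simp
    | add z z' hz hz' =>
      simp only [map_add]
      rw [← hz, ← hz']
    | tmul x y =>
      exact congrArg (x ⊗ₜ[k] ·)
        ((LinearEquiv.ofBijective _ hf).symm_apply_apply y).symm)
  hom_inv_id := RelHopfMod.Hom.ext (LinearMap.ext
    (LinearEquiv.ofBijective _ hf).symm_apply_apply)
  inv_hom_id := RelHopfMod.Hom.ext (LinearMap.ext
    (LinearEquiv.ofBijective _ hf).apply_symm_apply)

/-- A bijective morphism of comodules is an isomorphism. -/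
noncomputable def LeftComod.isoOfBijective {C : Type u} [AddCommGroup C] [Module k C]
    [Coalgebra k C] {V V' : LeftComod k C} (f : V ⟶ V')
    (hf : Function.Bijective (LeftComod.Hom.lin f)) : V ≅ V' where
  hom := f
  inv := LeftComod.Hom.mk (LinearEquiv.ofBijective _ hf).symm.toLinearMap (by
    intro m
    obtain ⟨n, rfl⟩ := hf.2 m
    have e : (LinearEquiv.ofBijective _ hf).symm (LeftComod.Hom.lin f n) = n :=
      (LinearEquiv.ofBijective _ hf).symm_apply_apply n
    refine (congrArg V.coact e).trans ?_
    rw [LeftComod.Hom.comm]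
    generalize V.coact n = z
    induction z with
    | zero => simp
    | add z z' hz hz' =>
      simp only [map_add]
      rw [← hz, ← hz']
    | tmul x y =>
      exact congrArg (x ⊗ₜ[k] ·)
        ((LinearEquiv.ofBijective _ hf).symm_apply_apply y).symm)
  hom_inv_id := LeftComod.Hom.ext (LinearMap.ext
    (LinearEquiv.ofBijective _ hf).symm_apply_apply)
  inv_hom_id := LeftComod.Hom.ext (LinearMap.ext
    (LinearEquiv.ofBijective _ hf).apply_symm_apply)

/-- On A □ V both sides equal (π_B ⊗ id)(z): the left one by `counitEval_cotDiff`, the right one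
because (π_B ⊗ ε)Δ = π_B. -/
theorem phiPsi_comm (V : LeftComod k (QuotHopf B))
    (x : Cotensor B V ⧸ plusSub B ((takeuchiPsi B).obj V)) :
    V.coact (phiPsi V x) =
      (phiPsi V).lTensor _ (phiCoact B ((takeuchiPsi B).obj V) x) := by
  obtain ⟨z, rfl⟩ := Submodule.mkQ_surjective _ x
  have h1 := counitEval_cotDiff V (cotVal B V z)
  rw [cotDiff_cotVal, map_zero] at h1
  refine (sub_eq_zero.1 h1.symm).symm.trans ?_
  have h2 : (phiPsi V).lTensor (QuotHopf B) ∘ₗ TensorProduct.map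
      (proj B).toLinearMap (plusSub B ((takeuchiPsi B).obj V)).mkQ =
      TensorProduct.map (proj B).toLinearMap (counitEval A V.carrier) ∘ₗ
        (cotVal B V).lTensor A := TensorProduct.ext' fun _ _ => rfl
  refine Eq.trans ?_ (LinearMap.congr_fun h2 (psiCoact B V z)).symm
  change _ = TensorProduct.map (proj B).toLinearMap (counitEval A V.carrier)
    ((cotVal B V).lTensor A (psiCoact B V z))
  rw [psiCoact_spec]
  generalize cotVal B V z = y
  have h3 : ∀ (w : A ⊗[k] A) (v : V.carrier), TensorProduct.map (proj B).toLinearMap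
      (counitEval A V.carrier) (TensorProduct.assoc k A A V.carrier (w ⊗ₜ v)) =
      proj B (TensorProduct.rid k A ((Coalgebra.counit (R := k)).lTensor A w)) ⊗ₜ v := by
    intro w v
    induction w with
    | zero => simp
    | add z z' hz hz' => simp only [map_add, TensorProduct.add_tmul, hz, hz']
    | tmul x y =>
      rw [TensorProduct.assoc_tmul, TensorProduct.map_tmul, counitEval_tmul,
        LinearMap.lTensor_tmul, TensorProduct.rid_tmul, map_smul, TensorProduct.tmul_smul,
        TensorProduct.smul_tmul']
      rfl
  induction y with
  | zero => simp
  | add z z' hz hz' => simp only [map_add, hz, hz']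
  | tmul a v =>
    rw [freeCoact_tmul, h3, Coalgebra.lTensor_counit_comul, TensorProduct.rid_tmul, one_smul]
    rfl

variable (B) in
/-- The Takeuchi equivalence. -/
noncomputable def takeuchiEquivalence : RelHopfMod B ≌ LeftComod k (QuotHopf B) :=
  CategoryTheory.Equivalence.mk (takeuchiPhi B) (takeuchiPsi B)
    (NatIso.ofComponents (fun N => RelHopfMod.isoOfBijective (psiPhi N) (psiPhi_bijective N)) (by
      intro N N' f
      refine RelHopfMod.Hom.ext (LinearMap.ext fun n => Subtype.ext ?_)
      change (plusSub B N').mkQ.lTensor A (N'.coact (RelHopfMod.Hom.lin f n)) =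
        (phiMap f).lTensor A ((plusSub B N).mkQ.lTensor A (N.coact n))
      rw [RelHopfMod.Hom.comm]
      generalize N.coact n = z
      induction z with
      | zero => simp
      | add z z' hz hz' => simp only [map_add, hz, hz']
      | tmul x y => rfl))
    (NatIso.ofComponents (fun V => LeftComod.isoOfBijective
      (LeftComod.Hom.mk (V := (takeuchiPhi B).obj ((takeuchiPsi B).obj V)) (W := V)
        (phiPsi V) (phiPsi_comm V) :
        (takeuchiPhi B).obj ((takeuchiPsi B).obj V) ⟶ V) (phiPsi_bijective V)) (by
      intro V V' f
      refine LeftComod.Hom.ext (LinearMap.ext fun x => ?_)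
      obtain ⟨z, rfl⟩ := Submodule.mkQ_surjective _ x
      change counitEval A V'.carrier ((LeftComod.Hom.lin f).lTensor A (cotVal B V z)) =
        LeftComod.Hom.lin f (counitEval A V.carrier (cotVal B V z))
      generalize cotVal B V z = y
      induction y with
      | zero => simp
      | add z z' hz hz' => simp only [map_add, hz, hz']
      | tmul x y =>
        rw [LinearMap.lTensor_tmul, counitEval_tmul, counitEval_tmul, map_smul]))

end Takeuchi

/-! ### Bijectivity of the antipode of π_B(A). -/

section QuotientAntipode

open HopfAlgebra

variable {k : Type*} [Field k] {A : Type u} [Ring A] [HopfAlgebra k A]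
  (hS : Function.Bijective (antipode k : A → A))
  (B : Subalgebra k A) [IsQuantumHomogeneousSpace B]

theorem proj_antipode (a : A) : proj B (antipode k a) = antipode k (proj B a) := rfl

/-- Elements of B satisfy b₁ ⊗ π_B(b₂) = b ⊗ 1. Applying x ⊗ y ↦ y π_B(S⁻¹(x)) gives π_B(b₂ S⁻¹(b₁))
= ε(b) = 0 on the left and π_B(S⁻¹(b)) on the right. -/
theorem proj_antipodeInv_plus {b : A} (hb : b ∈ plus B) : proj B (antipodeInv hS b) = 0 := by
  have h1 := congrArg (LinearMap.mul' k (QuotHopf B) ∘ₗ (TensorProduct.comm k _ _).toLinearMap ∘ₗ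
    ((proj B).toLinearMap ∘ₗ antipodeInv hS).rTensor (QuotHopf B)) (proj_comul B hb.1)
  have h2 : ∀ z : A ⊗[k] A, (LinearMap.mul' k (QuotHopf B) ∘ₗ
      (TensorProduct.comm k _ _).toLinearMap ∘ₗ
      ((proj B).toLinearMap ∘ₗ antipodeInv hS).rTensor (QuotHopf B))
        ((proj B).toLinearMap.lTensor A z) =
      proj B (LinearMap.mul' k A (TensorProduct.comm k A A ((antipodeInv hS).rTensor A z))) := by
    intro z
    induction z with
    | zero => simp
    | tmul x y => simp
    | add x y hx hy => simp only [map_add, hx, hy]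
  rw [h2, mul_antipodeInv_comul, show Coalgebra.counit (R := k) b = 0 from hb.2] at h1
  simpa using h1.symm

theorem proj_antipodeInv_augIdeal {x : A} (hx : x ∈ augIdeal B) :
    proj B (antipodeInv hS x) = 0 := by
  refine augIdeal_induction B (p := fun x => proj B (antipodeInv hS x) = 0) ?_ ?_ hx
  · intro b hb a
    rw [antipodeInv_mul, map_mul, proj_antipodeInv_plus hS B hb, mul_zero]
  · intro x y hx hy
    rw [map_add, map_add, hx, hy, add_zero]

include hS in
/-- The antipode of `π_B(A)` is bijective if the antipode of `A` is. -/
theorem antipode_quotHopf_bijective :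
    Function.Bijective (antipode k : QuotHopf B → QuotHopf B) := by
  constructor
  · refine (injective_iff_map_eq_zero (antipode k : QuotHopf B →ₗ[k] QuotHopf B)).2 ?_
    intro q hq
    obtain ⟨a, rfl⟩ := proj_surjective B q
    rw [← proj_antipode] at hq
    -- If S(a) lies in the ideal B⁺A then so does a = S⁻¹(S(a)), since S⁻¹ maps the ideal into
    -- itself.
    have h := proj_antipodeInv_augIdeal hS B (Ideal.Quotient.eq_zero_iff_mem.1 hq)
    rwa [antipodeInv_antipode] at h
  · intro q
    obtain ⟨a, rfl⟩ := proj_surjective B q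
    obtain ⟨a, rfl⟩ := hS.2 a
    exact ⟨proj B a, rfl⟩

end QuotientAntipode

/-! ### Restriction from P to B, and stability of π_B(P) under the inverse antipode. -/

section Restriction

variable {k : Type*} [Field k] {A : Type u} [Ring A] [HopfAlgebra k A]
  (B P : Subalgebra k A) [IsQuantumHomogeneousSpace B] [IsQuantumHomogeneousSpace P]
  [IsPrincipalPair B P]

variable {P} in
/-- The restriction of a relative Hopf module over `P` to `B`. -/
noncomputable def RelHopfMod.restrict (N : RelHopfMod P) : RelHopfMod B where
  carrier := N.carrier
  modB := Module.compHom N.carrier (incl B P).toRingHom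
  tower := by
    let _ : Module B N.carrier := Module.compHom N.carrier (incl B P).toRingHom
    refine ⟨fun c b n => ?_⟩
    change (incl B P (c • b)) • n = c • (incl B P b • n)
    rw [map_smul, smul_assoc]
  coact := N.coact
  isLeftCoaction := N.isLeftCoaction
  coact_smul b n := by
    let _ : Module B N.carrier := Module.compHom N.carrier (incl B P).toRingHom
    refine (N.coact_smul (incl B P b) n).trans ?_
    rw [coidealComul_incl]
    generalize coidealComul B b = w
    generalize N.coact n = z
    induction w with
    | zero => simp
    | add w w' hw hw' => simp only [map_add, LinearMap.add_apply, hw, hw']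
    | tmul x y =>
      induction z with
      | zero => simp
      | add z z' hz hz' => simp only [map_add, hz, hz']
      | tmul a m => rfl

/-- `P` as a relative Hopf module over itself. -/
noncomputable abbrev RelHopfMod.regular : RelHopfMod P where
  carrier := P
  coact := coidealComul P
  isLeftCoaction := isLeftCoaction_coidealComul P
  coact_smul p q := coidealComul_mul p q

/-- The inclusion of `P` in `A` as a morphism of relative Hopf modules. -/
noncomputable def regularHom :
    (RelHopfMod.regular P).restrict B ⟶ RelHopfMod.self B :=
  RelHopfMod.Hom.mk (M := (RelHopfMod.regular P).restrict B) (N := RelHopfMod.self B)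
    { toFun := fun p => P.val p
      map_add' := fun _ _ => rfl
      map_smul' := fun _ _ => rfl }
    (fun p => (coidealComul_spec P p).symm)

/-- The map `a ↦ a₁ ⊗ π_P(a₂) - a ⊗ 1` as a morphism of relative Hopf modules. -/
noncomputable def projDiffHom :
    RelHopfMod.self B ⟶ (RelHopfMod.self B).tensor (QuotHopf P) :=
  RelHopfMod.Hom.mk (M := RelHopfMod.self B) (N := (RelHopfMod.self B).tensor (QuotHopf P))
    { toFun := fun a => projCoact P a - a ⊗ₜ 1
      map_add' := fun a a' => by
        rw [map_add, TensorProduct.add_tmul]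
        abel
      map_smul' := fun b a => by
        have h := projCoact_smul P (incl B P b) a
        refine (congrArg (· - (b • a) ⊗ₜ[k] (1 : QuotHopf P)) h).trans ?_
        exact (smul_sub (b : A) (projCoact P a) (a ⊗ₜ[k] (1 : QuotHopf P))).symm }
    (fun a => by
      have h1 := projCoact_comul P a
      have h2 : ∀ z : A ⊗[k] A,
          ((TensorProduct.mk k A (QuotHopf P)).flip 1).lTensor A z =
          TensorProduct.assoc k A A (QuotHopf P) (z ⊗ₜ 1) := by
        intro z
        induction z with
        | zero => simp
        | add z z' hz hz' => simp only [map_add, TensorProduct.add_tmul, hz, hz']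
        | tmul x y => rfl
      have h3 := LinearMap.congr_fun (LinearMap.lTensor_sub (M := A) (projCoact P)
        ((TensorProduct.mk k A (QuotHopf P)).flip 1)) (Coalgebra.comul a)
      refine Eq.trans ?_ h3.symm
      rw [LinearMap.sub_apply, h1, h2]
      exact map_sub (freeCoact A (QuotHopf P)) (projCoact P a) (a ⊗ₜ[k] (1 : QuotHopf P)))

/-- P is presented as the kernel of a morphism of relative Hopf modules over B, so that Φ_B can be
applied to it. That the kernel is no larger than P rests on faithful flatness of A over P, through
`mem_of_proj_comul`. -/
theorem regularHom_exact : Function.Exact (RelHopfMod.Hom.lin (regularHom B P))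
    (RelHopfMod.Hom.lin (projDiffHom B P)) := by
  intro a
  constructor
  · intro h
    exact ⟨⟨a, mem_of_proj_comul P (sub_eq_zero.1 h)⟩, rfl⟩
  · rintro ⟨p, rfl⟩
    exact sub_eq_zero.2 (proj_comul P p.2)

/-- `π_B(P)` contains every right `π_P(A)`-coinvariant element of `π_B(A)`. -/
theorem mem_fiber_of_coinv {q : QuotHopf B}
    (hq : (projPair B P).toLinearMap.lTensor (QuotHopf B) (Coalgebra.comul (R := k) q) =
      q ⊗ₜ 1) : q ∈ fiber B P := by
  obtain ⟨a, rfl⟩ := proj_surjective B q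
  have h1 : (proj B).toLinearMap.rTensor (QuotHopf P)
      (projCoact P a - a ⊗ₜ 1) = 0 := by
    rw [map_sub, LinearMap.rTensor_tmul, sub_eq_zero]
    refine Eq.trans ?_ hq
    rw [comul_proj, projCoact, LinearMap.comp_apply]
    generalize Coalgebra.comul (R := k) a = z
    induction z with
    | zero => simp
    | add z z' hz hz' => simp only [map_add, hz, hz']
    | tmul x y => rfl
  have h2 := mkQ_self_tensor_eq_zero h1
  -- Coinvariance of π_B(a) only says that a₁ ⊗ π_P(a₂) - a ⊗ 1 vanishes modulo B⁺A in the first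
  -- factor. Exactness of Φ_B provides an element of P congruent to a modulo B⁺A.
  obtain ⟨x, hx⟩ := (phiMap_exact _ _ (regularHom_exact B P)
    ((plusSub B (RelHopfMod.self B)).mkQ a)).1 h2
  obtain ⟨p, rfl⟩ := Submodule.mkQ_surjective _ x
  refine ⟨P.val p, Subtype.property (p : P), ?_⟩
  have h3 := mem_plusSub_self.1 ((Submodule.Quotient.eq _).1 hx)
  exact Ideal.Quotient.eq.2 h3

/-- `P ∩ B⁺A = B⁺P`. -/
theorem mem_plusSub_regular {p : P} (hp : proj B (p : A) = 0) :
    p ∈ plusSub B ((RelHopfMod.regular P).restrict B) := by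
  have h1 : (plusSub B (RelHopfMod.self B)).mkQ (p : A) = 0 :=
    (Submodule.Quotient.mk_eq_zero _).2
      (mem_plusSub_self.2 (Ideal.Quotient.eq_zero_iff_mem.1 hp))
  -- Φ_B preserves the injectivity of P → A, so P/B⁺P embeds in A/B⁺A.
  refine (Submodule.Quotient.mk_eq_zero _).1 (phiMap_injective (regularHom B P)
    Subtype.val_injective (Eq.trans ?_ (map_zero _).symm))
  exact h1

open HopfAlgebra

variable (hS : Function.Bijective (antipode k : A → A))

theorem projPair_antipode (q : QuotHopf B) :
    projPair B P (antipode k q) = antipode k (projPair B P q) := by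
  obtain ⟨a, rfl⟩ := proj_surjective B q
  rfl

theorem projPair_antipodeInv (q : QuotHopf B) :
    projPair B P (antipodeInv (antipode_quotHopf_bijective hS B) q) =
      antipodeInv (antipode_quotHopf_bijective hS P) (projPair B P q) := by
  apply (antipode_quotHopf_bijective hS P).1
  rw [← projPair_antipode, antipode_antipodeInv, antipode_antipodeInv]

/-- Elements of π_B(P) are left π_P(A)-coinvariant. The inverse antipode reverses the coproduct and
commutes with π_B(A) → π_P(A), so it makes them right coinvariant, and `mem_fiber_of_coinv` applies.
-/
theorem antipodeInv_mem_fiber (t : fiber B P) :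
    antipodeInv (antipode_quotHopf_bijective hS B) (t : QuotHopf B) ∈ fiber B P := by
  apply mem_fiber_of_coinv
  rw [comul_antipodeInv]
  have h : ∀ z : QuotHopf B ⊗[k] QuotHopf B, (projPair B P).toLinearMap.lTensor (QuotHopf B)
      (TensorProduct.comm k _ _ (TensorProduct.map
        (antipodeInv (antipode_quotHopf_bijective hS B))
        (antipodeInv (antipode_quotHopf_bijective hS B)) z)) =
      TensorProduct.comm k _ _ (TensorProduct.map
        (antipodeInv (antipode_quotHopf_bijective hS P))
        (antipodeInv (antipode_quotHopf_bijective hS B))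
        ((projPair B P).toLinearMap.rTensor (QuotHopf B) z)) := by
    intro z
    induction z with
    | zero => simp
    | add z z' hz hz' => simp only [map_add, hz, hz']
    | tmul x y =>
      exact congrArg (_ ⊗ₜ[k] ·) (projPair_antipodeInv B P hS x)
  rw [h, fiber_left_coinv, TensorProduct.map_tmul, antipodeInv_one, TensorProduct.comm_tmul]

/-- The inverse of the antipode of `π_B(P)`. -/
noncomputable def fiberInv : fiber B P →ₗ[k] fiber B P :=
  (antipodeInv (antipode_quotHopf_bijective hS B) ∘ₗ fiberVal B P).codRestrict
    (Subalgebra.toSubmodule (fiber B P)) (antipodeInv_mem_fiber B P hS)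

theorem fiberInv_mul (s t : fiber B P) :
    fiberInv B P hS (s * t) = fiberInv B P hS t * fiberInv B P hS s :=
  Subtype.ext (antipodeInv_mul (antipode_quotHopf_bijective hS B) (s : QuotHopf B) t)

theorem fiberInv_one : fiberInv B P hS 1 = 1 := Subtype.ext
  (antipodeInv_one (antipode_quotHopf_bijective hS B))

theorem counit_fiberInv (t : fiber B P) :
    Coalgebra.counit (R := k) (fiberInv B P hS t) = Coalgebra.counit (R := k) t :=
  counit_antipodeInv (antipode_quotHopf_bijective hS B) (t : QuotHopf B)

theorem comul_fiberInv (t : fiber B P) : Coalgebra.comul (R := k) (fiberInv B P hS t) =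
    TensorProduct.comm k _ _ (TensorProduct.map (fiberInv B P hS) (fiberInv B P hS)
      (Coalgebra.comul (R := k) t)) := by
  apply map_inj (fiberVal_inj B P) (fiberVal_inj B P)
  rw [comul_fiber]
  refine (comul_antipodeInv (antipode_quotHopf_bijective hS B) (t : QuotHopf B)).trans ?_
  rw [← comul_fiber]
  generalize Coalgebra.comul (R := k) t = z
  induction z with
  | zero => simp
  | add z z' hz hz' => simp only [map_add, hz, hz']
  | tmul x y => rfl

theorem swapMul_fiberInv_comul (t : fiber B P) :
    swapMul (fiberInv B P hS) (Coalgebra.comul (R := k) t) =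
      algebraMap k (fiber B P) (Coalgebra.counit (R := k) t) := by
  apply fiberVal_inj B P
  refine Eq.trans ?_
    (swapMul_antipodeInv_comul (antipode_quotHopf_bijective hS B) (t : QuotHopf B))
  rw [← comul_fiber]
  generalize Coalgebra.comul (R := k) t = z
  induction z with
  | zero => simp
  | add z z' hz hz' => simp only [map_add, hz, hz']
  | tmul x y => rfl

end Restriction

/-! ### M/B⁺M as a Hopf module over π_B(P), and its coinvariants. -/

section FiberModule

variable {k : Type*} [Field k] {A : Type u} [Ring A] [HopfAlgebra k A]
  (B P : Subalgebra k A) [IsQuantumHomogeneousSpace B] [IsQuantumHomogeneousSpace P]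
  [IsPrincipalPair B P]

/-- The projection `P → π_B(P)`. -/
def fiberProj : P →ₗ[k] fiber B P :=
  ((proj B).toLinearMap ∘ₗ P.val.toLinearMap).codRestrict
    (Subalgebra.toSubmodule (fiber B P)) (fun p => ⟨p, p.2, rfl⟩)

theorem fiberProj_surjective : Function.Surjective (fiberProj B P) := by
  rintro ⟨_, p, hp, rfl⟩
  exact ⟨⟨p, hp⟩, rfl⟩

theorem fiberProj_mul (p q : P) : fiberProj B P (p * q) = fiberProj B P p * fiberProj B P q :=
  Subtype.ext (map_mul (proj B) (p : A) q)

theorem fiberProj_one : fiberProj B P 1 = 1 := Subtype.ext (map_one (proj B))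

theorem counit_fiberProj (p : P) :
    Coalgebra.counit (R := k) (fiberProj B P p) = Coalgebra.counit (R := k) (p : A) := rfl

/-- Inside π_B(A) ⊗ π_B(A) both sides are (π_B ⊗ π_B)Δ(p): the projection P → π_B(P) is right
colinear. -/
theorem comul_fiberProj (p : P) : Coalgebra.comul (R := k) (fiberProj B P p) =
    (fiberProj B P).rTensor (fiber B P) (pairCoact B P p) := by
  apply map_inj (fiberVal_inj B P) (fiberVal_inj B P)
  rw [comul_fiber]
  refine (comul_proj B (p : A)).trans ?_
  have h1 : ∀ z : A ⊗[k] A, TensorProduct.map (proj B).toLinearMap (proj B).toLinearMap z =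
      (proj B).toLinearMap.rTensor _ ((proj B).toLinearMap.lTensor A z) := fun z =>
    (LinearMap.congr_fun (LinearMap.rTensor_comp_lTensor _ _ _) z).symm
  have h2 := pairCoact_spec B P p
  rw [projCoact, LinearMap.comp_apply] at h2
  rw [h1, ← h2]
  generalize pairCoact B P p = z
  induction z with
  | zero => simp
  | add z z' hz hz' => simp only [map_add, hz, hz']
  | tmul x y => rfl

variable {B P}
variable (M : PairMod B P)

/-- The relative Hopf module over `B` underlying an object of `^A_P Mod^{π_B(P)}`. -/
noncomputable abbrev PairMod.restrict : RelHopfMod B := M.toRelHopfMod.restrict B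

/-- The quotient `M / B⁺M`. -/
abbrev PairMod.Fiber : Type u := M.restrict.carrier ⧸ plusSub B M.restrict

/-- The projection `M → M / B⁺M`. -/
noncomputable def PairMod.toFiber : M.carrier →ₗ[k] M.Fiber := (plusSub B M.restrict).mkQ

theorem PairMod.toFiber_surjective : Function.Surjective M.toFiber :=
  Submodule.mkQ_surjective (plusSub B M.restrict)

theorem PairMod.toFiber_eq_zero {m : M.carrier} : M.toFiber m = 0 ↔ m ∈ plusSub B M.restrict :=
  Submodule.Quotient.mk_eq_zero (plusSub B M.restrict)

theorem PairMod.toFiber_incl_smul (b : B) (m : M.carrier) :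
    M.toFiber (incl B P b • m) = Coalgebra.counit (R := k) (b : A) • M.toFiber m :=
  mkQ_smul B M.restrict b m

/-- (B⁺P)M is contained in B⁺(PM), by associativity of the action. -/
theorem smul_mem_plusSub_of_regular {p : P}
    (hp : p ∈ plusSub B ((RelHopfMod.regular P).restrict B)) (m : M.carrier) :
    p • m ∈ plusSub B M.restrict := by
  have h : plusSub B ((RelHopfMod.regular P).restrict B) ≤
      (plusSub B M.restrict).comap ((act k P M.carrier).flip m) := by
    refine Submodule.span_le.2 ?_
    rintro _ ⟨b, (q : P), hb, rfl⟩
    exact Submodule.subset_span ⟨b, q • m, hb, mul_smul (incl B P b) q m⟩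
  exact h hp

/-- An element of P killed by π_B lies in P ∩ B⁺A = B⁺P, so it sends M into B⁺M. Both parts of the
well-definedness of the π_B(P)-action on M/B⁺M reduce to this. -/
theorem mk_smul_eq_zero {p : P} (hp : proj B (p : A) = 0) (m : M.carrier) :
    M.toFiber (p • m) = 0 :=
  M.toFiber_eq_zero.2 (smul_mem_plusSub_of_regular M (mem_plusSub_regular B P hp) m)

/-- The action of `P` on `M / B⁺M`. -/
noncomputable def fiberActAux : P →ₗ[k] M.Fiber →ₗ[k] M.Fiber :=
  LinearMap.flip ((plusSub B M.restrict).liftQ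
    ((act k P M.carrier).flip.compr₂ M.toFiber) (by
      refine Submodule.span_le.2 ?_
      rintro _ ⟨b, (m : M.carrier), hb, rfl⟩
      refine LinearMap.ext fun p => ?_
      change M.toFiber (p • incl B P b • m) = 0
      rw [← mul_smul]
      -- P need not map B⁺M to itself in an evident way, since b stands to the right of p. But pb is
      -- killed by π_B, as B⁺ generates a two-sided ideal of A.
      refine mk_smul_eq_zero M ?_ m
      change proj B ((p : A) * (b : A)) = 0
      rw [map_mul, proj_eq_zero B (plus_le B hb), mul_zero]))

theorem ker_fiberProj_le : LinearMap.ker (fiberProj B P) ≤ LinearMap.ker (fiberActAux M) := by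
  intro p hp
  refine LinearMap.ext fun w => ?_
  obtain ⟨m, rfl⟩ := M.toFiber_surjective w
  exact mk_smul_eq_zero M (congrArg Subtype.val hp) m

/-- The action of `π_B(P)` on `M / B⁺M`. -/
noncomputable def fiberAct : fiber B P →ₗ[k] M.Fiber →ₗ[k] M.Fiber :=
  (LinearMap.ker (fiberProj B P)).liftQ (fiberActAux M) (ker_fiberProj_le M) ∘ₗ
    ((fiberProj B P).quotKerEquivOfSurjective (fiberProj_surjective B P)).symm.toLinearMap

theorem fiberAct_mk (p : P) (m : M.carrier) :
    fiberAct M (fiberProj B P p) (M.toFiber m) = M.toFiber (p • m) := by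
  have h : ((fiberProj B P).quotKerEquivOfSurjective (fiberProj_surjective B P)).symm
      (fiberProj B P p) = (LinearMap.ker (fiberProj B P)).mkQ p := by
    rw [LinearEquiv.symm_apply_eq]
    rfl
  rw [fiberAct, LinearMap.comp_apply, LinearEquiv.coe_coe, h]
  rfl

theorem fiberAct_one (w : M.Fiber) : fiberAct M 1 w = w := by
  obtain ⟨m, rfl⟩ := M.toFiber_surjective w
  rw [← fiberProj_one, fiberAct_mk, one_smul]

theorem fiberAct_mul (s t : fiber B P) (w : M.Fiber) :
    fiberAct M (s * t) w = fiberAct M s (fiberAct M t w) := by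
  obtain ⟨m, rfl⟩ := M.toFiber_surjective w
  obtain ⟨p, rfl⟩ := fiberProj_surjective B P s
  obtain ⟨q, rfl⟩ := fiberProj_surjective B P t
  rw [← fiberProj_mul, fiberAct_mk, fiberAct_mk, fiberAct_mk, mul_smul]

/-- The right `π_B(P)`-coaction on `M / B⁺M`. -/
noncomputable def fiberCoact : M.Fiber →ₗ[k] M.Fiber ⊗[k] fiber B P :=
  (plusSub B M.restrict).liftQ (M.toFiber.rTensor (fiber B P) ∘ₗ M.rcoact) (by
    refine Submodule.span_le.2 ?_
    rintro _ ⟨b, (m : M.carrier), hb, rfl⟩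
    change M.toFiber.rTensor (fiber B P) (M.rcoact (incl B P b • m)) = 0
    rw [M.rcoact_smul, pairCoact_incl]
    generalize M.rcoact m = z
    induction z with
    | zero => simp
    | add z z' hz hz' => simp only [map_add, hz, hz', add_zero]
    | tmul x t =>
      rw [TensorProduct.map₂_apply_tmul, TensorProduct.map_tmul, LinearMap.rTensor_tmul,
        act_apply, M.toFiber_incl_smul, show Coalgebra.counit (R := k) (b : A) = 0 from hb.2, zero_smul,
        TensorProduct.zero_tmul])

theorem fiberCoact_mk (m : M.carrier) :
    fiberCoact M (M.toFiber m) = M.toFiber.rTensor (fiber B P) (M.rcoact m) := rfl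

theorem isRightCoaction_fiberCoact : IsRightCoaction (fiber B P) (fiberCoact M) where
  coassoc w := by
    obtain ⟨m, rfl⟩ := M.toFiber_surjective w
    exact (M.isRightCoaction.image M.toFiber (fiberCoact_mk M) m).1
  counit w := by
    obtain ⟨m, rfl⟩ := M.toFiber_surjective w
    exact (M.isRightCoaction.image M.toFiber (fiberCoact_mk M) m).2

/-- The Hopf module axiom for M/B⁺M: the compatibility of Δ_R with the P-action on M, reduced modulo
B⁺ with the help of `comul_fiberProj`. -/
theorem fiberCoact_act (t : fiber B P) (w : M.Fiber) : fiberCoact M (fiberAct M t w) =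
    TensorProduct.map₂ (fiberAct M) (LinearMap.mul k (fiber B P)) (Coalgebra.comul t)
      (fiberCoact M w) := by
  obtain ⟨m, rfl⟩ := M.toFiber_surjective w
  obtain ⟨p, rfl⟩ := fiberProj_surjective B P t
  have h := map_map₂ (k := k) (β := act k P M.carrier) (β₁ := fiberAct M)
    (f := fiberProj B P) (g := M.toFiber) (h := M.toFiber) (fun p m => (fiberAct_mk M p m).symm)
    (β' := LinearMap.mul k (fiber B P)) (β₁' := LinearMap.mul k (fiber B P))
    (f' := LinearMap.id) (g' := LinearMap.id) (h' := LinearMap.id) (fun _ _ => rfl)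
    (pairCoact B P p) (M.rcoact m)
  rw [fiberAct_mk, fiberCoact_mk, fiberCoact_mk, M.rcoact_smul, comul_fiberProj]
  exact h

/-- The projection `M / B⁺M → M / P⁺M`. -/
noncomputable def fiberQuot : M.Fiber →ₗ[k] (M.carrier ⧸ plusSub P M.toRelHopfMod) :=
  (plusSub B M.restrict).liftQ (plusSub P M.toRelHopfMod).mkQ (by
    refine Submodule.span_le.2 ?_
    rintro _ ⟨b, m, hb, rfl⟩
    refine (Submodule.Quotient.mk_eq_zero _).2 (Submodule.subset_span ⟨incl B P b, m, ?_, rfl⟩)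
    exact ⟨(incl B P b).2, hb.2⟩)

theorem fiberQuot_mk (m : M.carrier) :
    fiberQuot M (M.toFiber m) = (plusSub P M.toRelHopfMod).mkQ m := rfl

/-- P acts on M/P⁺M through ε. This makes the quotient map one to which `map_twistEval` applies. -/
theorem fiberQuot_act (t : fiber B P) (w : M.Fiber) :
    fiberQuot M (fiberAct M t w) = Coalgebra.counit (R := k) t • fiberQuot M w := by
  obtain ⟨m, rfl⟩ := M.toFiber_surjective w
  obtain ⟨p, rfl⟩ := fiberProj_surjective B P t
  rw [fiberAct_mk, fiberQuot_mk, fiberQuot_mk, mkQ_smul, counit_fiberProj]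

/-- The inclusion of `M^{co(π_B(P))}` in `M` as a morphism of relative Hopf modules. -/
noncomputable def coinvHom : (coinvFunctor B P).obj M ⟶ M.restrict :=
  RelHopfMod.Hom.mk (M := (coinvFunctor B P).obj M) (N := M.restrict)
    { toFun := coinvVal M
      map_add' := map_add _
      map_smul' := fun _ _ => rfl }
    (fun m => (coinvCoact_spec M m).symm)

/-- Elements of B are right coinvariant in P, so Δ_R(bm) = b Δ_R(m) with b acting on the first
factor only. This is the B-linearity of `coinvDiffHom`. -/
theorem coinvDiff_smul (b : B) (m : M.carrier) :
    coinvDiff M (incl B P b • m) =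
      (incl B P b • LinearMap.id (R := k) (M := M.carrier)).rTensor (fiber B P)
        (coinvDiff M m) := by
  rw [coinvDiff, LinearMap.sub_apply, LinearMap.sub_apply, map_sub, M.rcoact_smul, pairCoact_incl]
  congr 1
  generalize M.rcoact m = z
  induction z with
  | zero => simp
  | add z z' hz hz' => simp only [map_add, hz, hz']
  | tmul x t => simp [TensorProduct.map₂_apply_tmul]

/-- Left colinearity of `coinvDiffHom`; the term Δ_R is handled by the bicomodule axiom. -/
theorem coinvDiff_coact (m : M.carrier) :
    tensorCoact (fiber B P) M.coact (coinvDiff M m) =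
      (coinvDiff M).lTensor A (M.coact m) := by
  have h := LinearMap.congr_fun (LinearMap.lTensor_sub (M := A) M.rcoact
    ((TensorProduct.mk k M.carrier (fiber B P)).flip 1)) (M.coact m)
  refine Eq.trans ?_ h.symm
  rw [coinvDiff, LinearMap.sub_apply, LinearMap.sub_apply, map_sub, ← M.bicomodule]
  congr 1
  change TensorProduct.assoc k A M.carrier (fiber B P) (M.coact m ⊗ₜ 1) = _
  generalize M.coact m = z
  induction z with
  | zero => simp
  | add z z' hz hz' => simp only [map_add, TensorProduct.add_tmul, hz, hz']
  | tmul x y => rfl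

/-- The map `m ↦ Δ_R(m) - m ⊗ 1` as a morphism of relative Hopf modules. -/
noncomputable def coinvDiffHom : M.restrict ⟶ M.restrict.tensor (fiber B P) :=
  RelHopfMod.Hom.mk (M := M.restrict) (N := M.restrict.tensor (fiber B P))
    { toFun := coinvDiff M
      map_add' := map_add (coinvDiff M)
      map_smul' := fun b m => by
        refine (coinvDiff_smul M b m).trans ?_
        generalize coinvDiff M m = z
        induction z with
        | zero => exact (map_zero _).trans (smul_zero (A := M.restrict.carrier ⊗[k] fiber B P) b).symm
        | add z z' hz hz' =>
          exact (map_add _ z z').trans ((congrArg₂ (· + ·) hz hz').trans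
            (smul_add (A := M.restrict.carrier ⊗[k] fiber B P) b z z').symm)
        | tmul x y => rfl }
    (coinvDiff_coact M)

theorem fiberCoact_coinvHom (y : Coinv M) :
    fiberCoact M (M.toFiber (coinvVal M y)) = M.toFiber (coinvVal M y) ⊗ₜ 1 := by
  rw [fiberCoact_mk, rcoact_coinvVal, LinearMap.rTensor_tmul]

/-- M^{co} is the kernel of m ↦ Δ_R(m) - m ⊗ 1, a morphism M → M ⊗ π_B(P) of relative Hopf modules
over B. Exactness of Φ_B lifts coinvariants of M/B⁺M to coinvariants of M; `ker_mkQ_rTensor_le`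
passes from Φ_B(M) ⊗ π_B(P) to Φ_B(M ⊗ π_B(P)). -/
theorem exists_coinv_of_fiberCoact {w : M.Fiber} (hw : fiberCoact M w = w ⊗ₜ 1) :
    ∃ m : Coinv M, M.toFiber (coinvVal M m) = w := by
  obtain ⟨m, rfl⟩ := M.toFiber_surjective w
  have h1 : M.toFiber.rTensor (fiber B P) (coinvDiff M m) = 0 := by
    rw [coinvDiff, LinearMap.sub_apply, map_sub, ← fiberCoact_mk, hw]
    exact sub_self _
  have h2 := ker_mkQ_rTensor_le M.restrict (fiber B P) h1
  obtain ⟨x, hx⟩ := (phiMap_exact (coinvHom M) (coinvDiffHom M) (coinvVal_exact M) (M.toFiber m)).1 h2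
  obtain ⟨y, rfl⟩ := Submodule.mkQ_surjective _ x
  exact ⟨y, hx⟩

variable (hS : Function.Bijective (HopfAlgebra.antipode k : A → A))

/-- The map `[m] ↦ S⁻¹(m₁) [m₀]` on `M / B⁺M`. -/
noncomputable def fiberTwist : M.Fiber →ₗ[k] M.Fiber :=
  twistEval (fiberAct M) (fiberInv B P hS) ∘ₗ fiberCoact M

theorem fiberCoact_twist (w : M.Fiber) :
    fiberCoact M (fiberTwist M hS w) = fiberTwist M hS w ⊗ₜ 1 :=
  twistEval_coinv (comul_fiberInv B P hS) (swapMul_fiberInv_comul B P hS) (fiberCoact_act M)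
    (isRightCoaction_fiberCoact M) w

theorem fiberQuot_twist (w : M.Fiber) : fiberQuot M (fiberTwist M hS w) = fiberQuot M w :=
  map_twistEval (fiberQuot M) (fiberQuot_act M) (counit_fiberInv B P hS)
    (isRightCoaction_fiberCoact M) w

theorem fiberTwist_of_coinv {w : M.Fiber} (hw : fiberCoact M w = w ⊗ₜ 1) :
    fiberTwist M hS w = w :=
  twistEval_of_coinv (fiberAct_one M) (fiberInv_one B P hS) hw

theorem fiberTwist_act (t : fiber B P) (w : M.Fiber) :
    fiberTwist M hS (fiberAct M t w) = Coalgebra.counit (R := k) t • fiberTwist M hS w :=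
  twistEval_smul (fiberAct_one M) (fiberAct_mul M) (fiberInv_mul B P hS)
    (swapMul_fiberInv_comul B P hS) (fiberCoact_act M) t w

/-- The projection turns the action of π_B(P) into the counit, which vanishes on the image of P⁺. -/
theorem fiberTwist_mk_eq_zero {m : M.carrier} (hm : m ∈ plusSub P M.toRelHopfMod) :
    fiberTwist M hS (M.toFiber m) = 0 := by
  refine Submodule.span_induction (p := fun m _ => fiberTwist M hS (M.toFiber m) = 0)
    ?_ ?_ ?_ ?_ hm
  · rintro _ ⟨p, m, hp, rfl⟩
    rw [← fiberAct_mk, fiberTwist_act, counit_fiberProj,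
      show Coalgebra.counit (R := k) (p : A) = 0 from hp.2, zero_smul]
  · rw [map_zero, map_zero]
  · intro x y _ _ hx hy
    rw [map_add, map_add, hx, hy, add_zero]
  · intro c x _ hx
    rw [map_smul, map_smul, hx, smul_zero]

include hS in
/-- The map `M^{co(π_B(P))} / B⁺M^{co(π_B(P))} → M / P⁺M` is bijective. -/
theorem fiberQuot_phiMap_coinvHom_bijective :
    Function.Bijective (fiberQuot M ∘ₗ phiMap (coinvHom M)) := by
  constructor
  · rw [injective_iff_map_eq_zero]
    intro x hx
    obtain ⟨y, rfl⟩ := Submodule.mkQ_surjective _ x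
    have h1 : coinvVal M y ∈ plusSub P M.toRelHopfMod := (Submodule.Quotient.mk_eq_zero _).1 hx
    -- The projection kills the class of y, as y lies in P⁺M, and also fixes it, as y is
    -- coinvariant. So y vanishes in M/B⁺M, into which Φ_B(M^{co}) embeds.
    have h2 := fiberTwist_mk_eq_zero M hS h1
    rw [fiberTwist_of_coinv M hS (fiberCoact_coinvHom M y)] at h2
    refine phiMap_injective (coinvHom M) (coinvVal_inj M) (Eq.trans ?_ (map_zero _).symm)
    exact h2
  · intro x
    obtain ⟨m, rfl⟩ := Submodule.mkQ_surjective _ x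
    -- The projected class S⁻¹(m₁)[m₀] is coinvariant, hence comes from a coinvariant y of M, and it
    -- has the same image in M/P⁺M as m.
    obtain ⟨y, hy⟩ := exists_coinv_of_fiberCoact M (fiberCoact_twist M hS (M.toFiber m))
    refine ⟨(plusSub B ((coinvFunctor B P).obj M)).mkQ y, ?_⟩
    refine (congrArg (fiberQuot M) hy).trans ?_
    rw [fiberQuot_twist, fiberQuot_mk]

end FiberModule

/-! ### The adjunction for the pair, and invertibility of its unit and counit. -/

section PairAdjunction

variable {k : Type*} [Field k] {A : Type u} [Ring A] [HopfAlgebra k A]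
  {B P : Subalgebra k A} [IsQuantumHomogeneousSpace B] [IsQuantumHomogeneousSpace P]
  [IsPrincipalPair B P]

section Counit

variable (M : PairMod B P)

/-- The map `P ⊗_B M^{co(π_B(P))} → M` sending `p ⊗ m` to `p m`. -/
noncomputable def pairCounitLin : BalTensor (incl B P) (Coinv M) →ₗ[P] M.carrier :=
  let f : BalTensor (incl B P) (Coinv M) →ₗ[k] M.carrier :=
    balLift (incl B P) ((act k P M.carrier).compl₂ (coinvVal M))
      (fun p b m => mul_smul p (incl B P b) (coinvVal M m))
  { toFun := f
    map_add' := map_add f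
    map_smul' := fun p x => by
      refine bal_induction (incl B P) (p := fun x : BalTensor (incl B P) (Coinv M) => f (p • x) = p • f x) x ?_ ?_ ?_
      · rw [smul_zero, map_zero, smul_zero]
      · intro q m
        exact mul_smul p q (coinvVal M m)
      · intro x y hx hy
        rw [smul_add, map_add, map_add, hx, hy, smul_add] }

theorem pairCounitLin_mk (p : P) (m : Coinv M) :
    pairCounitLin M (balMk (incl B P) p m) = p • coinvVal M m := rfl

theorem pairCounitLin_comm (x : Ind P ((coinvFunctor B P).obj M)) :
    M.coact (pairCounitLin M x) = ((pairCounitLin M).restrictScalars k).lTensor A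
      (indCoact P ((coinvFunctor B P).obj M) x) := by
  let F := M.coact ∘ₗ (pairCounitLin M).restrictScalars k
  let G := ((pairCounitLin M).restrictScalars k).lTensor A ∘ₗ
    indCoact P ((coinvFunctor B P).obj M)
  refine bal_induction (incl B P)
    (p := fun x : BalTensor (incl B P) (Coinv M) => F x = G x) x
    ((map_zero F).trans (map_zero G).symm) ?_ fun x y hx hy =>
      (map_add F x y).trans ((congrArg₂ (· + ·) hx hy).trans (map_add G x y).symm)
  intro p m
  have h := map_map₂ (k := k) (β := LinearMap.mul k A) (β₁ := LinearMap.mul k A)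
    (f := LinearMap.id) (g := LinearMap.id) (h := LinearMap.id) (fun _ _ => rfl)
    (β' := balMk (incl B P)) (β₁' := act k P M.carrier) (f' := LinearMap.id)
    (g' := coinvVal M) (h' := (pairCounitLin M).restrictScalars k)
    (fun p m => pairCounitLin_mk M p m)
    (coidealComul P p) (coinvCoact M m)
  rw [TensorProduct.map_id, LinearMap.id_apply] at h
  refine Eq.trans ?_ h.symm
  change M.coact (p • coinvVal M m) = _
  rw [M.coact_smul, ← coinvCoact_spec]
  rfl

theorem pairCounitLin_rcomm (x : Ind P ((coinvFunctor B P).obj M)) :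
    M.rcoact (pairCounitLin M x) = ((pairCounitLin M).restrictScalars k).rTensor (fiber B P)
      (indRcoact P ((coinvFunctor B P).obj M) x) := by
  let F := M.rcoact ∘ₗ (pairCounitLin M).restrictScalars k
  let G := ((pairCounitLin M).restrictScalars k).rTensor (fiber B P) ∘ₗ
    indRcoact P ((coinvFunctor B P).obj M)
  refine bal_induction (incl B P)
    (p := fun x : BalTensor (incl B P) (Coinv M) => F x = G x) x
    ((map_zero F).trans (map_zero G).symm) ?_ fun x y hx hy =>
      (map_add F x y).trans ((congrArg₂ (· + ·) hx hy).trans (map_add G x y).symm)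
  intro p m
  -- For a coinvariant m the product Δ_R(p) Δ_R(m) is p₀ m ⊗ p₁.
  have h : (TensorProduct.map₂ (act k P M.carrier) (LinearMap.mul k (fiber B P))).flip
      (coinvVal M m ⊗ₜ 1) = ((pairCounitLin M).restrictScalars k).rTensor (fiber B P) ∘ₗ
        ((indMk P ((coinvFunctor B P).obj M)).flip m).rTensor (fiber B P) := by
    refine TensorProduct.ext' fun x t => ?_
    exact congrArg ((x • coinvVal M m) ⊗ₜ[k] ·) (mul_one t)
  change M.rcoact (p • coinvVal M m) = _
  rw [M.rcoact_smul, rcoact_coinvVal]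
  refine (LinearMap.congr_fun h (pairCoact B P p)).trans ?_
  exact (congrArg (((pairCounitLin M).restrictScalars k).rTensor (fiber B P))
    (indRcoact_mk P ((coinvFunctor B P).obj M) p m)).symm

/-- The counit `P ⊗_B M^{co(π_B(P))} → M`. -/
noncomputable def pairCounit : (indFunctor B P).obj ((coinvFunctor B P).obj M) ⟶ M :=
  PairMod.Hom.mk (M := (indFunctor B P).obj ((coinvFunctor B P).obj M)) (N := M)
    (pairCounitLin M) (pairCounitLin_comm M) (pairCounitLin_rcomm M)

end Counit

section Unit

variable (P)
variable (N : RelHopfMod B)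

theorem indRcoact_one (n : N.carrier) :
    indRcoact P N (indMk P N 1 n) = indMk P N 1 n ⊗ₜ 1 := by
  have h := pairCoact_incl B P 1
  rw [map_one] at h
  rw [indRcoact_mk, h]
  rfl

/-- The map `N → (P ⊗_B N)^{co(π_B(P))}` sending `n` to `1 ⊗ n`. -/
noncomputable def pairUnitLin : N.carrier →ₗ[B] Coinv ((indFunctor B P).obj N) where
  toFun n := ⟨indMk P N 1 n, (mem_coinvSub _ _).2 (indRcoact_one P N n)⟩
  map_add' n n' := Subtype.ext (map_add (indMk P N 1) n n')
  map_smul' b n := Subtype.ext (by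
    change indMk P N 1 (b • n) = indMk P N (incl B P b * 1) n
    rw [← balMk_mul, one_mul, mul_one])

theorem coinvVal_pairUnitLin (n : N.carrier) :
    coinvVal ((indFunctor B P).obj N) (pairUnitLin P N n) = indMk P N 1 n := rfl

theorem pairUnitLin_comm (n : N.carrier) :
    coinvCoact ((indFunctor B P).obj N) (pairUnitLin P N n) =
      ((pairUnitLin P N).restrictScalars k).lTensor A (N.coact n) := by
  apply lTensor_inj A (coinvVal_inj ((indFunctor B P).obj N))
  rw [coinvCoact_spec, coinvVal_pairUnitLin]
  refine (indCoact_mk P N 1 n).trans ?_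
  have h : coidealComul P 1 = 1 ⊗ₜ 1 := by
    apply lTensor_inj A (f := P.val.toLinearMap) Subtype.val_injective
    rw [coidealComul_spec]
    exact Bialgebra.comul_one
  have h2 : TensorProduct.map₂ (LinearMap.mul k A) (indMk P N) (1 ⊗ₜ 1) =
      (coinvVal ((indFunctor B P).obj N)).lTensor A ∘ₗ
        ((pairUnitLin P N).restrictScalars k).lTensor A := by
    refine TensorProduct.ext' fun a n => ?_
    rw [TensorProduct.map₂_apply_tmul, TensorProduct.map_tmul, LinearMap.mul_apply', one_mul]
    rfl
  rw [h]
  exact LinearMap.congr_fun h2 (N.coact n)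

/-- The unit `N → (P ⊗_B N)^{co(π_B(P))}`. -/
noncomputable def pairUnit : N ⟶ (coinvFunctor B P).obj ((indFunctor B P).obj N) :=
  RelHopfMod.Hom.mk (N := (coinvFunctor B P).obj ((indFunctor B P).obj N)) (pairUnitLin P N)
    (pairUnitLin_comm P N)

end Unit

variable (B P)

/-- The adjunction between `P ⊗_B -` and `(-)^{co(π_B(P))}`. -/
noncomputable def pairAdjunction : indFunctor B P ⊣ coinvFunctor B P :=
  Adjunction.mkOfUnitCounit
    { unit :=
        { app := fun N => pairUnit P N
          naturality := fun _ _ _ => rfl }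
      counit :=
        { app := fun M => pairCounit M
          naturality := fun M M' f => by
            refine PairMod.Hom.ext (LinearMap.ext fun x => ?_)
            refine bal_induction (incl B P) (p := fun x =>
              pairCounitLin M' (balMap (incl B P) (coinvMap f) x) =
                PairMod.Hom.lin f (pairCounitLin M x)) x (by simp) ?_ ?_
            · intro p m
              exact ((PairMod.Hom.lin f).map_smul p (coinvVal M m)).symm
            · intro x y hx hy
              rw [map_add, map_add, map_add, map_add, hx, hy] }
      left_triangle := by
        ext N : 2
        refine PairMod.Hom.ext (LinearMap.ext fun x => ?_)
        refine bal_induction (incl B P) (p := fun x =>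
          pairCounitLin ((indFunctor B P).obj N) (balMap (incl B P) (pairUnitLin P N) x) = x) x
          (by simp; rfl) ?_ ?_
        · intro p n
          change balMk (incl B P) (p * 1) n = _
          rw [mul_one]
        · intro x y hx hy
          rw [map_add, map_add, hx, hy]
          rfl
      right_triangle := by
        ext M : 2
        refine RelHopfMod.Hom.ext (LinearMap.ext fun m => Subtype.ext ?_)
        exact one_smul P (coinvVal M m) }

variable {B}

section FiberInd

variable (N : RelHopfMod B)

/-- The relative Hopf module `P ⊗_B N` over `P`. -/
noncomputable abbrev indRel : RelHopfMod P := ((indFunctor B P).obj N).toRelHopfMod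

/-- The map `N / B⁺N → (P ⊗_B N) / P⁺(P ⊗_B N)` sending `[n]` to `[1 ⊗ n]`. -/
noncomputable def fiberInd : (N.carrier ⧸ plusSub B N) →ₗ[k]
    ((indRel P N).carrier ⧸ plusSub P (indRel P N)) :=
  (plusSub B N).liftQ ((plusSub P (indRel P N)).mkQ ∘ₗ indMk P N 1) (by
    refine Submodule.span_le.2 ?_
    rintro _ ⟨b, n, hb, rfl⟩
    refine (Submodule.Quotient.mk_eq_zero _).2
      (Submodule.subset_span ⟨incl B P b, indMk P N 1 n, ⟨(incl B P b).2, hb.2⟩, ?_⟩)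
    change indMk P N 1 (b • n) = indMk P N (incl B P b * 1) n
    rw [← balMk_mul, one_mul, mul_one])

theorem fiberInd_mk (n : N.carrier) : fiberInd P N ((plusSub B N).mkQ n) =
    (plusSub P (indRel P N)).mkQ (indMk P N 1 n) := rfl

/-- The map `P ⊗_B N → N / B⁺N` sending `p ⊗ n` to `ε(p) [n]`. -/
noncomputable def counitInd : Ind P N →ₗ[k] (N.carrier ⧸ plusSub B N) :=
  balLift (incl B P) ((LinearMap.lsmul k _).compl₁₂
    (Coalgebra.counit (R := k) (A := A) ∘ₗ P.val.toLinearMap) (plusSub B N).mkQ) (by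
      intro p b n
      change Coalgebra.counit (R := k) ((p : A) * (b : A)) • (plusSub B N).mkQ n =
        Coalgebra.counit (R := k) (p : A) • (plusSub B N).mkQ (b • n)
      rw [mkQ_smul, Bialgebra.counit_mul, mul_smul])

theorem counitInd_mk (p : P) (n : N.carrier) : counitInd P N (indMk P N p n) =
    Coalgebra.counit (R := k) (p : A) • (plusSub B N).mkQ n := rfl

theorem counitInd_smul (p : P) (x : Ind P N) :
    counitInd P N (p • x) = Coalgebra.counit (R := k) (p : A) • counitInd P N x := by
  refine bal_induction (incl B P) (p := fun x : Ind P N => counitInd P N (p • x) =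
    Coalgebra.counit (R := k) (p : A) • counitInd P N x) x (by simp) ?_ ?_
  · intro q n
    change Coalgebra.counit (R := k) ((p : A) * (q : A)) • (plusSub B N).mkQ n = _
    rw [Bialgebra.counit_mul, mul_smul]
    rfl
  · intro x y hx hy
    rw [smul_add, map_add, map_add, hx, hy, smul_add]

/-- Modulo P⁺ the class of p ⊗ n is ε(p)[1 ⊗ n], which gives surjectivity; p ⊗ n ↦ ε(p)[n] induces a
left inverse. -/
theorem fiberInd_bijective : Function.Bijective (fiberInd P N) := by
  constructor
  · let g : ((indRel P N).carrier ⧸ plusSub P (indRel P N)) →ₗ[k] (N.carrier ⧸ plusSub B N) :=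
      (plusSub P (indRel P N)).liftQ (counitInd P N) (by
        refine Submodule.span_le.2 ?_
        rintro _ ⟨p, x, hp, rfl⟩
        refine (counitInd_smul P N p x).trans ?_
        rw [show Coalgebra.counit (R := k) (p : A) = 0 from hp.2, zero_smul])
    refine Function.LeftInverse.injective (g := g) fun x => ?_
    obtain ⟨n, rfl⟩ := Submodule.mkQ_surjective _ x
    refine (counitInd_mk P N 1 n).trans ?_
    rw [OneMemClass.coe_one, Bialgebra.counit_one, one_smul]
  · intro x
    obtain ⟨y, rfl⟩ := Submodule.mkQ_surjective _ x
    refine bal_induction (incl B P) (p := fun y => ∃ a, fiberInd P N a =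
      (plusSub P (indRel P N)).mkQ y) y ⟨0, (map_zero _).trans (map_zero _).symm⟩ ?_ ?_
    · intro p n
      refine ⟨Coalgebra.counit (R := k) (p : A) • (plusSub B N).mkQ n, ?_⟩
      rw [map_smul, fiberInd_mk]
      refine (mkQ_smul P (indRel P N) p (indMk P N 1 n)).symm.trans ?_
      change (plusSub P (indRel P N)).mkQ (indMk P N (p * 1) n) = _
      rw [mul_one]
    · rintro x y ⟨a, ha⟩ ⟨b, hb⟩
      exact ⟨a + b, by rw [map_add, ha, hb]; exact (map_add _ x y).symm⟩

end FiberInd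

variable {P}

/-- The morphism of relative Hopf modules over `P` underlying a morphism of
`^A_P Mod^{π_B(P)}`. -/
noncomputable def PairMod.Hom.toRel {M M' : PairMod B P} (f : M ⟶ M') :
    M.toRelHopfMod ⟶ M'.toRelHopfMod :=
  RelHopfMod.Hom.mk (PairMod.Hom.lin f) (PairMod.Hom.comm f)

/-- Naturality of the identification of Φ_P(P ⊗_B N) with Φ_B(N). -/
theorem phiMap_toRel_ind {N N' : RelHopfMod B} (f : N ⟶ N') (x : N.carrier ⧸ plusSub B N) :
    phiMap (PairMod.Hom.toRel ((indFunctor B P).map f)) (fiberInd P N x) =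
      fiberInd P N' (phiMap f x) := by
  obtain ⟨n, rfl⟩ := Submodule.mkQ_surjective _ x
  rfl

/-- Under the identification of Φ_P(P ⊗_B M^{co}) with Φ_B(M^{co}), the counit becomes the natural
map M^{co}/B⁺M^{co} → M/P⁺M, since [1 ⊗ m] goes to [m]. -/
theorem phiMap_toRel_counit (M : PairMod B P)
    (x : Coinv M ⧸ plusSub B ((coinvFunctor B P).obj M)) :
    phiMap (PairMod.Hom.toRel (pairCounit M)) (fiberInd P ((coinvFunctor B P).obj M) x) =
      fiberQuot M (phiMap (coinvHom M) x) := by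
  obtain ⟨m, rfl⟩ := Submodule.mkQ_surjective _ x
  refine congrArg (plusSub P M.toRelHopfMod).mkQ ?_
  exact one_smul P (coinvVal M m)

variable (hS : Function.Bijective (HopfAlgebra.antipode k : A → A))

include hS in
-- Φ_P of the counit is the bijection M^{co}/B⁺M^{co} → M/P⁺M up to the bijection `fiberInd`, and
-- Φ_P reflects bijectivity.
theorem pairCounit_bijective (M : PairMod B P) :
    Function.Bijective (PairMod.Hom.lin (pairCounit M)) := by
  refine bijective_of_phiMap (PairMod.Hom.toRel (pairCounit M)) ?_
  have h1 := fiberQuot_phiMap_coinvHom_bijective M hS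
  have h2 := fiberInd_bijective P ((coinvFunctor B P).obj M)
  have h3 : phiMap (PairMod.Hom.toRel (pairCounit M)) ∘ fiberInd P ((coinvFunctor B P).obj M) =
      fiberQuot M ∘ₗ phiMap (coinvHom M) := funext (phiMap_toRel_counit M)
  rw [← h3] at h1
  exact (Function.Bijective.of_comp_iff _ h2).1 h1

include hS in
-- By the triangle identity, the bijectivity of the counit passes to P ⊗_B (unit). Its image under
-- Φ_P is Φ_B of the unit, and Φ_B reflects bijectivity. Faithful flatness of P over B is not needed
-- for this descent.
theorem pairUnit_bijective (N : RelHopfMod B) :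
    Function.Bijective (RelHopfMod.Hom.lin (pairUnit P N)) := by
  have h1 := pairCounit_bijective hS ((indFunctor B P).obj N)
  have h2 : PairMod.Hom.lin (pairCounit ((indFunctor B P).obj N)) ∘
      PairMod.Hom.lin ((indFunctor B P).map (pairUnit P N)) = id := by
    have h := (pairAdjunction B P).left_triangle_components N
    exact funext fun x => LinearMap.congr_fun (congrArg PairMod.Hom.lin h) x
  have h3 : Function.Bijective (PairMod.Hom.lin ((indFunctor B P).map (pairUnit P N))) :=
    (Function.Bijective.of_comp_iff' h1 _).1 (h2 ▸ Function.bijective_id)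
  have h4 : Function.Bijective
      (phiMap (PairMod.Hom.toRel ((indFunctor B P).map (pairUnit P N)))) := by
    -- A bijective morphism is an isomorphism, and the functor Φ_P preserves isomorphisms.
    let e := RelHopfMod.isoOfBijective (PairMod.Hom.toRel ((indFunctor B P).map (pairUnit P N))) h3
    let e' := (takeuchiPhi P).mapIso e
    refine Function.bijective_iff_has_inverse.2 ⟨LeftComod.Hom.lin e'.inv, ?_, ?_⟩
    · exact fun x => LinearMap.congr_fun (congrArg LeftComod.Hom.lin e'.hom_inv_id) x
    · exact fun x => LinearMap.congr_fun (congrArg LeftComod.Hom.lin e'.inv_hom_id) x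
  refine bijective_of_phiMap _ ((Function.Bijective.of_comp_iff'
    (fiberInd_bijective P _) _).1 ?_)
  have h5 : fiberInd P _ ∘ phiMap (pairUnit P N) =
      -- Naturality of `fiberInd` transfers bijectivity from Φ_P(P ⊗_B unit) to Φ_B(unit).
      phiMap (PairMod.Hom.toRel ((indFunctor B P).map (pairUnit P N))) ∘ fiberInd P N :=
    funext fun x => (phiMap_toRel_ind (pairUnit P N) x).symm
  rw [h5]
  exact h4.comp (fiberInd_bijective P N)

/-- A bijective morphism of `^A_P Mod^{π_B(P)}` is an isomorphism. -/
theorem PairMod.isIso_of_bijective {M M' : PairMod B P} (f : M ⟶ M')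
    (hf : Function.Bijective (PairMod.Hom.lin f)) : IsIso f := by
  let e := LinearEquiv.ofBijective _ hf
  have he : ∀ m, e.symm (PairMod.Hom.lin f m) = m := e.symm_apply_apply
  refine ⟨PairMod.Hom.mk e.symm.toLinearMap ?_ ?_, ?_, ?_⟩
  · intro m
    obtain ⟨n, rfl⟩ := hf.2 m
    refine (congrArg M.coact (he n)).trans ?_
    rw [PairMod.Hom.comm]
    generalize M.coact n = z
    induction z with
    | zero => simp
    | add z z' hz hz' =>
      simp only [map_add]
      rw [← hz, ← hz']
    | tmul x y => exact congrArg (x ⊗ₜ[k] ·) (he y).symm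
  · intro m
    obtain ⟨n, rfl⟩ := hf.2 m
    refine (congrArg M.rcoact (he n)).trans ?_
    rw [PairMod.Hom.rcomm]
    generalize M.rcoact n = z
    induction z with
    | zero => simp
    | add z z' hz hz' =>
      simp only [map_add]
      rw [← hz, ← hz']
    | tmul x y => exact congrArg (· ⊗ₜ[k] y) (he x).symm
  · exact PairMod.Hom.ext (LinearMap.ext he)
  · exact PairMod.Hom.ext (LinearMap.ext e.apply_symm_apply)

include hS in
theorem isIso_pairAdjunction_unit : IsIso (pairAdjunction B P).unit := by
  have : ∀ N, IsIso ((pairAdjunction B P).unit.app N) := fun N =>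
    (RelHopfMod.isoOfBijective (pairUnit P N) (pairUnit_bijective hS N)).isIso_hom
  exact NatIso.isIso_of_isIso_app _

include hS in
theorem isIso_pairAdjunction_counit : IsIso (pairAdjunction B P).counit := by
  have : ∀ M, IsIso ((pairAdjunction B P).counit.app M) := fun M =>
    PairMod.isIso_of_bijective (pairCounit M) (pairCounit_bijective hS M)
  exact NatIso.isIso_of_isIso_app _

/-- The equivalence between `^A_B Mod` and `^A_P Mod^{π_B(P)}`. -/
noncomputable def pairEquivalence : RelHopfMod B ≌ PairMod B P :=
  haveI := isIso_pairAdjunction_unit (P := P) (B := B) hS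
  haveI := isIso_pairAdjunction_counit (P := P) (B := B) hS
  haveI : ∀ N, IsIso ((pairAdjunction B P).unit.app N) := fun _ => inferInstance
  haveI : ∀ M, IsIso ((pairAdjunction B P).counit.app M) := fun _ => inferInstance
  (pairAdjunction B P).toEquivalence

end PairAdjunction

end HopfPair

theorem mainTheorem7 {A : Type u} [Ring A] [HopfAlgebra ℂ A]
    (hS : Function.Bijective (HopfAlgebra.antipode ℂ : A → A))
    (B P : Subalgebra ℂ A) [IsQuantumHomogeneousSpace B] [IsQuantumHomogeneousSpace P]
    [IsPrincipalPair B P] :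
    (∃ adj : indFunctor B P ⊣ coinvFunctor B P,
      (∀ (N : RelHopfMod B) (n : N.carrier),
        coinvVal ((indFunctor B P).obj N) (RelHopfMod.Hom.lin (adj.unit.app N) n) =
          indMk P N 1 n) ∧
      (∀ (M : PairMod B P) (p : P) (m : Coinv M),
        PairMod.Hom.lin (adj.counit.app M) (indMk P ((coinvFunctor B P).obj M) p m) =
          p • coinvVal M m) ∧
      IsIso adj.unit ∧ IsIso adj.counit) ∧
    (∃ e : PairMod B P ≌ LeftComod ℂ (QuotHopf B),
      e.functor = coinvFunctor B P ⋙ takeuchiPhi B ∧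
      e.inverse = takeuchiPsi B ⋙ indFunctor B P) :=
  ⟨⟨pairAdjunction B P, fun _ _ => rfl, fun _ _ _ => rfl,
    isIso_pairAdjunction_unit hS, isIso_pairAdjunction_counit hS⟩,
    -- Passing through the category over B, the composite equivalence has the two prescribed
    -- functors by definition.
    (pairEquivalence hS).symm.trans (takeuchiEquivalence B), rfl, rfl⟩
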